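/- Consider the following decision problem (generalized Subset Feedback Vertex Set in split graphs). An instance $(G,T,M,k)$ consists of a split graph $G=(V,E)$ (a finite simple graph whose vertex set can be partitioned into an independent set and a clique), a set $T\subseteq V$ of terminals, a set $M\subseteq E$ of marked edges, and an integer $k\ge 0$. The question is whether there is a set $S\subseteq V$ with $|S|\le k$ such that $G-S$ contains no edge of $M$ and no cycle passing through a vertex of $T$. This problem can be solved in time $\mathcal{O}^{*}(1.820^{k})$. That is, there are a deterministic algorithm and constants $C,d$ such that the algorithm, on every instance $(G,T,M,k)$ with $G$ a split graph on $n$ vertices, gives the correct answer after at most $C\,(n+1)^{d}\cdot 1.820^{k}$ steps. -/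

import Mathlib

namespace SFVS

/-! ## The machine model: a WHILE language on binary trees, with a step count -/

/-- The data that programs work on: finite binary trees (built from `nil` by pairing). -/
inductive Data : Type where
  | nil : Data
  | cons : Data → Data → Data

namespace Data

/-- The number of nodes of a tree (inner nodes and leaves). -/
def size : Data → ℕ
  | nil => 1
  | cons a b => 1 + a.size + b.size

/-- The head of a tree; the head of `nil` is `nil`. -/
def hd : Data → Data
  | nil => nil
  | cons a _ => a

/-- The tail of a tree; the tail of `nil` is `nil`. -/
def tl : Data → Data
  | nil => nil
  | cons _ b => b

/-- Truth values: `nil` is false, `cons nil nil` is true. -/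
def ofBool : Bool → Data
  | false => nil
  | true => cons nil nil

/-- Lists, nested to the right. -/
def ofList : List Data → Data
  | [] => nil
  | a :: l => cons a (ofList l)

/-- Natural numbers in unary. -/
def ofNat : ℕ → Data
  | 0 => nil
  | m + 1 => cons nil (ofNat m)

end Data

/-- Programs. A program transforms one tree into another one. -/
inductive Prog : Type where
  /-- return the input -/
  | id : Prog
  /-- return `nil` -/
  | nil : Prog
  /-- return the head of the input -/
  | hd : Prog
  /-- return the tail of the input -/
  | tl : Prog
  /-- run both programs on the input and pair the two results -/
  | cons : Prog → Prog → Prog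
  /-- run the first program, then the second one on its result -/
  | seq : Prog → Prog → Prog
  /-- run the first program as a test: if its result is not `nil`, run the second program on
  the input, otherwise the third one -/
  | ite : Prog → Prog → Prog → Prog
  /-- `while c f`: as long as the test `c` does not return `nil` on the current tree,
  replace this tree by the result of `f` on it -/
  | while : Prog → Prog → Prog

/-- `Runs p x y t`: the program `p` halts on the input `x` with the output `y` after `t` elementary
steps. Every construct that is executed is charged with the size of the tree it is applied to (so
reading, copying or forgetting a tree is never free, and `t` is at least the size of every tree
that occurs in the computation). -/
inductive Runs : Prog → Data → Data → ℕ → Prop where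
  | id (x : Data) : Runs Prog.id x x x.size
  | nil (x : Data) : Runs Prog.nil x Data.nil x.size
  | hd (x : Data) : Runs Prog.hd x x.hd x.size
  | tl (x : Data) : Runs Prog.tl x x.tl x.size
  | cons {f g : Prog} {x a b : Data} {s t : ℕ} :
      Runs f x a s → Runs g x b t → Runs (Prog.cons f g) x (Data.cons a b) (x.size + s + t)
  | seq {f g : Prog} {x y z : Data} {s t : ℕ} :
      Runs f x y s → Runs g y z t → Runs (Prog.seq f g) x z (x.size + s + t)
  | ite_true {c f g : Prog} {x u v y : Data} {s t : ℕ} :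
      Runs c x (Data.cons u v) s → Runs f x y t → Runs (Prog.ite c f g) x y (x.size + s + t)
  | ite_false {c f g : Prog} {x y : Data} {s t : ℕ} :
      Runs c x Data.nil s → Runs g x y t → Runs (Prog.ite c f g) x y (x.size + s + t)
  | while_stop {c f : Prog} {x : Data} {s : ℕ} :
      Runs c x Data.nil s → Runs (Prog.while c f) x x (x.size + s)
  | while_step {c f : Prog} {x u v y z : Data} {s t r : ℕ} :
      Runs c x (Data.cons u v) s → Runs f x y t → Runs (Prog.while c f) y z r →
      Runs (Prog.while c f) x z (x.size + s + t + r)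

/-- The model is deterministic: output and step count are determined by program and input. -/
theorem Runs.deterministic {p : Prog} {x y y' : Data} {t t' : ℕ}
    (h : Runs p x y t) (h' : Runs p x y' t') : y = y' ∧ t = t' := by
  induction h generalizing y' t' with
  | id x => cases h'; exact ⟨rfl, rfl⟩
  | nil x => cases h'; exact ⟨rfl, rfl⟩
  | hd x => cases h'; exact ⟨rfl, rfl⟩
  | tl x => cases h'; exact ⟨rfl, rfl⟩
  | cons _ _ ih₁ ih₂ =>
    cases h' with
    | cons k₁ k₂ =>
      obtain ⟨rfl, rfl⟩ := ih₁ k₁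
      obtain ⟨rfl, rfl⟩ := ih₂ k₂
      exact ⟨rfl, rfl⟩
  | seq _ _ ih₁ ih₂ =>
    cases h' with
    | seq k₁ k₂ =>
      obtain ⟨rfl, rfl⟩ := ih₁ k₁
      obtain ⟨rfl, rfl⟩ := ih₂ k₂
      exact ⟨rfl, rfl⟩
  | ite_true _ _ ih₁ ih₂ =>
    cases h' with
    | ite_true k₁ k₂ =>
      obtain ⟨_, rfl⟩ := ih₁ k₁
      obtain ⟨rfl, rfl⟩ := ih₂ k₂
      exact ⟨rfl, rfl⟩
    | ite_false k₁ k₂ => exact absurd (ih₁ k₁).1 (by simp)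
  | ite_false _ _ ih₁ ih₂ =>
    cases h' with
    | ite_true k₁ k₂ => exact absurd (ih₁ k₁).1 (by simp)
    | ite_false k₁ k₂ =>
      obtain ⟨_, rfl⟩ := ih₁ k₁
      obtain ⟨rfl, rfl⟩ := ih₂ k₂
      exact ⟨rfl, rfl⟩
  | while_stop _ ih₁ =>
    cases h' with
    | while_stop k₁ =>
      obtain ⟨_, rfl⟩ := ih₁ k₁
      exact ⟨rfl, rfl⟩
    | while_step k₁ k₂ k₃ => exact absurd (ih₁ k₁).1 (by simp)
  | while_step _ _ _ ih₁ ih₂ ih₃ =>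
    cases h' with
    | while_stop k₁ => exact absurd (ih₁ k₁).1 (by simp)
    | while_step k₁ k₂ k₃ =>
      obtain ⟨_, rfl⟩ := ih₁ k₁
      obtain ⟨rfl, rfl⟩ := ih₂ k₂
      obtain ⟨rfl, rfl⟩ := ih₃ k₃
      exact ⟨rfl, rfl⟩

/-! ## Subset feedback vertex sets, with marked edges -/

/-- A split graph: the vertex set is partitioned into an independent set and a clique. -/
def IsSplit {V : Type*} (G : SimpleGraph V) : Prop :=
  ∃ I K : Set V, Disjoint I K ∧ I ∪ K = Set.univ ∧ G.IsIndepSet I ∧ G.IsClique K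

/-- An instance `(G, T, M, k)`: a simple graph on the vertices `0, …, n - 1`, a terminal set,
a set of marked edges, and the parameter. -/
structure Instance (n : ℕ) where
  /-- the graph -/
  graph : SimpleGraph (Fin n)
  /-- the terminals -/
  terminals : Set (Fin n)
  /-- the marked edges -/
  marked : Set (Sym2 (Fin n))
  /-- marked edges are edges of the graph -/
  marked_subset : marked ⊆ graph.edgeSet
  /-- the bound on the size of a solution -/
  k : ℕ

/-- `G - S` contains no cycle through a terminal. -/
def IsSubsetFVS {V : Type*} (G : SimpleGraph V) (T S : Set V) : Prop :=
  ∀ (v : ↥Sᶜ) (c : (G.induce Sᶜ).Walk v v), c.IsCycle → ∀ u ∈ c.support, (u : V) ∉ T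

namespace Instance

variable {n : ℕ}

/-- A solution: a subset feedback vertex set that also covers all marked edges. -/
def IsSolution (J : Instance n) (S : Finset (Fin n)) : Prop :=
  IsSubsetFVS J.graph J.terminals (S : Set (Fin n)) ∧ ∀ e ∈ J.marked, ∃ v ∈ e, v ∈ S

/-- A Yes-instance: there is a solution of size at most `k`. -/
def IsYes (J : Instance n) : Prop :=
  ∃ S : Finset (Fin n), S.card ≤ J.k ∧ J.IsSolution S

/-- The truth value of a proposition, as a tree. -/
noncomputable def bit (P : Prop) : Data :=
  open Classical in Data.ofBool (decide P)

/-- A binary relation on `Fin n` as a 0-1 matrix, given by the list of its rows. -/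
noncomputable def matrix (r : Fin n → Fin n → Prop) : Data :=
  Data.ofList (List.ofFn fun u => Data.ofList (List.ofFn fun v => bit (r u v)))

/-- The input that a program receives: the list consisting of the adjacency matrix of the graph,
the characteristic vector of the terminals, the matrix of the marked edges, and `k` in unary. -/
noncomputable def encode (J : Instance n) : Data :=
  Data.ofList
    [matrix J.graph.Adj,
      Data.ofList (List.ofFn fun v => bit (v ∈ J.terminals)),
      matrix (fun u v => s(u, v) ∈ J.marked),
      Data.ofNat J.k]

end Instance

end SFVS

/-! In a split graph every vertex of a cycle lies in a triangle (`exists_triangle_of_isCycle`), so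
only triangles with a terminal and marked edges have to be hit. Fix a split partition. If a solution
keeps a terminal of the clique, it keeps at most two clique vertices, and all such pairs can be
tested. Otherwise all clique terminals are deleted, and what remains is a covering problem: the
items are the other clique vertices, and each independent vertex is a clause that is violated, at
the price of one deletion, if an untolerated item or two tolerated items are kept. Marked edges
inside the clique become doubled clauses (`Input.prep_correct`).

A clause with at most one tolerated item is inactive: it is satisfied iff all its untolerated items
are deleted. The inactive clauses and the items thus form a bipartite vertex cover problem, whose
optimum `tau` is a polynomial-time lower bound for the cost (`cost_eq`). It is found by an auction,
with prices in the role of a dual solution (`tau_le_cover`, `exists_cover_eq_tau`). By submodularity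
of covers it is safe to delete the crown, a maximal set of items in a minimum cover
(`exists_del_crown`). Once the crown is empty, every cover that uses an item costs more than `tau`.

The search branches on keeping or deleting an item `x` that an active clause tolerates
(`branch_correct`). Its progress is measured by three times the budget, minus twice the lower bound,
minus the size of the crown. Keeping `x` makes active clauses inactive, which raises the lower bound
or creates a crown. Deleting items in a crown-free state also gains on the lower bound. Unless
keeping `x` is safe, one branch lowers the measure by at least 3 and the other by at least 4
(`measure_pushKeep`, `branch_pot`). So the search tree has at most `(items + 1) * β ^ (3 * k)` nodes
as soon as `β + 1 ≤ β ^ 4`, and the cube root of 1.820 satisfies this inequality (`exists_base`).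

For the machine model, `PT` collects the functions computed by programs in polynomial time. Its
closure properties are registered with `fun_prop`, so that each ingredient of the algorithm is
certified by unfolding. The tree is searched depth first with an explicit stack of polynomial size
(`exists_search_prog`). -/

namespace SFVS

/-! ## Polynomial-time functions between encoded types -/

/-- Types whose elements are represented by trees. -/
class Enc (α : Type) where
  /-- the representation -/
  enc : α → Data

open Enc

instance : Enc Bool := ⟨Data.ofBool⟩
instance : Enc ℕ := ⟨Data.ofNat⟩
instance : Enc Unit := ⟨fun _ => Data.nil⟩
instance {α β : Type} [Enc α] [Enc β] : Enc (α × β) := ⟨fun p => Data.cons (enc p.1) (enc p.2)⟩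
instance {α : Type} [Enc α] : Enc (List α) := ⟨fun l => Data.ofList (l.map enc)⟩

/-- The size of the representation. -/
def sz {α : Type} [Enc α] (a : α) : ℕ := (enc a).size

/-! ### Sizes of encodings. -/

section size

variable {α β : Type} [Enc α] [Enc β]

theorem Data.size_pos (x : Data) : 1 ≤ x.size := by cases x <;> simp [Data.size]; omega

theorem sz_pos (a : α) : 1 ≤ sz a := Data.size_pos _

@[simp] theorem enc_nil : enc ([] : List α) = Data.nil := rfl

@[simp] theorem enc_cons (a : α) (l : List α) : enc (a :: l) = Data.cons (enc a) (enc l) := rfl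

@[simp] theorem enc_pair (a : α) (b : β) : enc (a, b) = Data.cons (enc a) (enc b) := rfl

@[simp] theorem sz_nil : sz ([] : List α) = 1 := rfl

@[simp] theorem sz_cons (a : α) (l : List α) : sz (a :: l) = 1 + sz a + sz l := rfl

@[simp] theorem sz_pair (a : α) (b : β) : sz (a, b) = 1 + sz a + sz b := rfl

theorem sz_prod (p : α × β) : sz p = 1 + sz p.1 + sz p.2 := rfl

@[simp] theorem sz_unit (u : Unit) : sz u = 1 := rfl

theorem sz_bool_le (b : Bool) : sz b ≤ 3 := by cases b <;> simp [sz, enc, Data.ofBool, Data.size]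

/-- Unary numerals and lists of units are the same trees, so a loop with a computed number of rounds
is a fold over a list that costs nothing to build. -/
theorem enc_nat_eq (m : ℕ) : enc m = enc (List.replicate m ()) := by
  induction m with
  | zero => rfl
  | succ m ih => rw [List.replicate_succ, enc_cons, ← ih]; rfl

theorem sz_nat (m : ℕ) : sz m = 2 * m + 1 := by
  induction m with
  | zero => rfl
  | succ m ih =>
    have : sz (m + 1) = 1 + 1 + sz m := rfl
    omega

theorem sz_append (l l' : List α) : sz (l ++ l') + 1 = sz l + sz l' := by
  induction l with
  | nil => simp; omega
  | cons a l ih => simp; omega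

theorem sz_sublist {l l' : List α} (h : l.Sublist l') : sz l ≤ sz l' := by
  induction h with
  | slnil => exact le_rfl
  | cons a _ ih => simp; omega
  | cons_cons a _ ih => simp; omega

theorem sz_le_of_mem {a : α} {l : List α} (h : a ∈ l) : sz a ≤ sz l := by
  have := sz_sublist (List.singleton_sublist.2 h)
  simp at this
  omega

theorem length_le_sz (l : List α) : l.length ≤ sz l := by
  induction l with
  | nil => simp
  | cons a l ih => simp; omega

theorem sz_map_le {f : α → β} {l : List α} (h : ∀ a ∈ l, sz (f a) ≤ sz a) :
    sz (l.map f) ≤ sz l := by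
  induction l with
  | nil => simp
  | cons a l ih =>
    have h1 := h a (by simp)
    have h2 := ih fun b hb => h b (by simp [hb])
    simp; omega

end size

/-- Every construct is charged with the size of its tree, so time bounds are size bounds. This
controls the input of the second program in a composition. -/
theorem Runs.size_le {p : Prog} {x y : Data} {t : ℕ} (h : Runs p x y t) :
    x.size ≤ t ∧ y.size ≤ t := by
  induction h with
  | id x => exact ⟨le_rfl, le_rfl⟩
  | nil x => exact ⟨le_rfl, Data.size_pos x⟩
  | hd x => refine ⟨le_rfl, ?_⟩; cases x <;> simp [Data.hd, Data.size]; omega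
  | tl x => refine ⟨le_rfl, ?_⟩; cases x <;> simp [Data.tl, Data.size]
  | @cons _ _ x _ _ _ _ _ _ ih₁ ih₂ =>
    have := Data.size_pos x
    simp only [Data.size]; omega
  | seq _ _ ih₁ ih₂ => omega
  | ite_true _ _ ih₁ ih₂ => omega
  | ite_false _ _ ih₁ ih₂ => omega
  | while_stop _ ih₁ => omega
  | while_step _ _ _ ih₁ ih₂ ih₃ => omega

/-- Coefficients in `ℕ` make evaluation monotone; time bounds are taken from `Polynomial ℕ` for this
reason. -/
theorem eval_monotone (b : Polynomial ℕ) : Monotone fun s => b.eval s := by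
  intro s t h
  induction b using Polynomial.induction_on' with
  | add p q hp hq => simpa using add_le_add hp hq
  | monomial n a => simp only [Polynomial.eval_monomial]; gcongr

theorem eval_le_pow (b : Polynomial ℕ) : ∃ c d : ℕ, ∀ s, b.eval s ≤ c * (s + 1) ^ d := by
  induction b using Polynomial.induction_on' with
  | add p q hp hq =>
    obtain ⟨c, d, h⟩ := hp
    obtain ⟨c', d', h'⟩ := hq
    refine ⟨c + c', d + d', fun s => ?_⟩
    have e1 : (s + 1) ^ d ≤ (s + 1) ^ (d + d') := Nat.pow_le_pow_right (by omega) (by omega)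
    have e2 : (s + 1) ^ d' ≤ (s + 1) ^ (d + d') := Nat.pow_le_pow_right (by omega) (by omega)
    have h1 := (h s).trans (Nat.mul_le_mul_left c e1)
    have h2 := (h' s).trans (Nat.mul_le_mul_left c' e2)
    rw [Polynomial.eval_add, add_mul]
    omega
  | monomial n a =>
    refine ⟨a, n, fun s => ?_⟩
    simp only [Polynomial.eval_monomial]
    gcongr
    omega

/-- A function is polynomial-time computable by a program. -/
@[fun_prop]
def PT {α β : Type} [Enc α] [Enc β] (f : α → β) : Prop :=
  ∃ (p : Prog) (b : Polynomial ℕ), ∀ a, ∃ t, Runs p (enc a) (enc (f a)) t ∧ t ≤ b.eval (sz a)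

/-! ### Closure of polynomial-time functions under the basic constructions. -/

namespace PT

variable {α β γ δ : Type} [Enc α] [Enc β] [Enc γ] [Enc δ]

theorem size_le {f : α → β} (hf : PT f) : ∃ b : Polynomial ℕ, ∀ a, sz (f a) ≤ b.eval (sz a) := by
  obtain ⟨p, b, h⟩ := hf
  refine ⟨b, fun a => ?_⟩
  obtain ⟨t, h1, h2⟩ := h a
  exact h1.size_le.2.trans h2

/-- Functions with the same representations of arguments and values. -/
theorem of_enc_eq {f : α → β} (hf : PT f) (g : γ → δ) (i : γ → α) (hi : ∀ c, enc c = enc (i c))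
    (h : ∀ c, enc (g c) = enc (f (i c))) : PT g := by
  obtain ⟨p, b, hp⟩ := hf
  refine ⟨p, b, fun c => ?_⟩
  rw [hi, h, sz, hi]
  exact hp (i c)

@[fun_prop]
theorem id : PT (fun a : α => a) :=
  ⟨Prog.id, Polynomial.X, fun a => ⟨_, Runs.id _, by simp [sz]⟩⟩

theorem exists_const (d : Data) : ∃ (p : Prog) (c : ℕ), ∀ x, ∃ t, Runs p x d t ∧ t ≤ c * x.size := by
  induction d with
  | nil => exact ⟨Prog.nil, 1, fun x => ⟨_, Runs.nil x, by simp⟩⟩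
  | cons a b iha ihb =>
    obtain ⟨p, c, hp⟩ := iha
    obtain ⟨q, e, hq⟩ := ihb
    refine ⟨Prog.cons p q, 1 + c + e, fun x => ?_⟩
    obtain ⟨s, h1, h2⟩ := hp x
    obtain ⟨t, h3, h4⟩ := hq x
    exact ⟨_, Runs.cons h1 h3, by rw [add_mul, add_mul]; omega⟩

@[fun_prop]
theorem const (y : β) : PT (fun _ : α => y) := by
  obtain ⟨p, c, h⟩ := exists_const (enc y)
  refine ⟨p, Polynomial.C c * Polynomial.X, fun a => ?_⟩
  obtain ⟨t, h1, h2⟩ := h (enc a)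
  exact ⟨t, h1, by simpa [sz] using h2⟩

@[fun_prop]
theorem comp {g : β → γ} {f : α → β} (hg : PT g) (hf : PT f) : PT (fun a => g (f a)) := by
  obtain ⟨p, b, hp⟩ := hg
  obtain ⟨q, e, hq⟩ := hf
  refine ⟨Prog.seq q p, Polynomial.X + e + b.comp e, fun a => ?_⟩
  obtain ⟨s, h1, h2⟩ := hq a
  obtain ⟨t, h3, h4⟩ := hp (f a)
  refine ⟨_, Runs.seq h1 h3, ?_⟩
  have h5 : b.eval (sz (f a)) ≤ b.eval (e.eval (sz a)) := eval_monotone b (h1.size_le.2.trans h2)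
  simp only [Polynomial.eval_add, Polynomial.eval_X, Polynomial.eval_comp, sz] at *
  omega

theorem of_cons {f : α → β} {g : α → γ} (hf : PT f) (hg : PT g) (k : α → δ)
    (hk : ∀ a, enc (k a) = Data.cons (enc (f a)) (enc (g a))) : PT k := by
  obtain ⟨p, b, hp⟩ := hf
  obtain ⟨q, e, hq⟩ := hg
  refine ⟨Prog.cons p q, Polynomial.X + b + e, fun a => ?_⟩
  obtain ⟨s, h1, h2⟩ := hp a
  obtain ⟨t, h3, h4⟩ := hq a
  refine ⟨_, hk a ▸ Runs.cons h1 h3, ?_⟩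
  simp only [Polynomial.eval_add, Polynomial.eval_X, sz] at *
  omega

@[fun_prop]
theorem pair {f : α → β} {g : α → γ} (hf : PT f) (hg : PT g) : PT (fun a => (f a, g a)) :=
  of_cons hf hg _ fun _ => rfl

@[fun_prop]
theorem cons {f : α → β} {g : α → List β} (hf : PT f) (hg : PT g) : PT (fun a => f a :: g a) :=
  of_cons hf hg _ fun _ => rfl

-- The unit is encoded as `nil`, and pairing `nil` in front of a unary numeral adds one.
@[fun_prop]
theorem succ {f : α → ℕ} (hf : PT f) : PT (fun a => f a + 1) :=
  of_cons (const ()) hf _ fun _ => rfl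

theorem of_hd {f : α → β} (hf : PT f) (k : β → γ) (hk : ∀ b, enc (k b) = (enc b).hd) :
    PT (fun a => k (f a)) :=
  comp (g := k) ⟨Prog.hd, Polynomial.X, fun b => ⟨_, hk b ▸ Runs.hd _, by simp [sz]⟩⟩ hf

theorem of_tl {f : α → β} (hf : PT f) (k : β → γ) (hk : ∀ b, enc (k b) = (enc b).tl) :
    PT (fun a => k (f a)) :=
  comp (g := k) ⟨Prog.tl, Polynomial.X, fun b => ⟨_, hk b ▸ Runs.tl _, by simp [sz]⟩⟩ hf

@[fun_prop]
theorem fst {f : α → β × γ} (hf : PT f) : PT (fun a => (f a).1) := of_hd hf _ fun _ => rfl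

@[fun_prop]
theorem snd {f : α → β × γ} (hf : PT f) : PT (fun a => (f a).2) := of_tl hf _ fun _ => rfl

@[fun_prop]
theorem pred {f : α → ℕ} (hf : PT f) : PT (fun a => (f a).pred) :=
  of_tl hf _ fun n => by cases n <;> rfl

@[fun_prop]
theorem tail {f : α → List β} (hf : PT f) : PT (fun a => (f a).tail) :=
  of_tl hf _ fun n => by cases n <;> rfl

@[fun_prop]
theorem headD_nat {f : α → List ℕ} (hf : PT f) : PT (fun a => (f a).headD 0) :=
  of_hd hf (fun l => l.headD 0) fun n => by cases n <;> rfl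

@[fun_prop]
theorem headD_bool {f : α → List Bool} (hf : PT f) : PT (fun a => (f a).headD false) :=
  of_hd hf (fun l => l.headD false) fun n => by cases n <;> rfl

@[fun_prop]
theorem headD_list {f : α → List (List β)} (hf : PT f) : PT (fun a => (f a).headD []) :=
  of_hd hf (fun l => l.headD []) fun n => by cases n <;> rfl

@[fun_prop]
theorem replicate {f : α → ℕ} (hf : PT f) : PT (fun a => List.replicate (f a) ()) := by
  refine comp (g := fun n : ℕ => List.replicate n ()) ?_ hf
  exact of_enc_eq (f := fun n : ℕ => n) id _ (fun n => n) (fun _ => rfl)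
    (fun n => (enc_nat_eq n).symm)

/-- Case distinction by a test whose value is represented like a truth value. -/
theorem of_test {δ : Type} [Enc δ] {c : α → δ} {f g k : α → β} (hc : PT c) (hf : PT f) (hg : PT g)
    (h : ∀ a, (∃ u v, enc (c a) = Data.cons u v ∧ k a = f a) ∨ enc (c a) = Data.nil ∧ k a = g a) :
    PT k := by
  obtain ⟨p, b, hp⟩ := hc
  obtain ⟨q, e, hq⟩ := hf
  obtain ⟨r, d, hr⟩ := hg
  refine ⟨Prog.ite p q r, Polynomial.X + b + e + d, fun a => ?_⟩
  obtain ⟨s, h1, h2⟩ := hp a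
  obtain ⟨t, h3, h4⟩ := hq a
  obtain ⟨t', h5, h6⟩ := hr a
  rcases h a with ⟨u, v, huv, hk⟩ | ⟨huv, hk⟩
  · refine ⟨_, hk ▸ Runs.ite_true (huv ▸ h1) h3, ?_⟩
    simp only [Polynomial.eval_add, Polynomial.eval_X, sz] at *
    omega
  · refine ⟨_, hk ▸ Runs.ite_false (huv ▸ h1) h5, ?_⟩
    simp only [Polynomial.eval_add, Polynomial.eval_X, sz] at *
    omega

@[fun_prop]
theorem cond {c : α → Bool} {f g : α → β} (hc : PT c) (hf : PT f) (hg : PT g) :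
    PT (fun a => bif c a then f a else g a) := by
  refine of_test hc hf hg fun a => ?_
  cases c a
  · exact Or.inr ⟨rfl, rfl⟩
  · exact Or.inl ⟨_, _, rfl, rfl⟩

@[fun_prop]
theorem isEmpty {l : α → List β} (hl : PT l) : PT (fun a => (l a).isEmpty) := by
  refine of_test (f := fun _ => false) (g := fun _ => true) hl (const _) (const _) fun a => ?_
  cases l a
  · exact Or.inr ⟨rfl, rfl⟩
  · exact Or.inl ⟨_, _, rfl, rfl⟩

@[fun_prop]
theorem not {f : α → Bool} (hf : PT f) : PT (fun a => !f a) := by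
  convert cond hf (const false) (const true) using 2 with a
  cases f a <;> rfl

@[fun_prop]
theorem and {f g : α → Bool} (hf : PT f) (hg : PT g) : PT (fun a => f a && g a) := by
  convert cond hf hg (const false) using 2 with a
  cases f a <;> rfl

@[fun_prop]
theorem or {f g : α → Bool} (hf : PT f) (hg : PT g) : PT (fun a => f a || g a) := by
  convert cond hf (const true) hg using 2 with a
  cases f a <;> rfl

/-- Case distinction on a list. -/
@[fun_prop]
theorem listCases {l : α → List β} {f : α → γ} {g : α → β → List β → γ}
    (hl : PT l) (hf : PT f) (hg : PT (fun p : α × β × List β => g p.1 p.2.1 p.2.2)) :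
    PT (fun a => List.casesOn (motive := fun _ => γ) (l a) (f a) (g a)) := by
  obtain ⟨p, b, hp⟩ := hg
  have hh : PT (fun a => (a, l a)) := pair id hl
  refine comp (f := fun a => (a, l a))
    (g := fun q : α × List β => List.casesOn (motive := fun _ => γ) q.2 (f q.1) (g q.1)) ?_ hh
  obtain ⟨q, e, hq⟩ := hf.comp (f := fun q : α × List β => q.1) (fst id)
  -- On the pair of `a` and the list, `Prog.tl` returns the list, whose code is `nil` exactly if it
  -- is empty. For a nonempty list the same tree is also the code of the triple `(a, x, xs)`, so `p`
  -- can be run without any conversion.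
  refine ⟨Prog.ite Prog.tl p q, 2 * Polynomial.X + b + e, ?_⟩
  rintro ⟨a, _ | ⟨x, xs⟩⟩
  · obtain ⟨t, h1, h2⟩ := hq (a, [])
    refine ⟨_, Runs.ite_false (Runs.tl _) h1, ?_⟩
    simp only [Polynomial.eval_add, Polynomial.eval_X, Polynomial.eval_mul, sz,
      Polynomial.eval_ofNat] at *
    omega
  · obtain ⟨t, h1, h2⟩ := hp (a, x, xs)
    refine ⟨_, Runs.ite_true (Runs.tl _) h1, ?_⟩
    simp only [Polynomial.eval_add, Polynomial.eval_X, Polynomial.eval_mul, sz,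
      Polynomial.eval_ofNat] at *
    simp only [enc_pair, enc_cons] at *
    omega

end PT

/-- A loop that stops after `n` rounds. -/
theorem runs_while {σ : Type} [Enc σ] {c f : Prog} {cond : σ → Bool} {step : σ → σ}
    {bc bf : Polynomial ℕ}
    (hc : ∀ s, ∃ t, Runs c (enc s) (enc (cond s)) t ∧ t ≤ bc.eval (sz s))
    (hf : ∀ s, ∃ t, Runs f (enc s) (enc (step s)) t ∧ t ≤ bf.eval (sz s))
    (n B : ℕ) (s : σ) (hcont : ∀ i < n, cond (step^[i] s) = true)
    (hlast : cond (step^[n] s) = false) (hB : ∀ i ≤ n, sz (step^[i] s) ≤ B) :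
    ∃ t, Runs (Prog.while c f) (enc s) (enc (step^[n] s)) t ∧
      t ≤ (n + 1) * (B + bc.eval B + bf.eval B) := by
  induction n generalizing s with
  | zero =>
    obtain ⟨t, h1, h2⟩ := hc s
    have hs : sz s ≤ B := hB 0 le_rfl
    have hm := eval_monotone bc hs
    simp only [Function.iterate_zero, id_eq] at hlast hm
    rw [hlast] at h1
    refine ⟨_, Runs.while_stop h1, ?_⟩
    simp only [sz] at *
    omega
  | succ n ih =>
    obtain ⟨t, h1, h2⟩ := hc s
    obtain ⟨t', h3, h4⟩ := hf s
    have hs : sz s ≤ B := hB 0 (by omega)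
    have hm := eval_monotone bc hs
    have hm' := eval_monotone bf hs
    have h0 : cond s = true := hcont 0 (by omega)
    rw [h0] at h1
    obtain ⟨r, h5, h6⟩ := ih (step s) (fun i hi => hcont (i + 1) (by omega)) hlast
      (fun i hi => hB (i + 1) (by omega))
    refine ⟨_, Runs.while_step h1 h3 h5, ?_⟩
    have : (n + 1 + 1) * (B + bc.eval B + bf.eval B)
      = (n + 1) * (B + bc.eval B + bf.eval B) + (B + bc.eval B + bf.eval B) := by ring
    simp only [sz] at *
    omega

/-! ### Loops over lists, and arithmetic. -/

namespace PT

variable {α β γ δ : Type} [Enc α] [Enc β] [Enc γ] [Enc δ]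

/-- The loop runs on triples of parameter, accumulator and remaining list. Polynomially many
polynomial-time rounds may still produce exponentially large trees, hence the hypothesis on the
accumulator after every prefix. -/
theorem foldl_of_bound {g : α → γ → β → γ} {l : α → List β} {i : α → γ}
    (hg : PT (fun p : α × γ × β => g p.1 p.2.1 p.2.2)) (hl : PT l) (hi : PT i) (b : Polynomial ℕ)
    (hb : ∀ a l₁ l₂, l a = l₁ ++ l₂ → sz (l₁.foldl (g a) (i a)) ≤ b.eval (sz a)) :
    PT (fun a => (l a).foldl (g a) (i a)) := by
  let step : α × γ × List β → α × γ × List β := fun s =>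
    List.casesOn (motive := fun _ => α × γ × List β) s.2.2 s (fun x xs => (s.1, g s.1 s.2.1 x, xs))
  have hstep : PT step := by
    refine listCases (by fun_prop) (by fun_prop) ?_
    refine pair (by fun_prop) (pair ?_ (by fun_prop))
    exact hg.comp (f := fun p : (α × γ × List β) × β × List β => (p.1.1, p.1.2.1, p.2.1))
      (by fun_prop)
  let test : α × γ × List β → Bool := fun s => !s.2.2.isEmpty
  have htest : PT test := by fun_prop
  obtain ⟨c, bc, hc⟩ := htest
  obtain ⟨f, bf, hf⟩ := hstep
  obtain ⟨bl, hbl⟩ := hl.size_le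
  have key : PT (fun a => (a, (l a).foldl (g a) (i a), ([] : List β))) := by
    obtain ⟨p, e, hp⟩ : PT (fun a => (a, i a, l a)) := by fun_prop
    let S : Polynomial ℕ := 2 + Polynomial.X + b + bl
    refine ⟨Prog.seq p (Prog.while c f),
      Polynomial.X + e + (bl + 1) * (S + bc.comp S + bf.comp S), fun a => ?_⟩
    obtain ⟨t, h1, h2⟩ := hp a
    have hit : ∀ l₁ l₂, l a = l₁ ++ l₂ →
        step^[l₁.length] (a, i a, l a) = (a, l₁.foldl (g a) (i a), l₂) := by
      intro l₁
      induction l₁ using List.reverseRecOn with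
      | nil => intro l₂ h; simp [h]
      | append_singleton l₁ x ih =>
        intro l₂ h
        have := ih (x :: l₂) (by simp [h])
        rw [List.length_append, List.length_singleton, Function.iterate_succ_apply', this,
          List.foldl_append]
        rfl
    have hit' : ∀ n ≤ (l a).length, step^[n] (a, i a, l a)
        = (a, ((l a).take n).foldl (g a) (i a), (l a).drop n) := by
      intro n hn
      have := hit ((l a).take n) ((l a).drop n) (List.take_append_drop _ _).symm
      rwa [List.length_take, min_eq_left hn] at this
    obtain ⟨r, h3, h4⟩ := runs_while hc hf (l a).length (S.eval (sz a)) (a, i a, l a)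
      (fun n hn => by
        rw [hit' n hn.le]
        simp [test, hn])
      (by rw [hit' _ le_rfl]; simp [test])
      (fun n hn => by
        rw [hit' n hn]
        have e1 := hb a _ _ (List.take_append_drop n (l a)).symm
        have e2 : sz ((l a).drop n) ≤ sz (l a) := sz_sublist (List.drop_sublist _ _)
        have e3 := hbl a
        simp [S]
        omega)
    rw [hit' _ le_rfl] at h3
    simp only [List.take_length, List.drop_length] at h3
    refine ⟨_, Runs.seq h1 h3, ?_⟩
    have e1 : (l a).length ≤ bl.eval (sz a) := (length_le_sz _).trans (hbl a)
    have e2 := Nat.mul_le_mul_right (S.eval (sz a) + bc.eval (S.eval (sz a))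
      + bf.eval (S.eval (sz a))) (Nat.add_le_add_right e1 1)
    simp only [Polynomial.eval_add, Polynomial.eval_X, Polynomial.eval_mul, Polynomial.eval_one,
      Polynomial.eval_comp, sz] at *
    omega
  exact comp (g := fun s : α × γ × List β => s.2.1) (by fun_prop) key

/-- Loops over a list whose accumulator grows by a polynomially bounded amount per round. -/
theorem foldl {g : α → γ → β → γ} {l : α → List β} {i : α → γ}
    (hg : PT (fun p : α × γ × β => g p.1 p.2.1 p.2.2)) (hl : PT l) (hi : PT i)
    (hb : ∃ b : Polynomial ℕ, ∀ a c x, sz (g a c x) ≤ sz c + b.eval (sz (a, x))) :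
    PT (fun a => (l a).foldl (g a) (i a)) := by
  obtain ⟨b, hb⟩ := hb
  obtain ⟨bl, hbl⟩ := hl.size_le
  obtain ⟨bi, hbi⟩ := hi.size_le
  refine foldl_of_bound hg hl hi (bi + bl * b.comp (1 + Polynomial.X + bl)) fun a l₁ l₂ h => ?_
  have key : ∀ l' : List β, (∀ x ∈ l', x ∈ l a) → sz (l'.foldl (g a) (i a))
      ≤ bi.eval (sz a) + l'.length * b.eval (1 + sz a + bl.eval (sz a)) := by
    intro l'
    induction l' using List.reverseRecOn with
    | nil => intro _; simpa using hbi a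
    | append_singleton l' x ih =>
      intro hx
      have h1 := ih fun y hy => hx y (by simp [hy])
      have h2 := hb a (l'.foldl (g a) (i a)) x
      have h3 : sz (a, x) ≤ 1 + sz a + bl.eval (sz a) := by
        have := (sz_le_of_mem (hx x (by simp))).trans (hbl a)
        simpa using this
      have h4 := eval_monotone b h3
      simp only [List.foldl_append, List.foldl_cons, List.foldl_nil, List.length_append,
        List.length_singleton, add_mul, one_mul] at *
      omega
  have h1 := key l₁ fun x hx => by simp [h, hx]
  have h2 : l₁.length ≤ bl.eval (sz a) := by
    have h3 := (length_le_sz (l a)).trans (hbl a)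
    have h4 : (l a).length = l₁.length + l₂.length := by rw [h, List.length_append]
    omega
  simp only [Polynomial.eval_add, Polynomial.eval_mul, Polynomial.eval_comp, Polynomial.eval_one,
    Polynomial.eval_X]
  exact h1.trans (Nat.add_le_add_left (Nat.mul_le_mul_right _ h2) _)

@[fun_prop]
theorem reverse {l : α → List β} (hl : PT l) : PT (fun a => (l a).reverse) := by
  have : PT (fun a => (l a).foldl (fun c x => x :: c) []) := by
    refine foldl (g := fun _ c x => x :: c) (by fun_prop) hl (by fun_prop)
      ⟨Polynomial.X, fun a c x => ?_⟩
    simp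
    omega
  simpa using this

@[fun_prop]
theorem map {l : α → List β} {f : α → β → γ} (hf : PT (fun p : α × β => f p.1 p.2)) (hl : PT l) :
    PT (fun a => (l a).map (f a)) := by
  obtain ⟨b, hb⟩ := hf.size_le
  have : PT (fun a => ((l a).foldl (fun c x => f a x :: c) []).reverse) := by
    refine reverse (foldl (g := fun a c x => f a x :: c) ?_ hl (by fun_prop)
      ⟨b + 1, fun a c x => ?_⟩)
    · exact cons (hf.comp (f := fun p : α × List γ × β => (p.1, p.2.2)) (by fun_prop)) (by fun_prop)
    · have := hb (a, x)
      simp at *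
      omega
  convert this using 2 with a
  have : ∀ (l : List β) (c : List γ), l.foldl (fun c x => f a x :: c) c = (l.map (f a)).reverse ++ c := by
    intro l
    induction l with
    | nil => simp
    | cons x l ih => intro c; simp [ih]
  simp [this]

@[fun_prop]
theorem filter {l : α → List β} {f : α → β → Bool} (hf : PT (fun p : α × β => f p.1 p.2))
    (hl : PT l) : PT (fun a => (l a).filter (f a)) := by
  have : PT (fun a => ((l a).foldl (fun c x => bif f a x then x :: c else c) []).reverse) := by
    refine reverse (foldl (g := fun a c x => bif f a x then x :: c else c) ?_ hl (by fun_prop)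
      ⟨Polynomial.X, fun a c x => ?_⟩)
    · exact cond (hf.comp (f := fun p : α × List β × β => (p.1, p.2.2)) (by fun_prop))
        (by fun_prop) (by fun_prop)
    · cases f a x <;> simp
      omega
  convert this using 2 with a
  have : ∀ (l : List β) (c : List β), l.foldl (fun c x => bif f a x then x :: c else c) c
      = (l.filter (f a)).reverse ++ c := by
    intro l
    induction l with
    | nil => simp
    | cons x l ih => intro c; cases h : f a x <;> simp [ih, h]
  simp [this]

@[fun_prop]
theorem any {l : α → List β} {f : α → β → Bool} (hf : PT (fun p : α × β => f p.1 p.2))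
    (hl : PT l) : PT (fun a => (l a).any (f a)) := by
  convert not (isEmpty (filter hf hl)) using 2 with a
  rw [Bool.eq_iff_iff]
  simp

@[fun_prop]
theorem all {l : α → List β} {f : α → β → Bool} (hf : PT (fun p : α × β => f p.1 p.2))
    (hl : PT l) : PT (fun a => (l a).all (f a)) := by
  convert isEmpty (filter (f := fun a x => !f a x) (not hf) hl) using 2 with a
  rw [Bool.eq_iff_iff]
  simp

@[fun_prop]
theorem length {l : α → List β} (hl : PT l) : PT (fun a => (l a).length) := by
  have : PT (fun a => (l a).foldl (fun c _ => c + 1) 0) := by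
    refine foldl (g := fun _ c _ => c + 1) (by fun_prop) hl (by fun_prop) ⟨2, fun a c x => ?_⟩
    simp [sz_nat]
    omega
  convert this using 2 with a
  have : ∀ (l : List β) (c : ℕ), l.foldl (fun c _ => c + 1) c = c + l.length := by
    intro l
    induction l with
    | nil => simp
    | cons x l ih => intro c; simp [ih]; omega
  simp [this]

@[fun_prop]
theorem countP {l : α → List β} {f : α → β → Bool} (hf : PT (fun p : α × β => f p.1 p.2))
    (hl : PT l) : PT (fun a => (l a).countP (f a)) := by
  convert length (filter hf hl) using 2 with a
  exact List.countP_eq_length_filter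

@[fun_prop]
theorem append {l l' : α → List β} (hl : PT l) (hl' : PT l') : PT (fun a => l a ++ l' a) := by
  have : PT (fun a => (l a).reverse.foldl (fun c x => x :: c) (l' a)) := by
    refine foldl (g := fun _ c x => x :: c) (by fun_prop) (by fun_prop) hl'
      ⟨Polynomial.X, fun a c x => ?_⟩
    simp
    omega
  simpa using this

@[fun_prop]
theorem flatMap {l : α → List β} {f : α → β → List γ} (hf : PT (fun p : α × β => f p.1 p.2))
    (hl : PT l) : PT (fun a => (l a).flatMap (f a)) := by
  obtain ⟨b, hb⟩ := hf.size_le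
  have : PT (fun a => (l a).foldl (fun c x => c ++ f a x) []) := by
    refine foldl (g := fun a c x => c ++ f a x) ?_ hl (by fun_prop) ⟨b, fun a c x => ?_⟩
    · exact append (by fun_prop) (hf.comp (f := fun p : α × List γ × β => (p.1, p.2.2)) (by fun_prop))
    · have h1 := hb (a, x)
      have h2 := sz_append c (f a x)
      simp only at h1
      omega
  convert this using 2 with a
  have : ∀ (l : List β) (c : List γ), l.foldl (fun c x => c ++ f a x) c = c ++ l.flatMap (f a) := by
    intro l
    induction l with
    | nil => simp
    | cons x l ih => intro c; simp [ih]
  simp [this]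

@[fun_prop]
theorem sub {f g : α → ℕ} (hf : PT f) (hg : PT g) : PT (fun a => f a - g a) := by
  have : PT (fun a => (List.replicate (g a) ()).foldl (fun c _ => c.pred) (f a)) := by
    refine foldl (g := fun _ c (_ : Unit) => c.pred) (by fun_prop) (replicate hg) hf ⟨0, fun a c x => ?_⟩
    simp [sz_nat]
  convert this using 2 with a
  induction g a with
  | zero => rfl
  | succ n ih =>
    rw [List.replicate_succ', List.foldl_append, ← ih]
    rfl

@[fun_prop]
theorem add {f g : α → ℕ} (hf : PT f) (hg : PT g) : PT (fun a => f a + g a) := by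
  have : PT (fun a => (List.replicate (g a) ()).foldl (fun c _ => c + 1) (f a)) := by
    refine foldl (g := fun _ c (_ : Unit) => c + 1) (by fun_prop) (replicate hg) hf ⟨2, fun a c x => ?_⟩
    simp [sz_nat]
    omega
  convert this using 2 with a
  induction g a with
  | zero => rfl
  | succ n ih =>
    rw [List.replicate_succ', List.foldl_append, ← ih]
    rfl

@[fun_prop]
theorem mul {f g : α → ℕ} (hf : PT f) (hg : PT g) : PT (fun a => f a * g a) := by
  have : PT (fun a => ((List.replicate (f a) ()).flatMap
      fun _ => List.replicate (g a) ()).length) := by fun_prop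
  convert this using 2 with a
  simp [List.length_flatMap]

@[fun_prop]
theorem decide_le {f g : α → ℕ} (hf : PT f) (hg : PT g) : PT (fun a => decide (f a ≤ g a)) := by
  have : PT (fun a => (List.replicate (f a - g a) ()).isEmpty) := by fun_prop
  convert this using 2 with a
  rw [Bool.eq_iff_iff]
  simp
  omega

@[fun_prop]
theorem decide_lt {f g : α → ℕ} (hf : PT f) (hg : PT g) : PT (fun a => decide (f a < g a)) :=
  decide_le (succ hf) hg

@[fun_prop]
theorem decide_eq {f g : α → ℕ} (hf : PT f) (hg : PT g) : PT (fun a => decide (f a = g a)) := by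
  convert and (decide_le hf hg) (decide_le hg hf) using 2 with a
  rw [Bool.eq_iff_iff]
  simp
  omega

@[fun_prop]
theorem contains {f : α → List ℕ} {g : α → ℕ} (hf : PT f) (hg : PT g) :
    PT (fun a => (f a).contains (g a)) := by
  have : PT (fun a => (f a).any (fun x => decide (x = g a))) := by fun_prop
  convert this using 2 with a
  rw [Bool.eq_iff_iff]
  simp

theorem sz_range_le (n : ℕ) : sz (List.range n) ≤ 1 + n * (2 * n + 2) := by
  induction n with
  | zero => simp
  | succ n ih =>
    have h1 := sz_append (List.range n) [n]
    rw [← List.range_succ] at h1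
    have h2 : sz [n] = 2 * n + 3 := by simp [sz_nat]; omega
    nlinarith

@[fun_prop]
theorem range {f : α → ℕ} (hf : PT f) : PT (fun a => List.range (f a)) := by
  obtain ⟨b, hb⟩ := hf.size_le
  have key : ∀ l : List Unit, l.foldl (fun c _ => c ++ [c.length]) [] = List.range l.length := by
    intro l
    induction l using List.reverseRecOn with
    | nil => rfl
    | append_singleton l x ih => simp [ih, List.range_succ]
  have : PT (fun a => (List.replicate (f a) ()).foldl (fun c _ => c ++ [c.length]) []) := by
    -- The appended element depends on the accumulator, so `foldl` with its bound per round does not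
    -- apply. Every intermediate list is itself a range, which bounds its size directly.
    refine foldl_of_bound (g := fun _ c (_ : Unit) => c ++ [c.length]) (by fun_prop) (by fun_prop)
      (by fun_prop) (1 + b * (2 * b + 2)) fun a l₁ l₂ h => ?_
    have h1 : l₁.length ≤ f a := by
      have := congrArg List.length h
      simp at this
      omega
    have h2 : l₁.length ≤ b.eval (sz a) := by
      have := hb a
      rw [sz_nat] at this
      omega
    rw [key]
    refine (sz_range_le _).trans ?_
    simp only [Polynomial.eval_add, Polynomial.eval_one, Polynomial.eval_mul, Polynomial.eval_ofNat]
    gcongr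
  simpa [key] using this

@[fun_prop]
theorem drop {f : α → List β} {g : α → ℕ} (hf : PT f) (hg : PT g) :
    PT (fun a => (f a).drop (g a)) := by
  have : PT (fun a => (List.replicate (g a) ()).foldl (fun c _ => c.tail) (f a)) := by
    refine foldl (g := fun _ c (_ : Unit) => c.tail) (by fun_prop) (replicate hg) hf ⟨0, fun a c x => ?_⟩
    simpa using sz_sublist (List.tail_sublist c)
  convert this using 2 with a
  induction g a with
  | zero => rfl
  | succ n ih =>
    rw [List.replicate_succ', List.foldl_append, ← ih]
    simp

end PT

/-! ## Minimum vertex covers of bipartite graphs by an auction -/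

/-- The size of the vertex cover of the bipartite graph between `items` and `Ys` that consists of the
items in `A` and of the lists in `Ys` with an item outside of `A`. -/
def cover (items : List ℕ) (Ys : List (List ℕ)) (A : ℕ → Bool) : ℕ :=
  items.countP A + Ys.countP fun y => items.any fun w => y.contains w && !A w

/-- An item, its price, and the list of the items that its owner wants. -/
abbrev Entry := ℕ × ℕ × List ℕ

/-- The items that a bidder wants and that are cheaper than `cap`. -/
def affordable (cap : ℕ) (E : List Entry) (N : List ℕ) : List Entry :=
  E.filter fun e => N.contains e.1 && decide (e.2.1 < cap)

/-- The cheapest items that a bidder wants. -/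
def cheapest (cap : ℕ) (E : List Entry) (N : List ℕ) : List Entry :=
  (affordable cap E N).filter fun e => (affordable cap E N).all fun e' => decide (e.2.1 ≤ e'.2.1)

/-- The first bidder takes a cheapest item, whose price goes up, or gives up. -/
def bid (cap : ℕ) (s : List Entry × List (List ℕ)) : List Entry × List (List ℕ) :=
  List.casesOn (motive := fun _ => List Entry × List (List ℕ)) s.2 s fun N P =>
    List.casesOn (motive := fun _ => List Entry × List (List ℕ)) (cheapest cap s.1 N) (s.1, P)
      fun e _ => ((e.1, e.2.1 + 1, N) :: s.1.filter (fun e' => !decide (e'.1 = e.1)),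
        -- Price zero means that the item has no owner; otherwise the displaced owner has to bid
        -- again.
        bif decide (e.2.1 = 0) then P else e.2.2 :: P)

/-- The result of the auction. -/
def auction (items : List ℕ) (Ys : List (List ℕ)) : List Entry × List (List ℕ) :=
  -- The number of rounds is the initial value of `auctionPot`. The price cap exceeds the number of
  -- items, so that some price level is always left unused.
  (List.replicate (Ys.length + items.length * (items.length + 1)) ()).foldl
    (fun s _ => bid (items.length + 1) s) (items.map fun w => (w, 0, []), Ys)

/-- The minimum size of a vertex cover. -/
def tau (items : List ℕ) (Ys : List (List ℕ)) : ℕ :=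
  (auction items Ys).1.countP fun e => decide (0 < e.2.1)

theorem mem_cheapest {cap : ℕ} {E : List Entry} {N : List ℕ} {e : Entry} (he : e ∈ cheapest cap E N) :
    e ∈ E ∧ e.1 ∈ N ∧ e.2.1 < cap ∧ ∀ e' ∈ E, e'.1 ∈ N → e.2.1 ≤ e'.2.1 := by
  simp only [cheapest, affordable, List.mem_filter, List.all_eq_true, Bool.and_eq_true,
    List.contains_iff_mem, decide_eq_true_eq] at he
  refine ⟨he.1.1, he.1.2.1, he.1.2.2, fun e' h h' => ?_⟩
  by_cases h2 : e'.2.1 < cap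
  · exact he.2 e' ⟨h, h', h2⟩
  · omega

theorem cheapest_eq_nil {cap : ℕ} {E : List Entry} {N : List ℕ} (h : cheapest cap E N = []) :
    ∀ e ∈ E, e.1 ∈ N → cap ≤ e.2.1 := by
  by_contra! hc
  obtain ⟨e, he, h1, h2⟩ := hc
  have hne : (affordable cap E N).toFinset.Nonempty := ⟨e, by simp [affordable, he, h1, h2]⟩
  obtain ⟨m, hm, hmin⟩ := Finset.exists_min_image _ (fun e : Entry => e.2.1) hne
  have : m ∈ cheapest cap E N := by
    simp only [cheapest, List.mem_filter, List.all_eq_true, decide_eq_true_eq]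
    exact ⟨by simpa using hm, fun e' he' => hmin e' (by simpa using he')⟩
  simp [h] at this

/-- The invariant of the auction. -/
structure AuctionInv (items : List ℕ) (Ys : List (List ℕ)) (cap : ℕ)
    (s : List Entry × List (List ℕ)) : Prop where
  perm : (s.1.map Prod.fst).Perm items
  count : ∃ G : List (List ℕ), (∀ p : List ℕ → Bool, Ys.countP p = s.2.countP p + G.countP p
      + s.1.countP fun e => decide (0 < e.2.1) && p e.2.2) ∧
    ∀ N ∈ G, ∀ e ∈ s.1, e.1 ∈ N → cap ≤ e.2.1
  mem : ∀ e ∈ s.1, 0 < e.2.1 → e.1 ∈ e.2.2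
  -- Complementary slackness up to one unit: an owner chose a cheapest item just before its price
  -- rose, and other prices never fall.
  cheap : ∀ e ∈ s.1, 0 < e.2.1 → ∀ e' ∈ s.1, e'.1 ∈ e.2.2 → e.2.1 ≤ e'.2.1 + 1
  le_cap : ∀ e ∈ s.1, e.2.1 ≤ cap

/-- The number of rounds that are left. -/
def auctionPot (cap : ℕ) (s : List Entry × List (List ℕ)) : ℕ :=
  s.2.length + s.1.countP (fun e => decide (0 < e.2.1)) + (s.1.map fun e => cap - e.2.1).sum

theorem perm_cons_filter {E : List Entry} (hE : (E.map Prod.fst).Nodup) {e : Entry} (he : e ∈ E) :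
    E.Perm (e :: E.filter fun e' => !decide (e'.1 = e.1)) := by
  induction E with
  | nil => simp at he
  | cons a E ih =>
    simp only [List.map_cons, List.nodup_cons] at hE
    rcases List.mem_cons.1 he with rfl | h
    · rw [List.filter_cons_of_neg (by simp), List.filter_eq_self.2]
      intro a' ha'
      simp only [Bool.not_eq_true', decide_eq_false_iff_not]
      intro h
      exact hE.1 (h ▸ List.mem_map_of_mem ha')
    · have hne : a.1 ≠ e.1 := fun h' => hE.1 (h' ▸ List.mem_map_of_mem h)
      rw [List.filter_cons_of_pos (by simp [hne])]
      exact ((ih hE.2 h).cons a).trans (List.Perm.swap _ _ _)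

/-- A bidder who gives up leaves the queue. A successful bid brings one price closer to the cap,
while the number of waiting bidders plus owners stays the same. Hence the potential drops in either
case. -/
theorem AuctionInv.bid {items : List ℕ} {Ys : List (List ℕ)} {cap : ℕ}
    {s : List Entry × List (List ℕ)} (hi : items.Nodup) (hs : AuctionInv items Ys cap s) :
    AuctionInv items Ys cap (bid cap s) ∧ (s.2 = [] ∧ SFVS.bid cap s = s ∨
      auctionPot cap (SFVS.bid cap s) + 1 ≤ auctionPot cap s) := by
  obtain ⟨E, P⟩ := s
  obtain ⟨hperm, ⟨G, hG, hG'⟩, hmem, hcheap, hcap⟩ := hs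
  rcases P with _ | ⟨N, P⟩
  · exact ⟨⟨hperm, ⟨G, hG, hG'⟩, hmem, hcheap, hcap⟩, Or.inl ⟨rfl, rfl⟩⟩
  simp only at hperm hG hG' hmem hcheap hcap
  rcases hc : cheapest cap E N with _ | ⟨e, l⟩
  · have hb : SFVS.bid cap (E, N :: P) = (E, P) := by simp [SFVS.bid, hc]
    rw [hb]
    refine ⟨⟨hperm, ⟨N :: G, fun p => ?_, ?_⟩, hmem, hcheap, hcap⟩, Or.inr ?_⟩
    · simp only [hG p, List.countP_cons]; omega
    · intro N' hN'
      rcases List.mem_cons.1 hN' with rfl | h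
      · exact cheapest_eq_nil hc
      · exact hG' N' h
    · simp only [auctionPot, List.length_cons]; omega
  · obtain ⟨he, heN, hlt, hmin⟩ := mem_cheapest (hc ▸ List.mem_cons_self : e ∈ cheapest cap E N)
    have hnd : (E.map Prod.fst).Nodup := hperm.nodup_iff.2 hi
    have hp := perm_cons_filter hnd he
    set F := E.filter fun e' => !decide (e'.1 = e.1) with hF
    have hb : SFVS.bid cap (E, N :: P) = ((e.1, e.2.1 + 1, N) :: F,
        bif decide (e.2.1 = 0) then P else e.2.2 :: P) := by simp [SFVS.bid, hc, hF]
    have hFE : ∀ a ∈ F, a ∈ E := fun a ha => (List.mem_filter.1 ha).1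
    rw [hb]
    refine ⟨⟨?_, ⟨G, fun p => ?_, ?_⟩, ?_, ?_, ?_⟩, Or.inr ?_⟩
    · exact ((hp.map Prod.fst).symm.trans hperm)
    · have h1 := hG p
      rw [hp.countP_eq] at h1
      simp only [List.countP_cons] at h1 ⊢
      rcases Nat.eq_zero_or_pos e.2.1 with h0 | h0
      · simp [h0] at h1 ⊢; omega
      · simp [h0, h0.ne', List.countP_cons] at h1 ⊢; omega
    · intro N' hN' a ha haN
      rcases List.mem_cons.1 ha with rfl | h
      · have := hG' N' hN' e he haN; simp only; omega
      · exact hG' N' hN' a (hFE a h) haN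
    · intro a ha h0
      rcases List.mem_cons.1 ha with rfl | h
      · exact heN
      · exact hmem a (hFE a h) h0
    · intro a ha h0 a' ha' haa'
      rcases List.mem_cons.1 ha with rfl | h
      · simp only at haa' ⊢
        rcases List.mem_cons.1 ha' with rfl | h'
        · simp only; omega
        · have := hmin a' (hFE a' h') haa'; omega
      · rcases List.mem_cons.1 ha' with rfl | h'
        · have := hcheap a (hFE a h) h0 e he haa'; simp only; omega
        · exact hcheap a (hFE a h) h0 a' (hFE a' h') haa'
    · intro a ha
      rcases List.mem_cons.1 ha with rfl | h
      · exact hlt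
      · exact hcap a (hFE a h)
    · have h1 := (hp.map fun e : Entry => cap - e.2.1).sum_eq
      have h2 := hp.countP_eq fun e => decide (0 < e.2.1)
      simp only [auctionPot, h1, h2, List.countP_cons, List.map_cons, List.sum_cons,
        List.length_cons]
      rcases Nat.eq_zero_or_pos e.2.1 with h0 | h0
      · simp [h0]; omega
      · simp [h0, h0.ne']; omega

theorem auction_inv {items : List ℕ} (hi : items.Nodup) (Ys : List (List ℕ)) :
    AuctionInv items Ys (items.length + 1) (auction items Ys) ∧ (auction items Ys).2 = [] := by
  set cap := items.length + 1 with hcap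
  have key : ∀ (l : List Unit) (s : List Entry × List (List ℕ)), AuctionInv items Ys cap s →
      auctionPot cap s ≤ l.length →
      AuctionInv items Ys cap (l.foldl (fun s _ => bid cap s) s) ∧
        (l.foldl (fun s _ => bid cap s) s).2 = [] := by
    intro l
    induction l with
    | nil =>
      intro s hs h
      refine ⟨hs, List.length_eq_zero_iff.1 ?_⟩
      simp only [auctionPot, List.length_nil] at h
      simp only [List.foldl_nil]
      omega
    | cons a l ih =>
      intro s hs h
      obtain ⟨h1, h2⟩ := hs.bid hi
      rcases h2 with ⟨h2, h3⟩ | h2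
      · have h4 : ∀ l : List Unit, l.foldl (fun s _ => bid cap s) s = s := by
          intro l
          induction l with
          | nil => rfl
          | cons a l ih => rw [List.foldl_cons, h3, ih]
        rw [h4]
        exact ⟨hs, h2⟩
      · refine ih _ h1 ?_
        simp only [List.length_cons] at h
        have h3 : auctionPot cap (bid cap s) + 1 ≤ l.length + 1 := h2.trans h
        exact Nat.le_of_succ_le_succ h3
  refine key _ _ ⟨?_, ⟨[], ?_, by simp⟩, ?_, ?_, ?_⟩ ?_
  · simp [Function.comp_def]
  · intro p
    have : (items.map fun w => ((w, 0, []) : Entry)).countP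
        (fun e => decide (0 < e.2.1) && p e.2.2) = 0 := by
      simp [List.countP_eq_zero]
    simp [this]
  · simp
  · simp
  · simp
  · have : (items.map fun w => ((w, 0, []) : Entry)).countP (fun e => decide (0 < e.2.1)) = 0 := by
      simp [List.countP_eq_zero]
    simp [auctionPot, this, Function.comp_def, List.map_const', hcap]

/-- Weak duality: owned items and their owners form a matching, and for each pair either the item
lies in `A` or the owner's list has to be in the cover. -/
theorem tau_le_cover {items : List ℕ} (hi : items.Nodup) (Ys : List (List ℕ)) (A : ℕ → Bool) :
    tau items Ys ≤ cover items Ys A := by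
  obtain ⟨⟨hperm, ⟨G, hG, -⟩, hmem, -, -⟩, -⟩ := auction_inv hi Ys
  unfold tau cover
  set E := (auction items Ys).1
  set q : List ℕ → Bool := fun y => items.any fun w => y.contains w && !A w with hq
  have h1 : E.countP (fun e => decide (0 < e.2.1)) ≤ E.countP (fun e => A e.1)
      + E.countP (fun e => decide (0 < e.2.1) && q e.2.2) := by
    have key : ∀ l : List Entry, (∀ e ∈ l, e ∈ E) → l.countP (fun e => decide (0 < e.2.1))
        ≤ l.countP (fun e => A e.1) + l.countP (fun e => decide (0 < e.2.1) && q e.2.2) := by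
      intro l
      induction l with
      | nil => simp
      | cons e l ih =>
        intro hl
        have := ih fun e' he' => hl e' (by simp [he'])
        simp only [List.countP_cons]
        by_cases h0 : 0 < e.2.1
        · by_cases hA : A e.1 = true
          · simp [h0, hA]; omega
          · have he : e ∈ E := hl e (by simp)
            have : q e.2.2 = true := by
              simp only [hq, List.any_eq_true]
              exact ⟨e.1, hperm.mem_iff.1 (List.mem_map_of_mem he), by simp [hmem e he h0, hA]⟩
            simp [h0, hA, this]; omega
        · simp [h0]; omega
    exact key E fun _ h => h
  have h2 : E.countP (fun e => A e.1) = items.countP A := by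
    rw [← hperm.countP_eq, List.countP_map]; rfl
  have h3 := hG q
  omega

/-- By pigeonhole some level `L` between 1 and the cap is the price of no item; `A` consists of the
items dearer than `L`. Bidders who gave up want only items at the cap, which lie in `A`. The owner
of an item in `A` paid more than `L`, so by slackness everything it wants costs at least `L` and
lies in `A`. Hence each owned item is charged at most once, for itself or for its owner, and nothing
else is charged. -/
theorem exists_cover_eq_tau {items : List ℕ} (hi : items.Nodup) (Ys : List (List ℕ)) :
    ∃ A, cover items Ys A = tau items Ys := by
  obtain ⟨⟨hperm, ⟨G, hG, hG'⟩, hmem, hcheap, hcap⟩, hnil⟩ := auction_inv hi Ys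
  suffices ∃ A, cover items Ys A ≤ tau items Ys by
    obtain ⟨A, hA⟩ := this
    exact ⟨A, hA.antisymm (tau_le_cover hi Ys A)⟩
  unfold tau cover
  set E := (auction items Ys).1 with hE
  have hlen : E.length = items.length := by simpa using hperm.length_eq
  obtain ⟨L, hL, hL'⟩ : ∃ L ∈ Finset.Icc 1 (items.length + 1), L ∉ (E.map fun e => e.2.1).toFinset := by
    refine Finset.exists_mem_notMem_of_card_lt_card ?_
    have := List.toFinset_card_le (E.map fun e => e.2.1)
    rw [List.length_map] at this
    simp
    omega
  have hgap : ∀ e ∈ E, e.2.1 ≠ L := by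
    intro e he h
    exact hL' (by simp only [List.mem_toFinset, List.mem_map]; exact ⟨e, he, h⟩)
  rw [Finset.mem_Icc] at hL
  let A : ℕ → Bool := fun w => E.any fun e => decide (e.1 = w) && decide (L ≤ e.2.1)
  have hA : ∀ e ∈ E, A e.1 = decide (L ≤ e.2.1) := by
    intro e he
    rw [Bool.eq_iff_iff]
    simp only [A, List.any_eq_true, Bool.and_eq_true, decide_eq_true_eq]
    refine ⟨?_, fun h => ⟨e, he, rfl, h⟩⟩
    rintro ⟨e', he', h1, h2⟩
    have hnd : (E.map Prod.fst).Nodup := hperm.nodup_iff.2 hi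
    rwa [← List.inj_on_of_nodup_map hnd he' he h1]
  refine ⟨A, ?_⟩
  set q : List ℕ → Bool := fun y => items.any fun w => y.contains w && !A w with hq
  have hqf : ∀ y, (∀ e ∈ E, e.1 ∈ y → L ≤ e.2.1) → q y = false := by
    intro y hy
    simp only [hq, List.any_eq_false]
    intro w hw
    obtain ⟨e, he, rfl⟩ := List.mem_map.1 (hperm.mem_iff.2 hw)
    rw [hA e he]
    by_cases h : e.1 ∈ y
    · simp [hy e he h]
    · simp [h]
  have h1 := hG q
  have h2 : G.countP q = 0 := by
    rw [List.countP_eq_zero]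
    intro N hN
    rw [hqf N fun e he h => hL.2.trans (hG' N hN e he h)]
    simp
  rw [hnil, List.countP_nil, h2] at h1
  have h3 : items.countP A = E.countP (fun e => A e.1) := by
    rw [← hperm.countP_eq, List.countP_map]; rfl
  have key : ∀ l : List Entry, (∀ e ∈ l, e ∈ E) →
      l.countP (fun e => A e.1) + l.countP (fun e => decide (0 < e.2.1) && q e.2.2)
        ≤ l.countP (fun e => decide (0 < e.2.1)) := by
    intro l
    induction l with
    | nil => simp
    | cons e l ih =>
      intro hl
      have := ih fun e' he' => hl e' (by simp [he'])
      have he : e ∈ E := hl e (by simp)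
      simp only [List.countP_cons, hA e he]
      by_cases h4 : L ≤ e.2.1
      · have h5 : q e.2.2 = false := by
          refine hqf _ fun e' he' h => ?_
          have := hcheap e he (by omega) e' he' h
          have := hgap e he
          omega
        simp [h4, h5, show 0 < e.2.1 by omega]; omega
      · by_cases h0 : 0 < e.2.1
        · cases q e.2.2 <;> simp [h4, h0] <;> omega
        · simp [h4, h0]; omega
  have := key E fun _ h => h
  omega

/-! ### The auction takes polynomial time -/

section time

variable {α : Type} [Enc α]

@[fun_prop]
theorem PT.affordable {c : α → ℕ} {E : α → List Entry} {N : α → List ℕ} (hc : PT c) (hE : PT E)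
    (hN : PT N) : PT (fun a => affordable (c a) (E a) (N a)) := by
  unfold SFVS.affordable; fun_prop

@[fun_prop]
theorem PT.cheapest {c : α → ℕ} {E : α → List Entry} {N : α → List ℕ} (hc : PT c) (hE : PT E)
    (hN : PT N) : PT (fun a => cheapest (c a) (E a) (N a)) := by
  unfold SFVS.cheapest; fun_prop

@[fun_prop]
theorem PT.bid {c : α → ℕ} {s : α → List Entry × List (List ℕ)} (hc : PT c) (hs : PT s) :
    PT (fun a => bid (c a) (s a)) := by
  unfold SFVS.bid; fun_prop

theorem sz_cons_filter_le {E : List Entry} {e : Entry} (he : e ∈ E) :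
    1 + sz e + sz (E.filter fun e' => !decide (e'.1 = e.1)) ≤ sz E := by
  induction E with
  | nil => simp at he
  | cons a E ih =>
    rcases List.mem_cons.1 he with rfl | h
    · rw [List.filter_cons_of_neg (by simp), sz_cons]
      have := sz_sublist (E.filter_sublist (p := fun e' => !decide (e'.1 = e.1)))
      omega
    · have h1 := ih h
      have h2 : sz ((a :: E).filter fun e' => !decide (e'.1 = e.1))
          ≤ 1 + sz a + sz (E.filter fun e' => !decide (e'.1 = e.1)) := by
        rw [List.filter_cons]
        split
        · rw [sz_cons]
        · omega
      rw [sz_cons]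
      omega

/-- Lists only move between the queue and the entries; the one growth is a price that gains a unary
digit, which is two nodes. -/
theorem sz_bid_le (cap : ℕ) (s : List Entry × List (List ℕ)) : sz (bid cap s) ≤ sz s + 2 := by
  obtain ⟨E, _ | ⟨N, P⟩⟩ := s
  · simp [bid]
  · rcases hc : cheapest cap E N with _ | ⟨e, l⟩
    · simp [bid, hc]; omega
    · have he := (mem_cheapest (hc ▸ List.mem_cons_self : e ∈ cheapest cap E N)).1
      have h1 := sz_cons_filter_le he
      have hb : bid cap (E, N :: P) = ((e.1, e.2.1 + 1, N) :: E.filter (fun e' => !decide (e'.1 = e.1)),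
        bif decide (e.2.1 = 0) then P else e.2.2 :: P) := by simp [bid, hc]
      rw [hb]
      generalize E.filter (fun e' => !decide (e'.1 = e.1)) = F at h1 ⊢
      obtain ⟨w, p, o⟩ := e
      have h2 : sz (p + 1) = sz p + 2 := by simp [sz_nat]; omega
      have h3 := sz_pos o
      by_cases h0 : p = 0
      · simp [h0] at *; omega
      · simp [h0] at *; omega

@[fun_prop]
theorem PT.auction {items : α → List ℕ} {Ys : α → List (List ℕ)} (hi : PT items) (hY : PT Ys) :
    PT (fun a => auction (items a) (Ys a)) := by
  unfold SFVS.auction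
  refine PT.foldl (g := fun a s (_ : Unit) => SFVS.bid ((items a).length + 1) s) (by fun_prop)
    (by fun_prop) (by fun_prop) ⟨2, fun a c x => ?_⟩
  simpa using sz_bid_le _ _

@[fun_prop]
theorem PT.tau {items : α → List ℕ} {Ys : α → List (List ℕ)} (hi : PT items) (hY : PT Ys) :
    PT (fun a => tau (items a) (Ys a)) := by
  unfold SFVS.tau; fun_prop

end time

/-! ## A covering problem with items and clauses -/

/-- A clause: the items that it tolerates singly, and those that it does not tolerate. -/
abbrev Clause := List ℕ × List ℕ

/-- A state of the search: a budget, the items, and the clauses. -/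
abbrev State := ℕ × List ℕ × List Clause

/-- The clause is violated if the items in `κ` are kept. -/
def bad (κ : ℕ → Bool) (t : Clause) : Bool := t.2.any κ || decide (2 ≤ t.1.countP κ)

/-- The number of deleted items and violated clauses. -/
def cost (items : List ℕ) (ts : List Clause) (κ : ℕ → Bool) : ℕ :=
  items.countP (fun w => !κ w) + ts.countP (bad κ)

/-- Some set of kept items has a cost within the budget. -/
def State.Yes (s : State) : Prop := ∃ κ, cost s.2.1 s.2.2 κ ≤ s.1

/-- The clause tolerates at least two items singly. -/
def active (t : Clause) : Bool := decide (2 ≤ t.1.length)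

/-- The lists of untolerated items of the inactive clauses. -/
def inactiveLists (ts : List Clause) : List (List ℕ) := (ts.filter fun t => !active t).map Prod.snd

/-- Delete the items in `Δ`. -/
def delItems (Δ items : List ℕ) : List ℕ := items.filter fun w => !Δ.contains w

/-- Delete the items in `Δ` from the clauses. -/
def delClauses (Δ : List ℕ) (ts : List Clause) : List Clause :=
  ts.map fun t => (delItems Δ t.1, delItems Δ t.2)

/-- The clauses that remain if `x` is kept. -/
def keepClauses (x : ℕ) (ts : List Clause) : List Clause :=
  (ts.filter fun t => !t.2.contains x).map fun t =>
    -- Keeping `x` uses up the tolerance of the clause: every other item in it is now untolerated,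
    -- and the clause becomes inactive.
    bif t.1.contains x then ([], delItems [x] (t.2 ++ t.1)) else t

/-- Keeping the item `x` matters for the clause. -/
def touches (x : ℕ) (t : Clause) : Bool := t.2.contains x || (active t && t.1.contains x)

/-- Charge `c` to the budget, and drop the state if its lower bound exceeds the budget. -/
def push (c : ℕ) (s : State) : List State :=
  bif decide (c ≤ s.1) && decide (tau s.2.1 (inactiveLists s.2.2) ≤ s.1 - c) then [(s.1 - c, s.2)]
  else []

/-- Delete the items in `Δ`. -/
def pushDel (Δ : List ℕ) (s : State) : List State :=
  push (s.2.1.countP fun w => Δ.contains w) (s.1, delItems Δ s.2.1, delClauses Δ s.2.2)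

/-- Keep the item `x`. -/
def pushKeep (x : ℕ) (s : State) : List State :=
  push (s.2.2.countP fun t => t.2.contains x) (s.1, delItems [x] s.2.1, keepClauses x s.2.2)

/-- A maximal set of items in a minimum vertex cover. -/
def crown (items : List ℕ) (Ys : List (List ℕ)) : List ℕ :=
  items.foldl (fun Δ x =>
    bif decide (tau (delItems (x :: Δ) items) Ys < tau (delItems Δ items) Ys) then x :: Δ else Δ) []

/-- It is safe to keep the item `x`. -/
def forced (x : ℕ) (s : State) : Bool :=
  -- Either keeping `x` saves one deletion and violates at most one further clause, or `x` matters
  -- only to clauses inside a pair `x`, `w`, and deleting `w` instead of `x` is no worse.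
  decide (s.2.2.countP (touches x) ≤ 1) || s.2.1.any fun w => !decide (w = x) &&
    (s.2.2.filter (touches x)).all fun t =>
      t.2.isEmpty && t.1.all fun u => decide (u = x) || decide (u = w)

/-- The items that are deleted in the branch in which `x` is not kept. -/
def dropSet (x : ℕ) (s : State) : List ℕ :=
  -- If one of the two touched clauses is inactive and violated anyway, then keeping `x` is no
  -- worse. So the other branch may assume that this clause is satisfied, which means that all its
  -- untolerated items are deleted.
  bif decide (s.2.2.countP (touches x) = 2) then
    List.casesOn (motive := fun _ => List ℕ) ((s.2.2.filter (touches x)).filter fun t => !active t)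
      [x] fun y _ => y.2
  else [x]

/-- The branches for an item. -/
def branch (x : ℕ) (s : State) : List State :=
  pushKeep x s ++ bif forced x s then [] else pushDel (dropSet x s) s

/-- Either the answer for the state, or the states to which it reduces. -/
def expand (s : State) : Bool × List State :=
  bif (crown s.2.1 (inactiveLists s.2.2)).isEmpty then
    List.casesOn (motive := fun _ => Bool × List State) (s.2.2.filter active) (true, [])
      -- The default 0 is never used, because an active clause tolerates at least two items.
      fun t _ => (false, branch (t.1.headD 0) s)
  else (false, pushDel (crown s.2.1 (inactiveLists s.2.2)) s)

/-- Well-formed clauses. -/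
def ClausesWF (items : List ℕ) (ts : List Clause) : Prop :=
  ∀ t ∈ ts, t.1.Nodup ∧ (∀ u ∈ t.1, u ∈ items) ∧ (∀ u ∈ t.2, u ∈ items) ∧ ∀ u ∈ t.1, u ∉ t.2

/-- Well-formed states within the budget. -/
def State.WF (s : State) : Prop :=
  s.2.1.Nodup ∧ ClausesWF s.2.1 s.2.2 ∧ tau s.2.1 (inactiveLists s.2.2) ≤ s.1

/-! ### Counting -/

section count

variable {α : Type*} {l : List α} {p q r : α → Bool}

theorem countP_le_add (h : ∀ a ∈ l, r a → p a ∨ q a) : l.countP r ≤ l.countP p + l.countP q := by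
  induction l with
  | nil => simp
  | cons a l ih =>
    have h1 := ih fun b hb => h b (by simp [hb])
    have h2 := h a (by simp)
    simp only [List.countP_cons]
    cases hr : r a <;> cases hp : p a <;> cases hq : q a <;> simp_all <;> omega

theorem countP_add_le (hp : ∀ a ∈ l, p a → r a) (hq : ∀ a ∈ l, q a → r a)
    (h : ∀ a ∈ l, p a → q a → False) : l.countP p + l.countP q ≤ l.countP r := by
  induction l with
  | nil => simp
  | cons a l ih =>
    have h1 := ih (fun b hb => hp b (by simp [hb])) (fun b hb => hq b (by simp [hb]))
      (fun b hb => h b (by simp [hb]))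
    have h2 := hp a (by simp)
    have h3 := hq a (by simp)
    have h4 := h a (by simp)
    simp only [List.countP_cons]
    cases hr : r a <;> cases hp : p a <;> cases hq : q a <;> simp_all <;> omega

theorem countP_mono (h : ∀ a ∈ l, p a → q a) : l.countP p ≤ l.countP q :=
  List.countP_mono_left h

end count

theorem mem_delItems {Δ items : List ℕ} {w : ℕ} : w ∈ delItems Δ items ↔ w ∈ items ∧ w ∉ Δ := by
  simp [delItems]

theorem delItems_nodup {Δ items : List ℕ} (h : items.Nodup) : (delItems Δ items).Nodup :=
  h.filter _

theorem countP_update_true {items : List ℕ} {x : ℕ} (hx : x ∈ items)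
    {κ : ℕ → Bool} (hκ : κ x = false) :
    items.countP (fun w => !Function.update κ x true w) + 1 ≤ items.countP (fun w => !κ w) := by
  have h1 : 1 ≤ items.countP (fun w => decide (w = x)) :=
    List.countP_pos_iff.2 ⟨x, hx, by simp⟩
  refine (Nat.add_le_add_left h1 _).trans (countP_add_le ?_ ?_ ?_)
  · intro a _ h
    by_cases hax : a = x
    · simp [hax, hκ]
    · simpa [Function.update_of_ne hax] using h
  · intro a _ h
    simp at h
    simp [h, hκ]
  · intro a _ h h'
    simp at h'
    simp [h'] at h

theorem countP_eq_le_one {items : List ℕ} (hi : items.Nodup) (x : ℕ) :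
    items.countP (fun w => decide (w = x)) ≤ 1 := by
  have := List.nodup_iff_count_le_one.1 hi x
  simpa [List.count, beq_eq_decide] using this

/-! ### Branching is correct -/

theorem bad_mono {κ κ' : ℕ → Bool} {t : Clause} (h : ∀ w, κ w → κ' w) (hb : bad κ t) : bad κ' t := by
  simp only [bad, Bool.or_eq_true, decide_eq_true_eq, List.any_eq_true] at *
  rcases hb with ⟨w, hw, hκ⟩ | hb
  · exact Or.inl ⟨w, hw, h w hκ⟩
  · exact Or.inr (hb.trans (countP_mono fun w _ => h w))

theorem bad_congr {κ κ' : ℕ → Bool} {t : Clause} (h1 : ∀ w ∈ t.1, κ w = κ' w)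
    (h2 : ∀ w ∈ t.2, κ w = κ' w) : bad κ t = bad κ' t := by
  have e1 : t.1.countP κ = t.1.countP κ' := List.countP_congr fun w hw => by rw [h1 w hw]
  have e2 : t.2.any κ = t.2.any κ' := by
    rw [Bool.eq_iff_iff]
    simp only [List.any_eq_true]
    exact exists_congr fun w => and_congr_right fun hw => by rw [h2 w hw]
  rw [bad, bad, e1, e2]

theorem cost_congr {items : List ℕ} {ts : List Clause} (hts : ClausesWF items ts)
    {κ κ' : ℕ → Bool} (h : ∀ w ∈ items, κ w = κ' w) : cost items ts κ = cost items ts κ' := by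
  unfold cost
  congr 1
  · exact List.countP_congr fun w hw => by rw [h w hw]
  · refine List.countP_congr fun t ht => ?_
    rw [bad_congr (fun w hw => h w ((hts t ht).2.1 w hw)) (fun w hw => h w ((hts t ht).2.2.1 w hw))]

theorem ClausesWF.del {items : List ℕ} {ts : List Clause} (h : ClausesWF items ts) (Δ : List ℕ) :
    ClausesWF (delItems Δ items) (delClauses Δ ts) := by
  intro t ht
  simp only [delClauses, List.mem_map] at ht
  obtain ⟨t, ht, rfl⟩ := ht
  obtain ⟨h1, h2, h3, h4⟩ := h t ht
  simp only [mem_delItems]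
  exact ⟨delItems_nodup h1, fun u hu => ⟨h2 u hu.1, hu.2⟩, fun u hu => ⟨h3 u hu.1, hu.2⟩,
    fun u hu hu' => h4 u hu.1 hu'.1⟩

theorem ClausesWF.keep {items : List ℕ} {ts : List Clause} (h : ClausesWF items ts) (x : ℕ) :
    ClausesWF (delItems [x] items) (keepClauses x ts) := by
  intro t ht
  simp only [keepClauses, List.mem_map, List.mem_filter] at ht
  obtain ⟨t, ⟨ht, hx⟩, rfl⟩ := ht
  obtain ⟨h1, h2, h3, h4⟩ := h t ht
  by_cases hxt : x ∈ t.1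
  · simp only [List.contains_iff_mem.2 hxt, cond_true, mem_delItems, List.mem_append]
    refine ⟨List.nodup_nil, by simp, ?_, by simp⟩
    rintro u ⟨h | h, h'⟩
    · exact ⟨h3 u h, h'⟩
    · exact ⟨h2 u h, h'⟩
  · have hx' : x ∉ t.2 := by simpa using hx
    have : t.1.contains x = false := by simpa using hxt
    simp only [this, cond_false, mem_delItems, List.mem_singleton]
    exact ⟨h1, fun u hu => ⟨h2 u hu, fun e => hxt (e ▸ hu)⟩,
      fun u hu => ⟨h3 u hu, fun e => hx' (e ▸ hu)⟩, h4⟩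

theorem cost_del (items : List ℕ) (ts : List Clause) {κ : ℕ → Bool} {Δ : List ℕ}
    (h : ∀ w ∈ Δ, κ w = false) :
    cost items ts κ = (items.countP fun w => Δ.contains w)
      + cost (delItems Δ items) (delClauses Δ ts) κ := by
  have e1 : items.countP (fun w => !κ w) = (items.countP fun w => Δ.contains w)
      + (delItems Δ items).countP fun w => !κ w := by
    unfold delItems
    rw [List.countP_filter]
    refine le_antisymm (countP_le_add ?_) (countP_add_le ?_ ?_ ?_)
    · intro a _ ha
      by_cases haΔ : a ∈ Δ <;> simp_all
    · intro a _ ha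
      simp [h a (by simpa using ha)]
    · intro a _ ha
      simp at ha ⊢; exact ha.1
    · intro a _ ha ha'
      simp at ha ha'; exact ha'.2 ha
  have e2 : (delClauses Δ ts).countP (bad κ) = ts.countP (bad κ) := by
    unfold delClauses
    rw [List.countP_map]
    refine List.countP_congr fun t _ => ?_
    have e3 : (delItems Δ t.1).countP κ = t.1.countP κ := by
      unfold delItems
      rw [List.countP_filter]
      refine List.countP_congr fun w _ => ?_
      have := h w
      simp only [Bool.and_eq_true, Bool.not_eq_true', and_iff_left_iff_imp]
      intro hκ
      by_contra hc
      simp at hc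
      simp [this hc] at hκ
    have e4 : (delItems Δ t.2).any κ = t.2.any κ := by
      rw [Bool.eq_iff_iff]
      simp only [List.any_eq_true, mem_delItems]
      refine exists_congr fun w => ⟨fun hw => ⟨hw.1.1, hw.2⟩, fun hw => ⟨⟨hw.1, fun hc => ?_⟩, hw.2⟩⟩
      simp [h w hc] at hw
    simp only [Function.comp, bad, e3, e4]
  unfold cost
  omega

/-- Clauses that do not tolerate `x` are violated and paid for. A clause that tolerates `x` is
violated iff some other item in it is kept as well, which is what `keepClauses` records. -/
theorem cost_keep {items : List ℕ} {ts : List Clause} (hts : ClausesWF items ts) {κ : ℕ → Bool}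
    {x : ℕ} (h : κ x = true) :
    cost items ts κ = (ts.countP fun t => t.2.contains x)
      + cost (delItems [x] items) (keepClauses x ts) κ := by
  have e1 : items.countP (fun w => !κ w) = (delItems [x] items).countP fun w => !κ w := by
    unfold delItems
    rw [List.countP_filter]
    refine List.countP_congr fun w _ => ?_
    by_cases hw : w = x <;> simp [hw, h]
  have e2 : ts.countP (bad κ) = (ts.countP fun t => t.2.contains x)
      + (keepClauses x ts).countP (bad κ) := by
    unfold keepClauses
    rw [List.countP_map, List.countP_filter]
    have key : ∀ t ∈ ts, x ∉ t.2 →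
        bad κ (bif t.1.contains x then ([], delItems [x] (t.2 ++ t.1)) else t) = bad κ t := by
      intro t ht hx
      by_cases hxt : x ∈ t.1
      · simp only [List.contains_iff_mem.2 hxt, cond_true]
        rw [Bool.eq_iff_iff]
        simp only [bad, List.countP_nil, Bool.or_eq_true, List.any_eq_true, decide_eq_true_eq,
          mem_delItems, List.mem_append, List.mem_singleton]
        have h5 : t.1.countP κ = 1 + (t.1.erase x).countP κ := by
          rw [(List.perm_cons_erase hxt).countP_eq, List.countP_cons]
          simp [h]; omega
        have h6 : 2 ≤ t.1.countP κ ↔ ∃ w, (w ∈ t.1 ∧ w ≠ x) ∧ κ w = true := by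
          rw [h5]
          have : 2 ≤ 1 + (t.1.erase x).countP κ ↔ 0 < (t.1.erase x).countP κ := by omega
          rw [this, List.countP_pos_iff]
          refine exists_congr fun w => and_congr_left fun _ => ?_
          rw [(hts t ht).1.mem_erase_iff]
          tauto
        rw [h6]
        constructor
        · rintro (⟨w, ⟨h7 | h7, h8⟩, h9⟩ | h7)
          · exact Or.inl ⟨w, h7, h9⟩
          · exact Or.inr ⟨w, ⟨h7, h8⟩, h9⟩
          · simp at h7
        · rintro (⟨w, h7, h8⟩ | ⟨w, ⟨h7, h8⟩, h9⟩)
          · exact Or.inl ⟨w, ⟨Or.inl h7, fun e => hx (e ▸ h7)⟩, h8⟩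
          · exact Or.inl ⟨w, ⟨Or.inr h7, h8⟩, h9⟩
      · have : t.1.contains x = false := by simpa using hxt
        rw [this, cond_false]
    refine le_antisymm (countP_le_add ?_) (countP_add_le ?_ ?_ ?_)
    · intro t ht hb
      by_cases hx : x ∈ t.2
      · exact Or.inl (by simpa using hx)
      · refine Or.inr ?_
        simp only [Function.comp, key t ht hx, hb]
        simpa using hx
    · intro t _ ht
      simp only [bad, Bool.or_eq_true, List.any_eq_true]
      exact Or.inl ⟨x, by simpa using ht, h⟩
    · intro t ht hb
      simp only [Function.comp, Bool.and_eq_true, Bool.not_eq_true', List.contains_eq_mem,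
        decide_eq_false_iff_not] at hb
      have := key t ht hb.2
      simp only [List.contains_eq_mem] at this
      rw [← this]
      exact hb.1
    · intro t _ h1 h2
      simp at h1 h2
      exact h2.2 h1
  unfold cost
  omega

theorem exists_cost_del_iff {items : List ℕ} {ts : List Clause} (hts : ClausesWF items ts)
    (Δ : List ℕ) (k : ℕ) : (∃ κ : ℕ → Bool, (∀ w ∈ Δ, κ w = false) ∧ cost items ts κ ≤ k) ↔
      ∃ κ, (items.countP fun w => Δ.contains w)
        + cost (delItems Δ items) (delClauses Δ ts) κ ≤ k := by
  constructor
  · rintro ⟨κ, h, hc⟩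
    exact ⟨κ, (cost_del items ts h) ▸ hc⟩
  · rintro ⟨κ, hc⟩
    -- The reduced cost does not see the values of `κ` on `Δ`, so they may be reset.
    refine ⟨fun w => κ w && !Δ.contains w, fun w hw => by simp [hw], ?_⟩
    rw [cost_del items ts (Δ := Δ) fun w hw => by simp [hw]]
    rwa [cost_congr (hts.del Δ) (κ' := κ)]
    intro w hw
    simp [(mem_delItems.1 hw).2]

theorem exists_cost_keep_iff {items : List ℕ} {ts : List Clause} (hts : ClausesWF items ts)
    (x : ℕ) (k : ℕ) : (∃ κ : ℕ → Bool, κ x = true ∧ cost items ts κ ≤ k) ↔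
      ∃ κ, (ts.countP fun t => t.2.contains x)
        + cost (delItems [x] items) (keepClauses x ts) κ ≤ k := by
  constructor
  · rintro ⟨κ, h, hc⟩
    exact ⟨κ, (cost_keep hts h) ▸ hc⟩
  · rintro ⟨κ, hc⟩
    refine ⟨fun w => κ w || decide (w = x), by simp, ?_⟩
    rw [cost_keep hts (x := x) (by simp)]
    rwa [cost_congr (hts.keep x) (κ' := κ)]
    intro w hw
    have := (mem_delItems.1 hw).2
    simp at this
    simp [this]

theorem bad_update_true {κ : ℕ → Bool} {x : ℕ} {t : Clause}
    (h : bad (Function.update κ x true) t) : bad κ t ∨ touches x t := by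
  by_contra hc
  obtain ⟨h1, h2⟩ := not_or.1 hc
  simp only [touches, active, Bool.or_eq_true, Bool.and_eq_true, decide_eq_true_eq,
    List.contains_iff_mem, not_or, not_and] at h2
  have h3 : ∀ w ∈ t.2, Function.update κ x true w = κ w := fun w hw =>
    Function.update_of_ne (fun e => h2.1 (by rwa [e] at hw)) _ _
  by_cases hx : x ∈ t.1
  · simp only [bad, Bool.or_eq_true, List.any_eq_true, decide_eq_true_eq] at h h1
    rcases h with ⟨w, hw, hκ⟩ | h
    · exact h1 (Or.inl ⟨w, hw, h3 w hw ▸ hκ⟩)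
    · exact h2.2 (h.trans List.countP_le_length) hx
  · refine h1 ?_
    rwa [← bad_congr (κ := Function.update κ x true) _ h3]
    exact fun w hw => Function.update_of_ne (fun e => hx (by rwa [e] at hw)) _ _

/-- An item can be kept if that violates at most one more clause. -/
theorem exists_keep_of_countP {items : List ℕ} {ts : List Clause} {κ : ℕ → Bool}
    {x : ℕ} (hx : x ∈ items) (h : ts.countP (fun t => touches x t && !bad κ t) ≤ 1) :
    ∃ κ', κ' x = true ∧ cost items ts κ' ≤ cost items ts κ := by
  by_cases hκ : κ x = true
  · exact ⟨κ, hκ, le_rfl⟩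
  refine ⟨Function.update κ x true, by simp, ?_⟩
  -- The saved deletion of `x` pays for the one clause that may become violated.
  have h1 := countP_update_true hx (κ := κ) (by simpa using hκ)
  have h2 : ts.countP (bad (Function.update κ x true))
      ≤ ts.countP (bad κ) + ts.countP (fun t => touches x t && !bad κ t) := by
    refine countP_le_add fun t _ ht => ?_
    rcases bad_update_true ht with h | h
    · exact Or.inl h
    · cases hb : bad κ t
      · exact Or.inr (by simp [h])
      · exact Or.inl rfl
  unfold cost
  omega

/-- An item can be kept if some other item dominates it. -/
theorem exists_keep_of_dominated {items : List ℕ} (hi : items.Nodup) {ts : List Clause}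
    (hts : ClausesWF items ts) (κ : ℕ → Bool) {x w : ℕ} (hx : x ∈ items) (hwx : w ≠ x)
    (h : ∀ t ∈ ts, touches x t → t.2 = [] ∧ ∀ u ∈ t.1, u = x ∨ u = w) :
    ∃ κ', κ' x = true ∧ cost items ts κ' ≤ cost items ts κ := by
  by_cases hκ : κ x = true
  · exact ⟨κ, hκ, le_rfl⟩
  -- Exchange: delete `w` in place of `x`. Of a clause touched by `x` only `x` can then be kept, and
  -- this single tolerated item violates nothing.
  set κ₁ := Function.update κ w false with hκ₁
  refine ⟨Function.update κ₁ x true, by simp, ?_⟩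
  have h0 : κ₁ x = false := by rw [hκ₁, Function.update_of_ne hwx.symm]; simpa using hκ
  have h1 := countP_update_true hx h0
  have h2 : items.countP (fun u => !κ₁ u)
      ≤ items.countP (fun u => !κ u) + items.countP (fun u => decide (u = w)) := by
    refine countP_le_add fun u _ hu => ?_
    by_cases huw : u = w
    · exact Or.inr (by simp [huw])
    · rw [hκ₁, Function.update_of_ne huw] at hu
      exact Or.inl hu
  have h3 := countP_eq_le_one hi w
  have h4 : ts.countP (bad (Function.update κ₁ x true)) ≤ ts.countP (bad κ) := by
    refine countP_mono fun t ht hb => ?_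
    by_cases htx : touches x t = true
    · obtain ⟨h5, h6⟩ := h t ht htx
      simp only [bad, h5, List.any_nil, Bool.false_or, decide_eq_true_eq] at hb
      have h7 : t.1.countP (Function.update κ₁ x true) ≤ t.1.countP (fun u => decide (u = x)) := by
        refine countP_mono fun u hu hκu => ?_
        rcases h6 u hu with rfl | rfl
        · simp
        · rw [Function.update_of_ne hwx, hκ₁] at hκu
          simp at hκu
      have := countP_eq_le_one (hts t ht).1 x
      omega
    · rcases bad_update_true hb with h5 | h5
      · refine bad_mono (fun u hu => ?_) h5
        by_cases huw : u = w
        · simp [hκ₁, huw] at hu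
        · rwa [hκ₁, Function.update_of_ne huw] at hu
      · exact absurd h5 htx
  unfold cost
  omega

/-! ### Vertex covers and crowns -/

theorem countP_add_le_add {α : Type*} {l : List α} {p q r s : α → Bool}
    (h : ∀ a ∈ l, (p a).toNat + (q a).toNat ≤ (r a).toNat + (s a).toNat) :
    l.countP p + l.countP q ≤ l.countP r + l.countP s := by
  induction l with
  | nil => simp
  | cons a l ih =>
    have h1 := ih fun b hb => h b (by simp [hb])
    have h2 := h a (by simp)
    simp only [List.countP_cons]
    cases hr : r a <;> cases hp : p a <;> cases hq : q a <;> cases hs : s a <;> simp_all <;> omega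

theorem countP_inactiveLists (ts : List Clause) (q : List ℕ → Bool) :
    (inactiveLists ts).countP q = ts.countP fun t => !active t && q t.2 := by
  simp only [inactiveLists, List.countP_map, List.countP_filter, Function.comp_def]
  exact List.countP_congr fun t _ => by simp [and_comm]

theorem uncovered_iff {items y : List ℕ} {A : ℕ → Bool} :
    (items.any fun w => y.contains w && !A w) = true ↔ ∃ w ∈ items, w ∈ y ∧ A w = false := by
  simp

/-- Item counts are modular. A list not covered by the union is covered by neither set, and a list
not covered by the intersection is missed by at least one of them. -/
theorem cover_submodular (items : List ℕ) (Ys : List (List ℕ)) (A B : ℕ → Bool) :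
    cover items Ys (fun w => A w || B w) + cover items Ys (fun w => A w && B w)
      ≤ cover items Ys A + cover items Ys B := by
  have h1 : items.countP (fun w => A w || B w) + items.countP (fun w => A w && B w)
      ≤ items.countP A + items.countP B :=
    countP_add_le_add fun w _ => by cases A w <;> cases B w <;> simp
  have h2 : Ys.countP (fun y => items.any fun w => y.contains w && !(A w || B w))
      + Ys.countP (fun y => items.any fun w => y.contains w && !(A w && B w))
      ≤ Ys.countP (fun y => items.any fun w => y.contains w && !A w)
      + Ys.countP (fun y => items.any fun w => y.contains w && !B w) := by
    refine countP_add_le_add fun y _ => ?_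
    have e1 : (items.any fun w => y.contains w && !(A w || B w)) = true →
        (items.any fun w => y.contains w && !A w) = true ∧
        (items.any fun w => y.contains w && !B w) = true := by
      rw [uncovered_iff, uncovered_iff, uncovered_iff]
      rintro ⟨w, h1, h2, h3⟩
      simp only [Bool.or_eq_false_iff] at h3
      exact ⟨⟨w, h1, h2, h3.1⟩, w, h1, h2, h3.2⟩
    have e2 : (items.any fun w => y.contains w && !(A w && B w)) = true →
        (items.any fun w => y.contains w && !A w) = true ∨
        (items.any fun w => y.contains w && !B w) = true := by
      rw [uncovered_iff, uncovered_iff, uncovered_iff]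
      rintro ⟨w, h1, h2, h3⟩
      simp only [Bool.and_eq_false_iff] at h3
      exact h3.imp (fun h => ⟨w, h1, h2, h⟩) fun h => ⟨w, h1, h2, h⟩
    revert e1 e2
    generalize (items.any fun w => y.contains w && !(A w || B w)) = a
    generalize (items.any fun w => y.contains w && !(A w && B w)) = b
    generalize (items.any fun w => y.contains w && !A w) = c
    generalize (items.any fun w => y.contains w && !B w) = d
    revert a b c d
    decide
  simp only [cover]
  omega

theorem cover_congr {items : List ℕ} (Ys : List (List ℕ)) {A B : ℕ → Bool}
    (h : ∀ w ∈ items, A w = B w) : cover items Ys A = cover items Ys B := by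
  unfold cover
  congr 1
  · exact List.countP_congr fun w hw => by rw [h w hw]
  · refine List.countP_congr fun y _ => ?_
    rw [uncovered_iff, uncovered_iff]
    exact exists_congr fun w => and_congr_right fun hw => by rw [h w hw]

theorem countP_delItems {Δ items : List ℕ} {A : ℕ → Bool} (h : ∀ w ∈ Δ, A w = true) :
    items.countP A = (items.countP fun w => Δ.contains w) + (delItems Δ items).countP A := by
  unfold delItems
  rw [List.countP_filter]
  refine le_antisymm (countP_le_add ?_) (countP_add_le ?_ ?_ ?_)
  · intro a _ ha
    by_cases haΔ : a ∈ Δ <;> simp_all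
  · intro a _ ha
    exact h a (by simpa using ha)
  · intro a _ ha
    simp at ha; exact ha.1
  · intro a _ ha ha'
    simp at ha ha'; exact ha'.2 ha

theorem cover_delItems {Δ items : List ℕ} (Ys : List (List ℕ)) {A : ℕ → Bool}
    (h : ∀ w ∈ Δ, A w = true) : cover items Ys A
      = (items.countP fun w => Δ.contains w) + cover (delItems Δ items) Ys A := by
  have h2 : Ys.countP (fun y => items.any fun w => y.contains w && !A w)
      = Ys.countP (fun y => (delItems Δ items).any fun w => y.contains w && !A w) := by
    refine List.countP_congr fun y _ => ?_
    rw [uncovered_iff, uncovered_iff]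
    refine exists_congr fun w => ⟨fun hw => ⟨mem_delItems.2 ⟨hw.1, fun hc => ?_⟩, hw.2⟩,
      fun hw => ⟨(mem_delItems.1 hw.1).1, hw.2⟩⟩
    simp [h w hc] at hw
  rw [cover, countP_delItems h, h2, cover]
  omega

/-- The minimum size of a vertex cover that contains `Δ`. -/
theorem tau_delItems_le {Δ items : List ℕ} (hi : items.Nodup) (Ys : List (List ℕ)) {A : ℕ → Bool}
    (h : ∀ w ∈ Δ, A w = true) :
    (items.countP fun w => Δ.contains w) + tau (delItems Δ items) Ys ≤ cover items Ys A := by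
  rw [cover_delItems Ys h]
  exact Nat.add_le_add_left (tau_le_cover (delItems_nodup hi) Ys A) _

theorem exists_cover_eq_tau_delItems (Δ : List ℕ) {items : List ℕ} (hi : items.Nodup)
    (Ys : List (List ℕ)) : ∃ A : ℕ → Bool, (∀ w ∈ Δ, A w = true) ∧
      cover items Ys A = (items.countP fun w => Δ.contains w) + tau (delItems Δ items) Ys := by
  obtain ⟨A, hA⟩ := exists_cover_eq_tau (delItems_nodup hi (Δ := Δ)) Ys
  refine ⟨fun w => A w || Δ.contains w, fun w hw => by simp [hw], ?_⟩
  rw [cover_delItems Ys (Δ := Δ) fun w hw => by simp [hw], ← hA]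
  congr 1
  refine cover_congr Ys fun w hw => ?_
  simp [(mem_delItems.1 hw).2]

theorem delItems_nil (items : List ℕ) : delItems [] items = items := by simp [delItems]

/-- The greedy loop adds `x` iff the enlarged set still extends to a minimum cover. An item once
rejected stays rejected, because later sets only grow. So a minimum cover containing the final set
has no further items, and the final set is itself the item part of a minimum cover. -/
theorem crown_spec {items : List ℕ} (hi : items.Nodup) (Ys : List (List ℕ)) :
    (∀ w ∈ crown items Ys, w ∈ items) ∧
    cover items Ys (fun w => (crown items Ys).contains w) = tau items Ys ∧
    ∀ A : ℕ → Bool, (∀ w ∈ crown items Ys, A w = true) → cover items Ys A = tau items Ys →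
      ∀ w ∈ items, A w = true → w ∈ crown items Ys := by
  have key : ∀ (l : List ℕ), l.Nodup → (∀ x ∈ l, x ∈ items) → ∀ Δ : List ℕ,
      (∀ w ∈ Δ, w ∈ items ∧ w ∉ l) →
      (items.countP fun w => Δ.contains w) + tau (delItems Δ items) Ys = tau items Ys →
      (∀ x ∈ items, x ∉ l → x ∉ Δ → ∀ A : ℕ → Bool, (∀ w ∈ Δ, A w = true) → A x = true →
        tau items Ys < cover items Ys A) →
      ∃ Δ', l.foldl (fun Δ x => bif decide (tau (delItems (x :: Δ) items) Ys
        < tau (delItems Δ items) Ys) then x :: Δ else Δ) Δ = Δ' ∧ (∀ w ∈ Δ', w ∈ items) ∧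
      (items.countP fun w => Δ'.contains w) + tau (delItems Δ' items) Ys = tau items Ys ∧
      (∀ x ∈ items, x ∉ Δ' → ∀ A : ℕ → Bool, (∀ w ∈ Δ', A w = true) → A x = true →
        tau items Ys < cover items Ys A) := by
    intro l
    induction l with
    | nil =>
      intro _ _ Δ h1 h2 h3
      exact ⟨Δ, rfl, fun w hw => (h1 w hw).1, h2, fun x hx => h3 x hx (by simp)⟩
    | cons a l ih =>
      intro hl hl' Δ h1 h2 h3
      rw [List.foldl_cons]
      rw [List.nodup_cons] at hl
      have ha : a ∈ items := hl' a (by simp)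
      have haΔ : a ∉ Δ := fun h => (h1 a h).2 (by simp)
      have hcount : (items.countP fun w => (a :: Δ).contains w)
          = (items.countP fun w => Δ.contains w) + 1 := by
        have e1 : items.countP (fun w => decide (w = a)) = 1 :=
          le_antisymm (countP_eq_le_one hi a) (List.countP_pos_iff.2 ⟨a, ha, by simp⟩)
        rw [← e1]
        refine le_antisymm (countP_le_add ?_) (countP_add_le ?_ ?_ ?_)
        · intro w _ hw
          simpa [or_comm] using hw
        · intro w _ hw
          simp at hw; simp [hw]
        · intro w _ hw
          simp at hw; simp [hw]
        · intro w _ hw hw'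
          simp at hw hw'; exact haΔ (hw' ▸ hw)
      by_cases hlt : tau (delItems (a :: Δ) items) Ys < tau (delItems Δ items) Ys
      · rw [decide_eq_true hlt, cond_true]
        refine ih hl.2 (fun x hx => hl' x (by simp [hx])) (a :: Δ) ?_ ?_ ?_
        · intro w hw
          rcases List.mem_cons.1 hw with rfl | hw
          · exact ⟨ha, hl.1⟩
          · exact ⟨(h1 w hw).1, fun h => (h1 w hw).2 (by simp [h])⟩
        -- One more forced item and a strictly smaller rest cost at most `tau` together; the lower
        -- bound gives equality.
        · obtain ⟨A, hA, hA'⟩ := exists_cover_eq_tau_delItems (a :: Δ) hi Ys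
          have := tau_le_cover hi Ys A
          omega
        · intro x hx hxl hxΔ A hA hAx
          simp only [List.mem_cons, not_or] at hxΔ
          exact h3 x hx (by simp [hxΔ.1, hxl]) hxΔ.2 A (fun w hw => hA w (by simp [hw])) hAx
      · rw [decide_eq_false hlt, cond_false]
        refine ih hl.2 (fun x hx => hl' x (by simp [hx])) Δ
          (fun w hw => ⟨(h1 w hw).1, fun h => (h1 w hw).2 (by simp [h])⟩) h2 ?_
        intro x hx hxl hxΔ A hA hAx
        by_cases hxa : x = a
        · subst hxa
          have h4 := tau_delItems_le (Δ := x :: Δ) hi Ys (A := A) (by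
            intro w hw
            rcases List.mem_cons.1 hw with rfl | hw
            exacts [hAx, hA w hw])
          omega
        · exact h3 x hx (by simp [hxa, hxl]) hxΔ A hA hAx
  obtain ⟨Δ, h1, h2, h3, h4⟩ := key items hi (fun _ h => h) [] (by simp) (by simp [delItems_nil])
    (fun x hx hx' => absurd hx hx')
  replace h1 : crown items Ys = Δ := h1
  rw [h1]
  have h5 : ∀ A : ℕ → Bool, (∀ w ∈ Δ, A w = true) → cover items Ys A = tau items Ys →
      ∀ w ∈ items, A w = true → w ∈ Δ := by
    intro A hA hA' w hw hAw
    by_contra hc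
    have := h4 w hw hc A hA hAw
    omega
  refine ⟨h2, ?_, h5⟩
  obtain ⟨A, hA, hA'⟩ := exists_cover_eq_tau_delItems Δ hi Ys
  rw [h3] at hA'
  rw [← hA']
  refine cover_congr Ys fun w hw => ?_
  rw [Bool.eq_iff_iff, List.contains_iff_mem]
  exact ⟨hA w, h5 A hA hA' w hw⟩

/-- An inactive clause has at most one tolerated item, so it is violated iff an untolerated item is
kept, that is, iff the deleted items fail to cover its list. -/
theorem cost_eq {items : List ℕ} {ts : List Clause} (hts : ClausesWF items ts) (κ : ℕ → Bool) :
    cost items ts κ = cover items (inactiveLists ts) (fun w => !κ w)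
      + ts.countP fun t => active t && bad κ t := by
  have key : ts.countP (bad κ) = (inactiveLists ts).countP (fun y => items.any fun w =>
      y.contains w && !!κ w) + ts.countP fun t => active t && bad κ t := by
    rw [countP_inactiveLists]
    have h0 : ∀ t ∈ ts, active t = false →
        ((items.any fun w => t.2.contains w && !!κ w) = bad κ t) := by
      intro t ht hat
      have h1 : t.1.countP κ < 2 := by
        have : t.1.countP κ ≤ t.1.length := List.countP_le_length
        simp only [active, decide_eq_false_iff_not] at hat
        omega
      rw [Bool.eq_iff_iff, uncovered_iff (A := fun w => !κ w)]
      simp only [bad, Bool.or_eq_true, List.any_eq_true, decide_eq_true_eq, not_le.2 h1, or_false]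
      refine exists_congr fun w => ⟨fun h => ⟨h.2.1, by simpa using h.2.2⟩,
        fun h => ⟨(hts t ht).2.2.1 w h.1, h.1, by simpa using h.2⟩⟩
    refine le_antisymm (countP_le_add ?_) (countP_add_le ?_ ?_ ?_)
    · intro t ht hb
      cases hat : active t
      · simp only [Bool.not_false, Bool.true_and]; exact Or.inl (by rw [h0 t ht hat]; exact hb)
      · exact Or.inr (by simpa using hb)
    · intro t ht hb
      simp only [Bool.and_eq_true, Bool.not_eq_true'] at hb
      rw [← h0 t ht hb.1]
      exact hb.2
    · intro t _ hb
      simp only [Bool.and_eq_true] at hb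
      exact hb.2
    · intro t _ hb hb'
      simp only [Bool.and_eq_true, Bool.not_eq_true'] at hb hb'
      simp [hb'.1] at hb
  rw [cost, key, cover]
  omega

theorem tau_le_of_yes {s : State} (h : s.2.1.Nodup) (hts : ClausesWF s.2.1 s.2.2) (hs : s.Yes) :
    tau s.2.1 (inactiveLists s.2.2) ≤ s.1 := by
  obtain ⟨κ, hκ⟩ := hs
  rw [cost_eq hts] at hκ
  have := tau_le_cover h (inactiveLists s.2.2) fun w => !κ w
  omega

/-- Deleting a crown is safe. -/
theorem exists_del_crown {items : List ℕ} (hi : items.Nodup) {ts : List Clause}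
    (hts : ClausesWF items ts) (κ : ℕ → Bool) :
    ∃ κ' : ℕ → Bool, (∀ w ∈ crown items (inactiveLists ts), κ' w = false) ∧
      cost items ts κ' ≤ cost items ts κ := by
  set Δ := crown items (inactiveLists ts)
  refine ⟨fun w => κ w && !Δ.contains w, fun w hw => by simp [hw], ?_⟩
  -- `Δ` is a minimum cover and the intersection costs at least as much, so the union costs no more
  -- than the items deleted by `κ`. Further deletions cannot violate an active clause.
  have h1 := cover_submodular items (inactiveLists ts) (fun w => !κ w) fun w => Δ.contains w
  have h2 : cover items (inactiveLists ts) (fun w => Δ.contains w) = tau items (inactiveLists ts) :=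
    (crown_spec hi (inactiveLists ts)).2.1
  have h3 := tau_le_cover hi (inactiveLists ts) fun w => !κ w && Δ.contains w
  rw [cost_eq hts, cost_eq hts]
  have h4 : ts.countP (fun t => active t && bad (fun w => κ w && !Δ.contains w) t)
      ≤ ts.countP fun t => active t && bad κ t := by
    refine countP_mono fun t _ h => ?_
    simp only [Bool.and_eq_true] at h ⊢
    exact ⟨h.1, bad_mono (fun w hw => by simp at hw; exact hw.1) h.2⟩
  have h5 : cover items (inactiveLists ts) (fun w => !(κ w && !Δ.contains w))
      = cover items (inactiveLists ts) (fun w => !κ w || Δ.contains w) :=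
    cover_congr _ fun w _ => by simp
  omega

/-! ### Expanding a state is correct -/

theorem mem_push {c : ℕ} {s s' : State} : s' ∈ push c s ↔
    c ≤ s.1 ∧ tau s.2.1 (inactiveLists s.2.2) ≤ s.1 - c ∧ s' = (s.1 - c, s.2) := by
  unfold push
  by_cases h1 : c ≤ s.1 <;> by_cases h2 : tau s.2.1 (inactiveLists s.2.2) ≤ s.1 - c <;> simp [h1, h2]

/-- Nothing is lost by dropping states: `tau` is a lower bound for the cost of every choice. -/
theorem exists_push_yes {c : ℕ} {s : State} (h : s.2.1.Nodup) (hts : ClausesWF s.2.1 s.2.2) :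
    (∃ s' ∈ push c s, s'.Yes) ↔ ∃ κ, c + cost s.2.1 s.2.2 κ ≤ s.1 := by
  constructor
  · rintro ⟨s', hs', κ, hκ⟩
    obtain ⟨h1, -, rfl⟩ := mem_push.1 hs'
    refine ⟨κ, ?_⟩
    simp only at hκ
    omega
  · rintro ⟨κ, hκ⟩
    have hy : State.Yes (s.1 - c, s.2) := ⟨κ, by simp only; omega⟩
    exact ⟨_, mem_push.2 ⟨by omega, tau_le_of_yes (s := (s.1 - c, s.2)) h hts hy, rfl⟩, hy⟩

theorem exists_pushDel_yes {s : State} (hs : s.WF) (Δ : List ℕ) :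
    (∃ s' ∈ pushDel Δ s, s'.Yes) ↔
      ∃ κ : ℕ → Bool, (∀ w ∈ Δ, κ w = false) ∧ cost s.2.1 s.2.2 κ ≤ s.1 := by
  rw [pushDel, exists_push_yes (delItems_nodup hs.1) (hs.2.1.del Δ), exists_cost_del_iff hs.2.1]

theorem exists_pushKeep_yes {s : State} (hs : s.WF) (x : ℕ) :
    (∃ s' ∈ pushKeep x s, s'.Yes) ↔
      ∃ κ : ℕ → Bool, κ x = true ∧ cost s.2.1 s.2.2 κ ≤ s.1 := by
  rw [pushKeep, exists_push_yes (delItems_nodup hs.1) (hs.2.1.keep x), exists_cost_keep_iff hs.2.1]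

theorem forced_iff {x : ℕ} {s : State} : forced x s = true ↔
    s.2.2.countP (touches x) ≤ 1 ∨ ∃ w ∈ s.2.1, w ≠ x ∧
      ∀ t ∈ s.2.2, touches x t → t.2 = [] ∧ ∀ u ∈ t.1, u = x ∨ u = w := by
  simp [forced, imp_iff_not_or]

theorem dropSet_eq (x : ℕ) (s : State) : dropSet x s = [x] ∨
    s.2.2.countP (touches x) = 2 ∧ ∃ y ∈ s.2.2, touches x y ∧ active y = false ∧
      dropSet x s = y.2 := by
  unfold dropSet
  by_cases h : s.2.2.countP (touches x) = 2
  · rcases hC : (s.2.2.filter (touches x)).filter fun t => !active t with _ | ⟨y, l⟩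
    · simp
    · have hy : y ∈ (s.2.2.filter (touches x)).filter fun t => !active t := by simp [hC]
      simp only [List.mem_filter] at hy
      exact Or.inr ⟨h, y, hy.1.1, hy.1.2, by simpa using hy.2, by simp [h]⟩
  · simp [h]

theorem branch_correct {s : State} (hs : s.WF) {x : ℕ} (hx : x ∈ s.2.1) :
    (∃ s' ∈ branch x s, s'.Yes) ↔ s.Yes := by
  unfold branch
  simp only [List.mem_append, or_and_right, exists_or, exists_pushKeep_yes hs]
  constructor
  · rintro (⟨κ, -, h⟩ | h)
    · exact ⟨κ, h⟩
    · cases hf : forced x s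
      · rw [hf, cond_false, exists_pushDel_yes hs] at h
        obtain ⟨κ, -, h⟩ := h
        exact ⟨κ, h⟩
      · simp [hf] at h
  · rintro ⟨κ, hκ⟩
    cases hf : forced x s
    · rw [cond_false, exists_pushDel_yes hs]
      by_cases hκx : κ x = true
      · exact Or.inl ⟨κ, hκx, hκ⟩
      rcases dropSet_eq x s with h | ⟨h, y, hy, hty, hay, h'⟩
      · rw [h]
        exact Or.inr ⟨κ, by simpa using hκx, hκ⟩
      · rw [h']
        by_cases hb : bad κ y = true
        · left
          -- One of the two touched clauses is already violated, so keeping `x` violates at most one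
          -- more.
          obtain ⟨κ', h1, h2⟩ := exists_keep_of_countP (κ := κ) hx (ts := s.2.2) (by
            have h3 : s.2.2.countP (fun t => touches x t && !bad κ t)
                + s.2.2.countP (fun t => touches x t && bad κ t) ≤ s.2.2.countP (touches x) :=
              countP_add_le (by simp +contextual) (by simp +contextual) (by simp +contextual)
            have h4 : 0 < s.2.2.countP (fun t => touches x t && bad κ t) :=
              List.countP_pos_iff.2 ⟨y, hy, by simp [hty, hb]⟩
            omega)
          exact ⟨κ', h1, h2.trans hκ⟩
        · refine Or.inr ⟨κ, fun w hw => ?_, hκ⟩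
          simp only [bad, Bool.or_eq_true, List.any_eq_true, not_or, not_exists, not_and] at hb
          simpa using hb.1 w hw
    · left
      rcases forced_iff.1 hf with h | ⟨w, -, hwx, h⟩
      · obtain ⟨κ', h1, h2⟩ := exists_keep_of_countP (κ := κ) hx (ts := s.2.2)
          ((countP_mono (by simp +contextual)).trans h)
        exact ⟨κ', h1, h2.trans hκ⟩
      · obtain ⟨κ', h1, h2⟩ := exists_keep_of_dominated hs.1 hs.2.1 κ hx hwx h
        exact ⟨κ', h1, h2.trans hκ⟩

/-- The three outcomes of an expansion. -/
theorem expand_cases (s : State) :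
    (crown s.2.1 (inactiveLists s.2.2) ≠ [] ∧
      expand s = (false, pushDel (crown s.2.1 (inactiveLists s.2.2)) s)) ∨
    (crown s.2.1 (inactiveLists s.2.2) = [] ∧ (∀ t ∈ s.2.2, active t = false) ∧
      expand s = (true, [])) ∨
    (crown s.2.1 (inactiveLists s.2.2) = [] ∧ ∃ t ∈ s.2.2, active t = true ∧ ∃ x ∈ t.1,
      expand s = (false, branch x s)) := by
  unfold expand
  rcases hΔ : crown s.2.1 (inactiveLists s.2.2) with _ | ⟨a, Δ⟩
  · rcases hC : s.2.2.filter active with _ | ⟨t, l⟩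
    · refine Or.inr (Or.inl ⟨rfl, ?_, by simp⟩)
      simpa using hC
    · have ht : t ∈ s.2.2.filter active := by simp [hC]
      rw [List.mem_filter] at ht
      refine Or.inr (Or.inr ⟨rfl, t, ht.1, ht.2, ?_⟩)
      rcases h1 : t.1 with _ | ⟨x, U⟩
      · simp [active, h1] at ht
      · exact ⟨x, by simp, by simp [h1]⟩
  · exact Or.inl ⟨by simp, by simp⟩

theorem expand_correct {s : State} (hs : s.WF) :
    ((expand s).1 = true ∨ ∃ s' ∈ (expand s).2, s'.Yes) ↔ s.Yes := by
  rcases expand_cases s with ⟨-, h⟩ | ⟨-, hi, h⟩ | ⟨-, t, ht, -, x, hx, h⟩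
  · rw [h]
    simp only [Bool.false_eq_true, false_or, exists_pushDel_yes hs]
    constructor
    · rintro ⟨κ, -, hκ⟩
      exact ⟨κ, hκ⟩
    · rintro ⟨κ, hκ⟩
      obtain ⟨κ', h1, h2⟩ := exists_del_crown hs.1 hs.2.1 κ
      exact ⟨κ', h1, h2.trans hκ⟩
  · rw [h]
    simp only [true_or, true_iff]
    -- Without active clauses the cost is exactly a vertex cover, and well-formedness puts the
    -- minimum within the budget.
    obtain ⟨A, hA⟩ := exists_cover_eq_tau hs.1 (inactiveLists s.2.2)
    refine ⟨fun w => !A w, ?_⟩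
    have h2 : s.2.2.countP (fun t => active t && bad (fun w => !A w) t) = 0 := by
      rw [List.countP_eq_zero]
      intro t ht
      simp [hi t ht]
    have h3 : cover s.2.1 (inactiveLists s.2.2) (fun w => !!A w)
        = cover s.2.1 (inactiveLists s.2.2) A := cover_congr _ (by simp)
    have := hs.2.2
    rw [cost_eq hs.2.1]
    omega
  · rw [h]
    simp only [Bool.false_eq_true, false_or]
    exact branch_correct hs ((hs.2.1 t ht).2.1 x hx)

theorem pushDel_wf {s : State} (hs : s.WF) (Δ : List ℕ) : ∀ s' ∈ pushDel Δ s, s'.WF := by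
  intro s' hs'
  obtain ⟨-, h, rfl⟩ := mem_push.1 hs'
  exact ⟨delItems_nodup hs.1, hs.2.1.del Δ, h⟩

theorem pushKeep_wf {s : State} (hs : s.WF) (x : ℕ) : ∀ s' ∈ pushKeep x s, s'.WF := by
  intro s' hs'
  obtain ⟨-, h, rfl⟩ := mem_push.1 hs'
  exact ⟨delItems_nodup hs.1, hs.2.1.keep x, h⟩

theorem branch_wf {s : State} (hs : s.WF) (x : ℕ) : ∀ s' ∈ branch x s, s'.WF := by
  intro s' hs'
  rcases List.mem_append.1 hs' with h | h
  · exact pushKeep_wf hs x s' h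
  · cases hf : forced x s
    · rw [hf] at h; exact pushDel_wf hs _ s' h
    · simp [hf] at h

theorem expand_wf {s : State} (hs : s.WF) : ∀ s' ∈ (expand s).2, s'.WF := by
  rcases expand_cases s with ⟨-, h⟩ | ⟨-, hi, h⟩ | ⟨-, t, ht, -, x, hx, h⟩ <;> rw [h]
  · exact pushDel_wf hs _
  · simp
  · exact branch_wf hs x

/-! ### The measure of a state -/

/-- The lower bound for the cost of a state. -/
def State.low (s : State) : ℕ := tau s.2.1 (inactiveLists s.2.2)

/-- The number of items in the crown of a state. -/
def State.crownSize (s : State) : ℕ :=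
  s.2.1.countP fun w => (crown s.2.1 (inactiveLists s.2.2)).contains w

/-- The measure that the branching decreases. -/
def State.measure (s : State) : ℕ := 3 * s.1 - 2 * s.low - s.crownSize

/-- Deleting items can make active clauses inactive but not conversely, so a cover after the
deletion, together with `Δ`, covers the old lists. -/
theorem cover_le_del (items : List ℕ) (ts : List Clause) (Δ : List ℕ) (A : ℕ → Bool) :
    cover items (inactiveLists ts) (fun w => A w || Δ.contains w)
      ≤ (items.countP fun w => Δ.contains w)
        + cover (delItems Δ items) (inactiveLists (delClauses Δ ts)) A := by
  rw [cover_delItems (Δ := Δ) _ fun w hw => by simp [hw]]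
  refine Nat.add_le_add_left ?_ _
  unfold cover
  rw [countP_inactiveLists, countP_inactiveLists, delClauses, List.countP_map]
  refine add_le_add (countP_mono fun w hw h => ?_) (countP_mono fun t _ h => ?_)
  · simpa [(mem_delItems.1 hw).2] using h
  · simp only [Function.comp, Bool.and_eq_true, Bool.not_eq_true', uncovered_iff, active,
      decide_eq_false_iff_not, not_le, Bool.or_eq_false_iff] at h ⊢
    obtain ⟨h1, w, h2, h3, h4⟩ := h
    refine ⟨lt_of_le_of_lt (List.length_filter_le _ _) h1, ?_⟩
    exact ⟨w, h2, mem_delItems.2 ⟨h3, (mem_delItems.1 h2).2⟩, h4.1⟩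

theorem length_delItems (Δ items : List ℕ) :
    (delItems Δ items).length + (items.countP fun w => Δ.contains w) = items.length := by
  have := countP_delItems (Δ := Δ) (items := items) (A := fun _ => true) (by simp)
  simp at this
  simp
  omega

/-- Deleting `D` items that raise the lower bound by `b` lowers the measure by `D + 2 * b`. -/
theorem measure_pushDel {s : State} {Δ : List ℕ} (b : ℕ)
    (hb : ∀ A : ℕ → Bool, (∀ w ∈ Δ, A w = true) → s.low + b ≤ cover s.2.1 (inactiveLists s.2.2) A)
    (hs : s.WF) : ∀ s' ∈ pushDel Δ s, s'.measure + (s.2.1.countP fun w => Δ.contains w) + 2 * b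
      ≤ 3 * s.1 - 2 * s.low ∧
      s'.2.1.length + (s.2.1.countP fun w => Δ.contains w) = s.2.1.length := by
  intro s' hs'
  obtain ⟨h1, h2, rfl⟩ := mem_push.1 hs'
  simp only at h1 h2
  refine ⟨?_, length_delItems _ _⟩
  obtain ⟨A, hA⟩ := exists_cover_eq_tau (delItems_nodup (Δ := Δ) hs.1)
    (inactiveLists (delClauses Δ s.2.2))
  have h3 := cover_le_del s.2.1 s.2.2 Δ A
  have h4 := hb (fun w => A w || Δ.contains w) fun w hw => by simp [hw]
  have h5 := hs.2.2
  simp only [State.measure, State.low] at *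
  omega

/-- With `low` bounded by the budget, this shows that the subtractions in `State.measure` are never
truncated for well-formed states. -/
theorem crownSize_le_low {s : State} (hs : s.WF) : s.crownSize ≤ s.low := by
  rw [State.low, ← (crown_spec hs.1 (inactiveLists s.2.2)).2.1]
  exact Nat.le_add_right _ _

/-- By maximality of the crown, a minimum cover that contains an item would put that item into the
crown. -/
theorem reduced_lt_cover {s : State} (hs : s.WF)
    (hc : crown s.2.1 (inactiveLists s.2.2) = []) {A : ℕ → Bool} {w : ℕ} (hw : w ∈ s.2.1)
    (hA : A w = true) : s.low + 1 ≤ cover s.2.1 (inactiveLists s.2.2) A := by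
  have h1 := (crown_spec hs.1 (inactiveLists s.2.2)).2.2 A
  have h2 := tau_le_cover hs.1 (inactiveLists s.2.2) A
  rw [hc] at h1
  unfold State.low
  by_contra h3
  have := h1 (by simp) (by omega) w hw hA
  simp at this

theorem reduced_low {s : State} (hs : s.WF) (hc : crown s.2.1 (inactiveLists s.2.2) = []) :
    cover s.2.1 (inactiveLists s.2.2) (fun _ => false) = s.low := by
  have h1 := (crown_spec hs.1 (inactiveLists s.2.2)).2.1
  rw [hc] at h1
  simpa [State.low] using h1

theorem exists_mem_ne {l : List ℕ} (hl : l.Nodup) (h : 2 ≤ l.length) (x : ℕ) : ∃ u ∈ l, u ≠ x := by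
  by_contra! hc
  have h1 := countP_eq_le_one hl x
  have h2 : l.countP (fun w => decide (w = x)) = l.length :=
    List.countP_eq_length.2 fun u hu => by simp [hc u hu]
  omega

/-- The items of an active clause that become untolerated if `x` is kept are not all in `A`. -/
def opens (items : List ℕ) (x : ℕ) (A : ℕ → Bool) (t : Clause) : Bool :=
  active t && t.1.contains x &&
    (delItems [x] items).any fun w => (delItems [x] (t.2 ++ t.1)).contains w && !A w

/-- Of the uncovered inactive clauses, keeping `x` removes only some that do not tolerate `x`. In
return the active clauses that tolerate `x` become inactive, and those counted by `opens` are
uncovered. -/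
theorem cover_le_keep {items : List ℕ} {ts : List Clause} (hts : ClausesWF items ts) {x : ℕ}
    {A : ℕ → Bool} (hA : A x = false) :
    cover items (inactiveLists ts) A + ts.countP (opens items x A)
      ≤ cover (delItems [x] items) (inactiveLists (keepClauses x ts)) A
        + ts.countP fun t => !active t && t.2.contains x := by
  unfold cover
  have h1 : items.countP A = (delItems [x] items).countP A := by
    unfold delItems
    rw [List.countP_filter]
    refine List.countP_congr fun w _ => ?_
    by_cases hw : w = x <;> simp [hw, hA]
  rw [countP_inactiveLists, countP_inactiveLists, keepClauses, List.countP_map, List.countP_filter]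
  have h2 : ts.countP (fun t => !active t && items.any fun w => t.2.contains w && !A w)
      ≤ ts.countP (fun t => !t.2.contains x && (!active t &&
        (delItems [x] items).any fun w => t.2.contains w && !A w))
        + ts.countP (fun t => !active t && t.2.contains x) := by
    refine countP_le_add fun t _ h => ?_
    simp only [Bool.and_eq_true, Bool.not_eq_true', uncovered_iff] at h ⊢
    obtain ⟨h1, w, h2, h3, h4⟩ := h
    by_cases hx : x ∈ t.2
    · exact Or.inr ⟨h1, by simpa using hx⟩
    · exact Or.inl ⟨by simpa using hx, h1, w, mem_delItems.2 ⟨h2, fun h => hx (by simp at h; rwa [h] at h3)⟩,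
        h3, h4⟩
  have h3 : ts.countP (fun t => !t.2.contains x && (!active t &&
        (delItems [x] items).any fun w => t.2.contains w && !A w)) + ts.countP (opens items x A)
      ≤ ts.countP (fun t => ((fun t => !active t && (delItems [x] items).any fun w =>
        t.2.contains w && !A w) ∘ fun t : Clause =>
          bif t.1.contains x then ([], delItems [x] (t.2 ++ t.1)) else t) t && !t.2.contains x) := by
    refine countP_add_le ?_ ?_ ?_
    · intro t _ h
      simp only [Bool.and_eq_true, Bool.not_eq_true', Function.comp] at h ⊢
      refine ⟨?_, h.1⟩
      by_cases hx : x ∈ t.1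
      · simp only [List.contains_iff_mem.2 hx, cond_true]
        refine ⟨by simp [active], ?_⟩
        rw [uncovered_iff] at h ⊢
        obtain ⟨-, -, w, h2, h3, h4⟩ := h
        exact ⟨w, h2, mem_delItems.2 ⟨by simp [h3], (mem_delItems.1 h2).2⟩, h4⟩
      · have : t.1.contains x = false := by simpa using hx
        simp only [this, cond_false]
        exact h.2
    · intro t ht h
      simp only [opens, Bool.and_eq_true, Bool.not_eq_true', Function.comp] at h ⊢
      refine ⟨?_, ?_⟩
      · rw [h.1.2]
        exact ⟨by simp [active], h.2⟩
      · simpa using (hts t ht).2.2.2 x (by simpa using h.1.2)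
    · intro t _ h h'
      simp only [opens, Bool.and_eq_true, Bool.not_eq_true'] at h h'
      simp [h.2.1] at h'
  omega

theorem exists_unique_of_countP_eq_one {l : List ℕ} {p : ℕ → Bool} (h : l.countP p = 1) :
    ∃ w ∈ l, p w = true ∧ ∀ u ∈ l, p u = true → u = w := by
  rw [List.countP_eq_length_filter, List.length_eq_one_iff] at h
  obtain ⟨w, hw⟩ := h
  have h1 : ∀ u, u ∈ l.filter p ↔ u = w := by simp [hw]
  simp only [List.mem_filter] at h1
  exact ⟨w, ((h1 w).2 rfl).1, ((h1 w).2 rfl).2, fun u hu hpu => (h1 u).1 ⟨hu, hpu⟩⟩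

/-! ### The effect of keeping an item in a state without a crown. -/

section keep

variable {s : State} (hs : s.WF) (hc : crown s.2.1 (inactiveLists s.2.2) = []) {t : Clause}
  (ht : t ∈ s.2.2) (hat : active t = true) {x : ℕ} (hx : x ∈ t.1)

-- Every active clause that tolerates `x` tolerates another item too, so it becomes an inactive
-- clause with a nonempty list and is missed by the empty cover.
include hs hc in
theorem low_add_le_keep_nil : s.low + s.2.2.countP (fun t => active t && t.1.contains x)
    ≤ cover (delItems [x] s.2.1) (inactiveLists (keepClauses x s.2.2)) (fun _ => false)
      + s.2.2.countP fun t => !active t && t.2.contains x := by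
  have h1 := cover_le_keep hs.2.1 (x := x) (A := fun _ => false) rfl
  rw [reduced_low hs hc] at h1
  refine le_trans (Nat.add_le_add_left (countP_mono fun t ht h => ?_) _) h1
  rw [Bool.and_eq_true] at h
  rw [opens, Bool.and_eq_true, Bool.and_eq_true, uncovered_iff]
  refine ⟨h, ?_⟩
  obtain ⟨u, hu, hux⟩ := exists_mem_ne (hs.2.1 t ht).1 (by simpa [active] using h.1) x
  exact ⟨u, mem_delItems.2 ⟨(hs.2.1 t ht).2.1 u hu, by simpa using hux⟩,
    mem_delItems.2 ⟨by simp [hu], by simpa using hux⟩, rfl⟩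

-- A cover that uses an item already exceeds `low` in the old state, because the crown is empty. The
-- cover without items misses the newly inactive clause that comes from `t`.
include hs hc ht hat hx in
theorem low_succ_le_keep (A : ℕ → Bool) : s.low + 1
    ≤ cover (delItems [x] s.2.1) (inactiveLists (keepClauses x s.2.2)) A
      + s.2.2.countP fun t => !active t && t.2.contains x := by
  by_cases h : ∃ w ∈ delItems [x] s.2.1, A w = true
  · obtain ⟨w, hw, hA⟩ := h
    have hw' := mem_delItems.1 hw
    have h1 := cover_le_keep hs.2.1 (x := x) (A := fun u => A u && !decide (u = x)) (by simp)
    have h2 := reduced_lt_cover hs hc (A := fun u => A u && !decide (u = x)) hw'.1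
      (by simpa [hA] using hw'.2)
    have h3 : cover (delItems [x] s.2.1) (inactiveLists (keepClauses x s.2.2))
        (fun u => A u && !decide (u = x))
        = cover (delItems [x] s.2.1) (inactiveLists (keepClauses x s.2.2)) A := by
      refine cover_congr _ fun u hu => ?_
      have := (mem_delItems.1 hu).2
      simp at this
      simp [this]
    omega
  · push Not at h
    have h1 := low_add_le_keep_nil hs hc (x := x)
    have h2 : 0 < s.2.2.countP (fun t => active t && t.1.contains x) :=
      List.countP_pos_iff.2 ⟨t, ht, by simp [hat, hx]⟩
    rw [cover_congr (A := fun _ => false) (B := A) _ fun u hu => by simpa using (h u hu).symm] at h1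
    omega

-- The cover by `w` alone costs at least `low + 1` already before `x` is kept. If it costs no more
-- afterwards, `w` has to cover every clause that becomes inactive. So these clauses contain no
-- items besides `x` and `w`, and `w` is tolerated, which leaves their untolerated lists empty.
include hs hc in
theorem dominated_of_cover_keep (hd : s.2.2.countP (fun t => !active t && t.2.contains x) = 0)
    (hσ : s.2.2.countP (fun t => active t && t.2.contains x) = 0) {w : ℕ}
    (hw : w ∈ delItems [x] s.2.1)
    (h : cover (delItems [x] s.2.1) (inactiveLists (keepClauses x s.2.2)) (fun u => decide (u = w))
      ≤ s.low + 1) : ∀ t ∈ s.2.2, touches x t → t.2 = [] ∧ ∀ u ∈ t.1, u = x ∨ u = w := by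
  intro t ht htx
  have hw' := mem_delItems.1 hw
  have hwx : w ≠ x := by simpa using hw'.2
  have h1 := cover_le_keep hs.2.1 (x := x) (A := fun u => decide (u = w)) (by simpa using hwx.symm)
  have h2 := reduced_lt_cover hs hc (A := fun u => decide (u = w)) hw'.1 (by simp)
  have h3 : s.2.2.countP (opens s.2.1 x fun u => decide (u = w)) = 0 := by omega
  rw [List.countP_eq_zero] at hd hσ h3
  have hd' := hd t ht
  have hσ' := hσ t ht
  have h4 : active t = true ∧ x ∈ t.1 := by
    simp only [touches, Bool.or_eq_true, Bool.and_eq_true, List.contains_iff_mem] at htx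
    rcases htx with htx | htx
    · cases ha : active t <;> simp_all
    · exact htx
  obtain ⟨w1, w2, w3, w4⟩ := hs.2.1 t ht
  have h5 : ∀ u, u ∈ t.2 ++ t.1 → u ≠ x → u = w := by
    intro u hu hux
    by_contra hc
    refine h3 t ht ?_
    rw [opens, Bool.and_eq_true, Bool.and_eq_true, uncovered_iff]
    refine ⟨⟨h4.1, by simpa using h4.2⟩, u, mem_delItems.2 ⟨?_, by simpa using hux⟩,
      mem_delItems.2 ⟨hu, by simpa using hux⟩, by simpa using hc⟩
    rcases List.mem_append.1 hu with h | h
    exacts [w3 u h, w2 u h]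
  obtain ⟨u, hu, hux⟩ := exists_mem_ne w1 (by simpa [active] using h4.1) x
  have hwt : w ∈ t.1 := by rwa [← h5 u (by simp [hu]) hux]
  refine ⟨?_, fun u hu => ?_⟩
  · rw [List.eq_nil_iff_forall_not_mem]
    intro v hv
    have hvx : v ≠ x := fun e => w4 x h4.2 (e ▸ hv)
    have := h5 v (by simp [hv]) hvx
    exact w4 w hwt (this ▸ hv)
  · by_cases h : u = x
    · exact Or.inl h
    · exact Or.inr (h5 u (by simp [hu]) h)

include hs in
theorem countP_touches : s.2.2.countP (touches x)
    = s.2.2.countP (fun t => !active t && t.2.contains x)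
      + s.2.2.countP (fun t => active t && t.2.contains x)
      + s.2.2.countP (fun t => active t && t.1.contains x) := by
  have h1 : s.2.2.countP (touches x) = s.2.2.countP (fun t => t.2.contains x)
      + s.2.2.countP (fun t => active t && t.1.contains x) := by
    refine le_antisymm (countP_le_add ?_) (countP_add_le ?_ ?_ ?_)
    · intro t _ h
      simpa [touches] using h
    · intro t _ h
      simp only [touches, h, Bool.true_or]
    · intro t _ h
      simp only [touches, h, Bool.or_true]
    · intro t ht h h'
      simp at h h'
      exact (hs.2.1 t ht).2.2.2 x h'.2 h
  have h2 : s.2.2.countP (fun t => t.2.contains x)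
      = s.2.2.countP (fun t => !active t && t.2.contains x)
      + s.2.2.countP (fun t => active t && t.2.contains x) := by
    refine le_antisymm (countP_le_add ?_) (countP_add_le ?_ ?_ ?_)
    · intro t _ h
      cases active t <;> simp_all
    · intro t _ h
      simp at h; simp [h.2]
    · intro t _ h
      simp at h; simp [h.2]
    · intro t _ h h'
      simp at h h'; simp [h'.1] at h
  omega

include hs hc ht hat hx in
/-- How the measure drops when an item is kept. -/
theorem measure_pushKeep : ∀ s' ∈ pushKeep x s,
    s'.2.1.length + 1 ≤ s.2.1.length ∧ s'.measure ≤ s.measure ∧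
    (forced x s = false → s'.measure + 3 ≤ s.measure ∧ (s'.measure + 4 ≤ s.measure ∨
      s.2.2.countP (touches x) = 2 ∧ ∃ y ∈ s.2.2, active y = false ∧ x ∈ y.2)) := by
  intro s' hs'
  have hwf := pushKeep_wf hs x s' hs'
  obtain ⟨h1, h2, h3⟩ := mem_push.1 hs'
  simp only at h1 h2 h3
  have hxi : x ∈ s.2.1 := (hs.2.1 t ht).2.1 x hx
  have hlen : s'.2.1.length + 1 ≤ s.2.1.length := by
    have := length_delItems [x] s.2.1
    have h4 : 0 < s.2.1.countP (fun w => [x].contains w) :=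
      List.countP_pos_iff.2 ⟨x, hxi, by simp⟩
    simp only [h3]
    omega
  refine ⟨hlen, ?_⟩
  have ht1 := countP_touches hs (x := x)
  have hch : s.2.2.countP (fun t => t.2.contains x) + s.2.2.countP (fun t => active t && t.1.contains x)
      = s.2.2.countP (touches x) := by
    refine le_antisymm (countP_add_le ?_ ?_ ?_) (countP_le_add ?_)
    · intro t _ h
      simp only [touches, h, Bool.true_or]
    · intro t _ h
      simp only [touches, h, Bool.or_true]
    · intro t ht h h'
      simp at h h'
      exact (hs.2.1 t ht).2.2.2 x h'.2 h
    · intro t _ h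
      simpa [touches] using h
  have hr : 0 < s.2.2.countP (fun t => active t && t.1.contains x) :=
    List.countP_pos_iff.2 ⟨t, ht, by simp [hat, hx]⟩
  have hy : 0 < s.2.2.countP (fun t => !active t && t.2.contains x) →
      ∃ y ∈ s.2.2, active y = false ∧ x ∈ y.2 := by
    intro h
    obtain ⟨y, hy, h⟩ := List.countP_pos_iff.1 h
    exact ⟨y, hy, by simpa using h⟩
  have hD := dominated_of_cover_keep hs hc (x := x)
  have hN := low_add_le_keep_nil hs hc (x := x)
  have hK := low_succ_le_keep hs hc ht hat hx
  have hcr : s.crownSize = 0 := by simp [State.crownSize, hc]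
  have hf : forced x s = false → 2 ≤ s.2.2.countP (touches x) ∧ ¬ ∃ w ∈ s.2.1, w ≠ x ∧
      ∀ t ∈ s.2.2, touches x t → t.2 = [] ∧ ∀ u ∈ t.1, u = x ∨ u = w := by
    intro h
    have := (not_congr forced_iff).1 (by rw [h]; simp)
    rw [not_or] at this
    exact ⟨by omega, this.2⟩
  obtain ⟨c1, c2, -⟩ := crown_spec hwf.1 (inactiveLists s'.2.2)
  have hst : s'.2.1 = delItems [x] s.2.1 := by rw [h3]
  have hst' : s'.2.2 = keepClauses x s.2.2 := by rw [h3]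
  have hk : s'.1 = s.1 - s.2.2.countP (fun t => t.2.contains x) := by rw [h3]
  rw [← hst, ← hst'] at hN hD
  rw [← hst, ← hst'] at hK
  have hK' := hK fun w => (crown s'.2.1 (inactiveLists s'.2.2)).contains w
  rw [c2] at hK'
  have hzero : s'.crownSize = 0 →
      cover s'.2.1 (inactiveLists s'.2.2) (fun _ => false) = s'.low := by
    intro h
    rw [State.low, ← c2]
    refine cover_congr _ fun w hw => ?_
    rw [State.crownSize, List.countP_eq_zero] at h
    simpa using (h w hw)
  have hone : s'.crownSize = 1 → ∃ w ∈ s'.2.1,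
      cover s'.2.1 (inactiveLists s'.2.2) (fun u => decide (u = w)) = s'.low := by
    intro h
    obtain ⟨w, hw, hw', hu⟩ := exists_unique_of_countP_eq_one h
    refine ⟨w, hw, ?_⟩
    rw [State.low, ← c2]
    refine cover_congr _ fun u hu' => ?_
    rw [Bool.eq_iff_iff]
    exact ⟨fun e => by simp at e; rwa [e], fun e => by simpa using hu u hu' e⟩
  have hlow := hs.2.2
  have hmeas : s.measure = 3 * s.1 - 2 * s.low := by simp [State.measure, hcr]
  have hmeas' : s'.measure = 3 * s'.1 - 2 * s'.low - s'.crownSize := rfl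
  have hlow' := hwf.2.2
  have hcs := crownSize_le_low hwf
  rw [← State.low] at hlow hlow' hK'
  refine ⟨by omega, fun hfx => ?_⟩
  obtain ⟨hf1, hf2⟩ := hf hfx
  -- Here `d` and `σ` count the inactive and active clauses that do not tolerate `x`, and `r` the
  -- active ones that tolerate it. The measure drops by `3 * (d + σ)`, plus twice the rise of `low`,
  -- plus the new crown size. As the new `low` plus `d` is at least `low + 1`, this is at least `2 +
  -- d + 3 * σ` plus the new crown size; the cases below look for 4.
  generalize s.2.2.countP (fun t => t.2.contains x) = ch at *
  generalize s.2.2.countP (fun t => !active t && t.2.contains x) = d at *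
  generalize s.2.2.countP (fun t => active t && t.2.contains x) = σ at *
  generalize s.2.2.countP (fun t => active t && t.1.contains x) = r at *
  generalize s.2.2.countP (touches x) = c at *
  by_cases hbig : s.low + 2 ≤ s'.low + d
  · exact ⟨by omega, by omega⟩
  by_cases hσ : 1 ≤ σ
  · exact ⟨by omega, by omega⟩
  by_cases hd2 : 2 ≤ d
  · exact ⟨by omega, by omega⟩
  -- With no new crown the empty cover is minimum, so `r` is 1. As at least two clauses are touched,
  -- `d` is 1: the one case with a drop of only 3.
  by_cases ha0 : s'.crownSize = 0
  · have := hzero ha0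
    have hd1 : 0 < d := by omega
    exact ⟨by omega, Or.inr ⟨by omega, hy hd1⟩⟩
  by_cases hd0 : d = 0
  -- A crown with a single item `w` would make `w` dominate `x`, and then keeping `x` would be
  -- forced.
  · by_cases ha1 : s'.crownSize = 1
    · exfalso
      obtain ⟨w, hw, hcw⟩ := hone ha1
      have hw' := mem_delItems.1 (hst ▸ hw)
      exact hf2 ⟨w, hw'.1, by simpa using hw'.2, hD hd0 (by omega) hw (by omega)⟩
    · exact ⟨by omega, by omega⟩
  · exact ⟨by omega, by omega⟩

end keep

/-! ### The potential of a state -/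

/-- A bound for the number of nodes of the search tree of a state. -/
noncomputable def State.pot (β : ℝ) (s : State) : ℝ := (s.2.1.length + 1) * β ^ s.measure

section pot

variable {β : ℝ} (hβ : 1 ≤ β)

include hβ in
theorem one_le_pot (s : State) : 1 ≤ s.pot β := by
  have h1 : (1 : ℝ) ≤ β ^ s.measure := one_le_pow₀ hβ
  have h2 : (0 : ℝ) ≤ s.2.1.length := Nat.cast_nonneg _
  unfold State.pot
  nlinarith

-- `push` yields at most one state. Multiplying by `β ^ j` expresses the gain from a drop by `j`
-- without division.
include hβ in
theorem sum_push_pot {c : ℕ} {s : State} {q m j : ℕ}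
    (h : ∀ s' ∈ push c s, s'.2.1.length + 1 ≤ q ∧ s'.measure + j ≤ m) :
    ((push c s).map (State.pot β)).sum * β ^ j ≤ q * β ^ m := by
  have h0 : (0 : ℝ) ≤ β := by linarith
  by_cases hp : push c s = []
  · rw [hp]
    simp only [List.map_nil, List.sum_nil, zero_mul]
    positivity
  · obtain ⟨a, l, hal⟩ := List.exists_cons_of_ne_nil hp
    have hl : push c s = [a] := by
      have : a ∈ push c s := by simp [hal]
      obtain ⟨h1, h2, -⟩ := mem_push.1 this
      unfold push at hal ⊢
      rw [decide_eq_true h1, decide_eq_true h2] at hal ⊢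
      simp at hal ⊢
      exact hal.1
    obtain ⟨h1, h2⟩ := h a (by simp [hl])
    rw [hl]
    simp only [List.map_cons, List.map_nil, List.sum_cons, List.sum_nil, add_zero, State.pot]
    rw [mul_assoc, ← pow_add]
    have h3 : ((a.2.1.length : ℝ) + 1) ≤ q := by exact_mod_cast h1
    exact mul_le_mul h3 (pow_le_pow_right₀ hβ h2) (by positivity) (by positivity)

theorem low_lt_dropSet {s : State} (hs : s.WF) (hc : crown s.2.1 (inactiveLists s.2.2) = [])
    {Δ : List ℕ} {x : ℕ} (hx : x ∈ s.2.1) (hxΔ : x ∈ Δ) (A : ℕ → Bool) (hA : ∀ w ∈ Δ, A w = true) :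
    s.low + 1 ≤ cover s.2.1 (inactiveLists s.2.2) A :=
  reduced_lt_cover hs hc hx (hA x hxΔ)

/-- The items of `y.2` cover at least the list of `y` itself. If there were only one of them,
exchanging that list for the item would give a minimum cover with an item, although the crown is
empty. -/
theorem two_le_countP {s : State} (hs : s.WF) (hc : crown s.2.1 (inactiveLists s.2.2) = [])
    {x : ℕ} (hx : x ∈ s.2.1) {y : Clause} (hy : y ∈ s.2.2) (hay : active y = false)
    (hxy : x ∈ y.2) : 2 ≤ s.2.1.countP fun w => y.2.contains w := by
  have h1 := reduced_lt_cover hs hc (A := fun w => y.2.contains w) hx (by simpa using hxy)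
  have h2 := reduced_low hs hc
  rw [cover, countP_inactiveLists] at h1 h2
  have h3 : s.2.2.countP (fun t => !active t && s.2.1.any fun w => t.2.contains w && !y.2.contains w)
      + s.2.2.countP (fun t => (!active t && s.2.1.any fun w => t.2.contains w && !false) &&
        !(s.2.1.any fun w => t.2.contains w && !y.2.contains w))
      ≤ s.2.2.countP (fun t => !active t && s.2.1.any fun w => t.2.contains w && !false) := by
    refine countP_add_le ?_ ?_ ?_
    · intro t _ h
      rw [Bool.and_eq_true, uncovered_iff] at h ⊢
      obtain ⟨h, w, h1, h2, -⟩ := h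
      exact ⟨h, w, h1, h2, rfl⟩
    · intro t _ h
      rw [Bool.and_eq_true] at h
      exact h.1
    · intro t _ h h'
      rw [Bool.and_eq_true] at h h'
      rw [h.2] at h'
      simp at h'
  have h4 : 0 < s.2.2.countP (fun t => (!active t && s.2.1.any fun w => t.2.contains w && !false) &&
        !(s.2.1.any fun w => t.2.contains w && !y.2.contains w)) := by
    refine List.countP_pos_iff.2 ⟨y, hy, ?_⟩
    simp only [Bool.and_eq_true, Bool.not_eq_true', hay, true_and]
    refine ⟨(uncovered_iff (A := fun _ => false)).2 ⟨x, hx, hxy, rfl⟩, ?_⟩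
    rw [Bool.eq_false_iff, ne_eq, uncovered_iff]
    rintro ⟨w, -, h1, h2⟩
    simp [h1] at h2
  have h5 : s.2.1.countP (fun _ => false) = 0 := by simp
  rw [h5] at h2
  omega

theorem dropSet_of_inactive {s : State} {x : ℕ} (h : s.2.2.countP (touches x) = 2)
    (hy : ∃ y ∈ s.2.2, active y = false ∧ x ∈ y.2) :
    ∃ y ∈ s.2.2, active y = false ∧ x ∈ y.2 ∧ dropSet x s = y.2 := by
  obtain ⟨y, hy, hay, hxy⟩ := hy
  unfold dropSet
  rcases hC : (s.2.2.filter (touches x)).filter fun t => !active t with _ | ⟨z, l⟩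
  · have : y ∈ (s.2.2.filter (touches x)).filter fun t => !active t := by
      simp [List.mem_filter, hy, hay, touches, hxy]
    simp [hC] at this
  · have hz : z ∈ (s.2.2.filter (touches x)).filter fun t => !active t := by simp [hC]
    simp only [List.mem_filter, touches, Bool.or_eq_true, Bool.and_eq_true, Bool.not_eq_true',
      List.contains_iff_mem] at hz
    refine ⟨z, hz.1.1, hz.2, ?_, by simp [h]⟩
    rcases hz.1.2 with h' | h'
    · exact h'
    · simp [h'.1] at hz

-- Deleting one item drops the measure by 3: one for the item and two for the gain on `low`. If
-- keeping `x` drops it by only 3, then `dropSet` contains at least two items and deletion drops it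
-- by 4. Thus the worst case is always the branching (3, 4).
include hβ in
theorem branch_pot (hβ' : β + 1 ≤ β ^ 4) {s : State} (hs : s.WF)
    (hc : crown s.2.1 (inactiveLists s.2.2) = []) {t : Clause} (ht : t ∈ s.2.2)
    (hat : active t = true) {x : ℕ} (hx : x ∈ t.1) :
    ((branch x s).map (State.pot β)).sum ≤ s.2.1.length * β ^ s.measure ∧
      ∀ s' ∈ branch x s, s'.2.1.length + 1 ≤ s.2.1.length := by
  have h0 : (0 : ℝ) < β := by linarith
  have hK := measure_pushKeep hs hc ht hat hx
  have hxi : x ∈ s.2.1 := (hs.2.1 t ht).2.1 x hx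
  have hmeas : s.measure = 3 * s.1 - 2 * s.low := by simp [State.measure, State.crownSize, hc]
  unfold branch
  rw [List.map_append, List.sum_append]
  cases hf : forced x s
  · rw [cond_false]
    have hxd : x ∈ dropSet x s := by
      rcases dropSet_eq x s with h | ⟨-, y, -, hty, hay, h⟩
      · simp [h]
      · rw [h]
        simpa [touches, hay] using hty
    have hD := measure_pushDel (Δ := dropSet x s) 1 (low_lt_dropSet hs hc hxi hxd) hs
    have hD1 : 0 < s.2.1.countP (fun w => (dropSet x s).contains w) :=
      List.countP_pos_iff.2 ⟨x, hxi, by simpa using hxd⟩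
    rw [← hmeas] at hD
    refine ⟨?_, fun s' hs' => ?_⟩
    swap
    · rcases List.mem_append.1 hs' with h | h
      · exact (hK s' h).1
      · have := (hD s' h).2; omega
    have key : ∀ a b : ℝ, a * β ^ 3 ≤ s.2.1.length * β ^ s.measure →
        b * β ^ 4 ≤ s.2.1.length * β ^ s.measure → a + b ≤ s.2.1.length * β ^ s.measure := by
      intro a b ha hb
      set R := (s.2.1.length : ℝ) * β ^ s.measure with hR
      have hR0 : 0 ≤ R := by positivity
      have e1 : (a + b) * β ^ 4 ≤ R * β ^ 4 := by
        calc (a + b) * β ^ 4 = a * β ^ 3 * β + b * β ^ 4 := by ring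
          _ ≤ R * β + R := by gcongr
          _ = R * (β + 1) := by ring
          _ ≤ R * β ^ 4 := by gcongr
      exact le_of_mul_le_mul_right e1 (by positivity)
    by_cases h2 : s.2.2.countP (touches x) = 2 ∧ ∃ y ∈ s.2.2, active y = false ∧ x ∈ y.2
    · obtain ⟨y, hy, hay, hxy, hdy⟩ := dropSet_of_inactive h2.1 h2.2
      have h3 := two_le_countP hs hc hxi hy hay hxy
      refine key _ _ (sum_push_pot hβ fun s' hs' => ⟨(hK s' hs').1, ((hK s' hs').2.2 hf).1⟩)
        (sum_push_pot hβ fun s' hs' => ?_)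
      have h4 := hD s' hs'
      rw [hdy] at h4
      omega
    · rw [add_comm]
      refine key _ _ (sum_push_pot hβ fun s' hs' => ?_) (sum_push_pot hβ fun s' hs' =>
        ⟨(hK s' hs').1, ((hK s' hs').2.2 hf).2.resolve_right h2⟩)
      have h4 := hD s' hs'
      omega
  · rw [cond_true]
    simp only [List.map_nil, List.sum_nil, add_zero, List.append_nil]
    refine ⟨?_, fun s' hs' => (hK s' hs').1⟩
    have := sum_push_pot (j := 0) hβ fun s' hs' => ⟨(hK s' hs').1, (hK s' hs').2.1⟩
    rwa [pow_zero, mul_one] at this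

include hβ in
theorem expand_pot (hβ' : β + 1 ≤ β ^ 4) {s : State} (hs : s.WF) :
    (((expand s).2.map (State.pot β)).sum + 1 ≤ s.pot β) ∧
      ∀ s' ∈ (expand s).2, s'.2.1.length + 1 ≤ s.2.1.length := by
  have h1 : (1 : ℝ) ≤ β ^ s.measure := one_le_pow₀ hβ
  -- The summand 1 in the factor `length + 1` leaves `β ^ measure`, which is at least 1 and pays for
  -- the expanded node itself.
  suffices ((expand s).2.map (State.pot β)).sum ≤ s.2.1.length * β ^ s.measure ∧
      ∀ s' ∈ (expand s).2, s'.2.1.length + 1 ≤ s.2.1.length by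
    refine ⟨?_, this.2⟩
    have := this.1
    unfold State.pot at this ⊢
    linarith
  rcases expand_cases s with ⟨hne, h⟩ | ⟨-, -, h⟩ | ⟨hc, t, ht, hat, x, hx, h⟩
  · rw [h]
    obtain ⟨a, Δ, hΔ⟩ := List.exists_cons_of_ne_nil hne
    have ha : a ∈ crown s.2.1 (inactiveLists s.2.2) := by simp [hΔ]
    have hai := (crown_spec hs.1 (inactiveLists s.2.2)).1 a ha
    have hpos : 0 < s.2.1.countP fun w => (crown s.2.1 (inactiveLists s.2.2)).contains w :=
      List.countP_pos_iff.2 ⟨a, hai, by simpa using ha⟩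
    have hD := measure_pushDel (Δ := crown s.2.1 (inactiveLists s.2.2)) 0
      (fun A _ => tau_le_cover hs.1 _ A) hs
    have hm : s.measure = 3 * s.1 - 2 * s.low - s.crownSize := rfl
    have hcs : s.crownSize = s.2.1.countP fun w => (crown s.2.1 (inactiveLists s.2.2)).contains w :=
      rfl
    have hlen : ∀ s' ∈ pushDel (crown s.2.1 (inactiveLists s.2.2)) s,
        s'.2.1.length + 1 ≤ s.2.1.length := fun s' hs' => by have := (hD s' hs').2; omega
    refine ⟨?_, hlen⟩
    have := sum_push_pot (j := 0) hβ fun s' hs' => ⟨hlen s' hs', show s'.measure + 0 ≤ s.measure by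
      have := (hD s' hs').1; omega⟩
    rwa [pow_zero, mul_one] at this
  · rw [h]
    refine ⟨?_, by simp⟩
    simp only [List.map_nil, List.sum_nil]
    positivity
  · rw [h]
    exact branch_pot hβ hβ' hs hc ht hat hx

end pot

/-! ### Expansions take polynomial time -/

theorem sz_push_le {c : ℕ} {s s' : State} (h : s' ∈ push c s) : sz s' ≤ sz s := by
  obtain ⟨-, -, rfl⟩ := mem_push.1 h
  obtain ⟨k, s⟩ := s
  simp [sz_nat]

theorem sz_delItems_le (Δ items : List ℕ) : sz (delItems Δ items) ≤ sz items :=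
  sz_sublist List.filter_sublist

theorem sz_pushDel_le {Δ : List ℕ} {s s' : State} (h : s' ∈ pushDel Δ s) : sz s' ≤ sz s := by
  refine (sz_push_le h).trans ?_
  have h1 := sz_delItems_le Δ s.2.1
  have h2 : sz (delClauses Δ s.2.2) ≤ sz s.2.2 := sz_map_le fun t _ => by
    have h1 := sz_delItems_le Δ t.1
    have h2 := sz_delItems_le Δ t.2
    obtain ⟨U, A⟩ := t
    simp only [sz_pair] at *
    omega
  obtain ⟨k, items, ts⟩ := s
  simp only [sz_pair] at *
  omega

theorem sz_pushKeep_le {x : ℕ} {s s' : State} (h : s' ∈ pushKeep x s) : sz s' ≤ sz s := by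
  refine (sz_push_le h).trans ?_
  have h1 := sz_delItems_le [x] s.2.1
  have h2 : sz (keepClauses x s.2.2) ≤ sz s.2.2 := by
    refine (sz_map_le fun t _ => ?_).trans (sz_sublist List.filter_sublist)
    cases t.1.contains x
    · simp
    · have h1 := sz_delItems_le [x] (t.2 ++ t.1)
      have h2 := sz_append t.2 t.1
      obtain ⟨U, A⟩ := t
      simp only [sz_pair, cond_true, sz_nil] at *
      omega
  obtain ⟨k, items, ts⟩ := s
  simp only [sz_pair] at *
  omega

theorem sz_expand_le {s s' : State} (h : s' ∈ (expand s).2) : sz s' ≤ sz s := by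
  rcases expand_cases s with ⟨-, h'⟩ | ⟨-, -, h'⟩ | ⟨-, t, -, -, x, -, h'⟩ <;> rw [h'] at h
  · exact sz_pushDel_le h
  · simp at h
  · rcases List.mem_append.1 h with h | h
    · exact sz_pushKeep_le h
    · cases hf : forced x s <;> rw [hf] at h
      · exact sz_pushDel_le h
      · simp at h

theorem length_push_le (c : ℕ) (s : State) : (push c s).length ≤ 1 := by
  unfold push
  cases decide (c ≤ s.1) && decide (tau s.2.1 (inactiveLists s.2.2) ≤ s.1 - c) <;> simp

theorem length_expand_le (s : State) : (expand s).2.length ≤ 2 := by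
  rcases expand_cases s with ⟨-, h'⟩ | ⟨-, -, h'⟩ | ⟨-, t, -, -, x, -, h'⟩ <;> rw [h']
  · exact (length_push_le _ _).trans (by simp)
  · simp
  · simp only [branch, List.length_append]
    have h1 : (pushKeep x s).length ≤ 1 := length_push_le _ _
    have h2 : (pushDel (dropSet x s) s).length ≤ 1 := length_push_le _ _
    cases forced x s
    · simp; omega
    · simp; omega

section time

variable {α : Type} [Enc α]

@[fun_prop]
theorem PT.active {t : α → Clause} (ht : PT t) : PT (fun a => active (t a)) := by
  unfold SFVS.active; fun_prop

@[fun_prop]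
theorem PT.inactiveLists {ts : α → List Clause} (ht : PT ts) :
    PT (fun a => inactiveLists (ts a)) := by
  unfold SFVS.inactiveLists; fun_prop

@[fun_prop]
theorem PT.delItems {Δ items : α → List ℕ} (hΔ : PT Δ) (hi : PT items) :
    PT (fun a => delItems (Δ a) (items a)) := by
  unfold SFVS.delItems; fun_prop

@[fun_prop]
theorem PT.delClauses {Δ : α → List ℕ} {ts : α → List Clause} (hΔ : PT Δ) (ht : PT ts) :
    PT (fun a => delClauses (Δ a) (ts a)) := by
  unfold SFVS.delClauses; fun_prop

@[fun_prop]
theorem PT.keepClauses {x : α → ℕ} {ts : α → List Clause} (hx : PT x) (ht : PT ts) :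
    PT (fun a => keepClauses (x a) (ts a)) := by
  unfold SFVS.keepClauses; fun_prop

@[fun_prop]
theorem PT.touches {x : α → ℕ} {t : α → Clause} (hx : PT x) (ht : PT t) :
    PT (fun a => touches (x a) (t a)) := by
  unfold SFVS.touches; fun_prop

@[fun_prop]
theorem PT.push {c : α → ℕ} {s : α → State} (hc : PT c) (hs : PT s) :
    PT (fun a => push (c a) (s a)) := by
  unfold SFVS.push; fun_prop

@[fun_prop]
theorem PT.pushDel {Δ : α → List ℕ} {s : α → State} (hΔ : PT Δ) (hs : PT s) :
    PT (fun a => pushDel (Δ a) (s a)) := by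
  unfold SFVS.pushDel; fun_prop

@[fun_prop]
theorem PT.pushKeep {x : α → ℕ} {s : α → State} (hx : PT x) (hs : PT s) :
    PT (fun a => pushKeep (x a) (s a)) := by
  unfold SFVS.pushKeep; fun_prop

@[fun_prop]
theorem PT.crown {items : α → List ℕ} {Ys : α → List (List ℕ)} (hi : PT items) (hY : PT Ys) :
    PT (fun a => crown (items a) (Ys a)) := by
  unfold SFVS.crown
  refine PT.foldl (g := fun a (Δ : List ℕ) (x : ℕ) =>
    bif decide (SFVS.tau (SFVS.delItems (x :: Δ) (items a)) (Ys a)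
      < SFVS.tau (SFVS.delItems Δ (items a)) (Ys a)) then x :: Δ else Δ) (by fun_prop)
    (by fun_prop) (by fun_prop) ⟨Polynomial.X, fun a c x => ?_⟩
  have h1 : sz (x :: c) ≤ sz c + sz (a, x) := by simp; omega
  cases decide (SFVS.tau (SFVS.delItems (x :: c) (items a)) (Ys a)
      < SFVS.tau (SFVS.delItems c (items a)) (Ys a))
  · simp
  · simpa using h1

@[fun_prop]
theorem PT.forced {x : α → ℕ} {s : α → State} (hx : PT x) (hs : PT s) :
    PT (fun a => forced (x a) (s a)) := by
  unfold SFVS.forced; fun_prop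

@[fun_prop]
theorem PT.dropSet {x : α → ℕ} {s : α → State} (hx : PT x) (hs : PT s) :
    PT (fun a => dropSet (x a) (s a)) := by
  unfold SFVS.dropSet; fun_prop

@[fun_prop]
theorem PT.branch {x : α → ℕ} {s : α → State} (hx : PT x) (hs : PT s) :
    PT (fun a => branch (x a) (s a)) := by
  unfold SFVS.branch; fun_prop

@[fun_prop]
theorem PT.expand {s : α → State} (hs : PT s) : PT (fun a => expand (s a)) := by
  unfold SFVS.expand; fun_prop

end time

/-! ### The search -/

/-- One round of the search: expand the first state on the stack. -/
def searchStep (z : Bool × List State) : Bool × List State :=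
  List.casesOn (motive := fun _ => Bool × List State) z.2 z fun s rest =>
    bif (expand s).1 then (true, []) else (z.1, (expand s).2 ++ rest)

@[fun_prop]
theorem PT.searchStep {α : Type} [Enc α] {z : α → Bool × List State} (hz : PT z) :
    PT (fun a => searchStep (z a)) := by
  unfold SFVS.searchStep; fun_prop

/-- The invariant of the stack. -/
def StackOK (n B : ℕ) : List State → Prop
  | [] => True
  -- An expansion removes an item and lengthens the stack by at most one, so the sum never grows.
  -- This bounds the height of the stack by `n + 1`.
  | s :: rest => s.WF ∧ sz s ≤ B ∧ s.2.1.length + rest.length ≤ n ∧ StackOK n B rest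

theorem StackOK.sz_le {n B : ℕ} {st : List State} (h : StackOK n B st) :
    sz st ≤ 1 + (n + 1) * (B + 1) := by
  have key : ∀ st : List State, StackOK n B st → sz st ≤ 1 + st.length * (B + 1) ∧
      st.length ≤ n + 1 := by
    intro st
    induction st with
    | nil => simp
    | cons s rest ih =>
      rintro ⟨-, h1, h2, h3⟩
      have := ih h3
      simp only [sz_cons, List.length_cons, add_mul]
      omega
  obtain ⟨h1, h2⟩ := key st h
  have := Nat.mul_le_mul_right (B + 1) h2
  omega

theorem StackOK.expand {n B : ℕ} {β : ℝ} (hβ : 1 ≤ β) (hβ' : β + 1 ≤ β ^ 4) {s : State}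
    {rest : List State} (h : StackOK n B (s :: rest)) : StackOK n B ((expand s).2 ++ rest) := by
  obtain ⟨h1, h2, h3, h4⟩ := h
  have e1 := expand_wf h1
  have e2 := (expand_pot hβ hβ' h1).2
  have e3 := length_expand_le s
  have e4 : ∀ s' ∈ (SFVS.expand s).2, sz s' ≤ B := fun s' hs' => (sz_expand_le hs').trans h2
  rcases hc : (SFVS.expand s).2 with _ | ⟨a, _ | ⟨b, _ | ⟨c, l⟩⟩⟩ <;> rw [hc] at e1 e2 e3 e4
  · exact h4
  · have := e2 a (by simp)
    exact ⟨e1 a (by simp), e4 a (by simp), by simp; omega, h4⟩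
  · have ha := e2 a (by simp)
    have hb := e2 b (by simp)
    exact ⟨e1 a (by simp), e4 a (by simp), by simp; omega,
      e1 b (by simp), e4 b (by simp), by simp; omega, h4⟩
  · simp at e3

/-- The search stops with the correct answer, after at most as many rounds as the potential of the
stack tells. -/
theorem search_correct {n B : ℕ} {β : ℝ} (hβ : 1 ≤ β) (hβ' : β + 1 ≤ β ^ 4) (N : ℕ) (b : Bool)
    (st : List State) (hst : StackOK n B st) (hN : (st.map (State.pot β)).sum < N) :
    ∃ (m : ℕ) (b' : Bool), (m : ℝ) ≤ (st.map (State.pot β)).sum ∧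
      (∀ i < m, (searchStep^[i] (b, st)).2.isEmpty = false) ∧ searchStep^[m] (b, st) = (b', []) ∧
      (b' = true ↔ b = true ∨ ∃ s ∈ st, s.Yes) ∧ ∀ i ≤ m, StackOK n B (searchStep^[i] (b, st)).2 := by
  have h0 : (0 : ℝ) ≤ β := by linarith
  have hnn : ∀ st : List State, 0 ≤ (st.map (State.pot β)).sum := by
    intro st
    refine List.sum_nonneg fun a ha => ?_
    obtain ⟨s, -, rfl⟩ := List.mem_map.1 ha
    exact le_trans zero_le_one (one_le_pot hβ s)
  -- The potential is real; the integer `N` above it serves for the induction, since every round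
  -- that does not stop the search lowers the potential by at least 1.
  induction N generalizing b st with
  | zero =>
    have := hnn st
    simp only [Nat.cast_zero] at hN
    linarith
  | succ N ih =>
    rcases st with _ | ⟨s, rest⟩
    · refine ⟨0, b, by simp, by simp, rfl, by simp, fun i hi => ?_⟩
      obtain rfl : i = 0 := by omega
      trivial
    · have hs := hst.1
      have hE := expand_correct hs
      obtain ⟨hp, -⟩ := expand_pot hβ hβ' hs
      have hr := hnn rest
      rw [List.map_cons, List.sum_cons] at hN ⊢
      cases hc : (expand s).1
      · have hstep : searchStep (b, s :: rest) = (b, (expand s).2 ++ rest) := by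
          simp [searchStep, hc]
        have hsum : (((expand s).2 ++ rest).map (State.pot β)).sum + 1
            ≤ s.pot β + (rest.map (State.pot β)).sum := by
          rw [List.map_append, List.sum_append]
          linarith
        obtain ⟨m, b', h1, h2, h3, h4, h5⟩ := ih b ((expand s).2 ++ rest)
          (hst.expand hβ hβ') (by push_cast at hN; linarith)
        refine ⟨m + 1, b', by push_cast; linarith, ?_, ?_, ?_, ?_⟩
        · rintro (_ | i) hi
          · rfl
          · rw [Function.iterate_succ_apply, hstep]
            exact h2 i (by omega)
        · rw [Function.iterate_succ_apply, hstep, h3]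
        · rw [h4]
          rw [hc] at hE
          simp only [Bool.false_eq_true, false_or] at hE
          simp only [List.mem_append, List.mem_cons, or_and_right, exists_or, exists_eq_left, hE]
        · rintro (_ | i) hi
          · exact hst
          · rw [Function.iterate_succ_apply, hstep]
            exact h5 i (by omega)
      · have hstep : searchStep (b, s :: rest) = (true, []) := by simp [searchStep, hc]
        have h1 := one_le_pot hβ s
        refine ⟨1, true, by push_cast; linarith, ?_, hstep, ?_, ?_⟩
        · intro i hi
          obtain rfl : i = 0 := by omega
          rfl
        · rw [hc] at hE
          simp only [true_or, true_iff] at hE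
          simp [hE]
        · rintro (_ | i) hi
          · exact hst
          · obtain rfl : i = 0 := by omega
            rw [Function.iterate_one, hstep]
            trivial

/-- A problem that is reduced in polynomial time to states can be decided by searching. -/
theorem exists_search_prog {α : Type} [Enc α] {prep : α → Bool × List State} (hp : PT prep) {β : ℝ}
    (hβ : 1 ≤ β) (hβ' : β + 1 ≤ β ^ 4) : ∃ (p : Prog) (b : Polynomial ℕ), ∀ (a : α) (k : ℕ)
      (ans : Bool), (prep a).2.length ≤ 1 → (∀ s ∈ (prep a).2, s.WF ∧ s.1 ≤ k) →
      (ans = true ↔ (prep a).1 = true ∨ ∃ s ∈ (prep a).2, s.Yes) →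
      ∃ t : ℕ, Runs p (enc a) (enc ans) t ∧ (t : ℝ) ≤ b.eval (sz a) * (β ^ 3) ^ k := by
  obtain ⟨p, e, hpe⟩ := hp
  obtain ⟨c, bc, hc⟩ : PT (fun z : Bool × List State => !z.2.isEmpty) := by fun_prop
  obtain ⟨f, bf, hf⟩ : PT searchStep := PT.searchStep PT.id
  -- Bound for the loop state: at most `1 + (X + 1) * (X + 1)` for the stack by `StackOK.sz_le`, 3
  -- for the truth value, and 1 for the pair.
  let S : Polynomial ℕ := 5 + (e + 1) * (e + 1)
  let R : Polynomial ℕ := S + bc.comp S + bf.comp S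
  refine ⟨Prog.seq p (Prog.seq (Prog.while c f) Prog.hd),
    Polynomial.X + e + e + (e + 2) * R + S, fun a k ans hlen hwf hans => ?_⟩
  obtain ⟨t, h1, h2⟩ := hpe a
  set X := e.eval (sz a) with hX
  have hsz : sz (prep a) ≤ X := h1.size_le.2.trans h2
  have hsz' : sz (prep a).2 ≤ X := by
    rw [sz_prod] at hsz
    omega
  have hok : StackOK X X (prep a).2 ∧ ((prep a).2.map (State.pot β)).sum ≤ (X + 1) * (β ^ 3) ^ k := by
    rcases hst : (prep a).2 with _ | ⟨s, _ | ⟨s', l⟩⟩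
    · refine ⟨trivial, ?_⟩
      simp only [List.map_nil, List.sum_nil]
      positivity
    · rw [hst] at hsz' hwf
      obtain ⟨w1, w2⟩ := hwf s (by simp)
      have hs : sz s ≤ X := by simp at hsz'; omega
      have hl : s.2.1.length ≤ X := by
        have := length_le_sz s.2.1
        obtain ⟨k, items, ts⟩ := s
        simp at hs this ⊢
        omega
      refine ⟨⟨w1, hs, by simpa using hl, trivial⟩, ?_⟩
      simp only [List.map_cons, List.map_nil, List.sum_cons, List.sum_nil, add_zero, State.pot]
      rw [← pow_mul]
      have hm : s.measure ≤ 3 * k := by unfold State.measure; omega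
      have hl' : (s.2.1.length : ℝ) ≤ X := by exact_mod_cast hl
      have hb : β ^ s.measure ≤ β ^ (3 * k) := pow_le_pow_right₀ hβ hm
      have h0 : (0 : ℝ) ≤ β := by linarith
      gcongr
    · rw [hst] at hlen
      simp at hlen
  obtain ⟨hok, hpot⟩ := hok
  obtain ⟨N, hN⟩ := exists_nat_gt ((prep a).2.map (State.pot β)).sum
  obtain ⟨m, b', m1, m2, m3, m4, m5⟩ := search_correct hβ hβ' N (prep a).1 (prep a).2 hok hN
  have hb' : b' = ans := by
    rw [Bool.eq_iff_iff, m4, hans]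
  subst hb'
  set SX := S.eval (sz a) with hSX
  have hSX' : SX = 5 + (X + 1) * (X + 1) := by simp [hSX, S, hX]
  obtain ⟨r, h3, h4⟩ := runs_while hc hf m SX (prep a) (fun i hi => by
      have := m2 i hi
      simp only [Prod.mk.eta] at this
      rw [this]; rfl)
    (by rw [show prep a = ((prep a).1, (prep a).2) from rfl, m3]; rfl)
    (fun i hi => by
      have h5 := (m5 i hi).sz_le
      simp only [Prod.mk.eta] at h5
      have := sz_bool_le (searchStep^[i] (prep a)).1
      rw [sz_prod]
      omega)
  have hm3 : searchStep^[m] (prep a) = (b', []) := m3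
  rw [hm3] at h3
  refine ⟨_, Runs.seq h1 (Runs.seq h3 (Runs.hd _)), ?_⟩
  have hRX : R.eval (sz a) = SX + bc.eval SX + bf.eval SX := by
    simp [R, Polynomial.eval_comp, hSX]
  have hfin : (enc (b', ([] : List State))).size ≤ SX := by
    have := sz_bool_le b'
    have h5 : (enc (b', ([] : List State))).size = 1 + sz b' + 1 := rfl
    have h6 : 1 ≤ (X + 1) * (X + 1) := Nat.one_le_iff_ne_zero.2 (by positivity)
    omega
  have hnat : (enc a).size + t + ((enc (prep a)).size + r + (enc (b', ([] : List State))).size)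
      ≤ sz a + X + X + (m + 1) * R.eval (sz a) + SX := by
    rw [hRX]
    have : (enc (prep a)).size ≤ X := hsz
    have : (enc a).size = sz a := rfl
    omega
  have hone : (1 : ℝ) ≤ (β ^ 3) ^ k := one_le_pow₀ (one_le_pow₀ hβ)
  have hcast : (((enc a).size + t + ((enc (prep a)).size + r
      + (enc (b', ([] : List State))).size) : ℕ) : ℝ)
      ≤ sz a + X + X + (m + 1) * R.eval (sz a) + SX := by exact_mod_cast hnat
  refine hcast.trans ?_
  simp only [Polynomial.eval_add, Polynomial.eval_X, Polynomial.eval_mul, Polynomial.eval_ofNat,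
    ← hX, ← hSX]
  push_cast
  have hm : (m : ℝ) ≤ (X + 1) * (β ^ 3) ^ k := m1.trans hpot
  set Z := (β ^ 3) ^ k
  have hR0 : (0 : ℝ) ≤ (R.eval (sz a) : ℕ) := Nat.cast_nonneg _
  have hA0 : (0 : ℝ) ≤ (sz a : ℝ) + X + X + SX := by positivity
  have e1 : ((m : ℝ) + 1) * (R.eval (sz a) : ℕ) ≤ ((X + 2) * Z) * (R.eval (sz a) : ℕ) := by
    refine mul_le_mul_of_nonneg_right ?_ hR0
    nlinarith
  have e2 : ((sz a : ℝ) + X + X + SX) * 1 ≤ ((sz a : ℝ) + X + X + SX) * Z :=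
    mul_le_mul_of_nonneg_left hone hA0
  nlinarith

/-! ## Cycles in split graphs -/

section graph

variable {V : Type*} {G : SimpleGraph V}

/-- In a split graph every vertex on a cycle lies in a triangle of vertices of the cycle. -/
theorem exists_triangle_of_isCycle (hG : IsSplit G) {u : V} (c : G.Walk u u) (hc : c.IsCycle) :
    ∃ v w, G.Adj u v ∧ G.Adj v w ∧ G.Adj u w := by
  obtain ⟨I, K, -, hIK, hI, hK⟩ := hG
  have hmem : ∀ v, v ∉ K → v ∈ I := fun v hv =>
    (by rw [hIK]; trivial : v ∈ I ∪ K).resolve_right hv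
  have hadj : ∀ v w, G.Adj v w → v ∉ K → w ∈ K := by
    intro v w h hv
    by_contra hw
    exact hI (hmem v hv) (hmem w hw) h.ne h
  -- If `u` is in the clique and the next vertex is not, then the one after that is again in the
  -- clique and differs from `u`, so it closes a triangle. Reversing the cycle treats the other
  -- neighbour.
  have hstart : ∀ (c : G.Walk u u), c.IsCycle → G.Adj u c.snd ∧ G.Adj u c.penultimate ∧
      c.snd ≠ c.penultimate ∧ (u ∈ K → c.snd ∉ K →
        ∃ v w, G.Adj u v ∧ G.Adj v w ∧ G.Adj u w) := by
    intro c hc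
    have h3 := hc.three_le_length
    have hsnd := c.adj_snd hc.not_nil
    refine ⟨hsnd, (c.adj_penultimate hc.not_nil).symm, hc.snd_ne_penultimate, fun hu hs => ?_⟩
    have h12 : G.Adj (c.getVert 1) (c.getVert 2) := c.adj_getVert_succ (by omega)
    have h2u : c.getVert 2 ≠ u := by
      intro h
      rcases (hc.getVert_endpoint_iff (by omega)).1 h with h | h <;> omega
    exact ⟨c.getVert 1, c.getVert 2, hsnd, h12, hK hu (hadj _ _ h12 hs) h2u.symm⟩
  obtain ⟨h1, h2, h3, h4⟩ := hstart c hc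
  by_cases hu : u ∈ K
  · by_cases hs : c.snd ∈ K
    · by_cases hp : c.penultimate ∈ K
      · exact ⟨_, _, h1, hK hs hp h3, h2⟩
      · exact (hstart c.reverse hc.reverse).2.2.2 hu (by simpa using hp)
    · exact h4 hu hs
  · exact ⟨_, _, h1, hK (hadj _ _ h1 hu) (hadj _ _ h2 hu) h3, h2⟩

theorem IsSplit.induce (hG : IsSplit G) (X : Set V) : IsSplit (G.induce X) := by
  obtain ⟨I, K, h1, h2, h3, h4⟩ := hG
  refine ⟨Subtype.val ⁻¹' I, Subtype.val ⁻¹' K, h1.preimage _, ?_, ?_, ?_⟩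
  · rw [← Set.preimage_union, h2, Set.preimage_univ]
  · intro a ha b hb hab h
    exact h3 ha hb (fun e => hab (Subtype.ext e)) h
  · intro a ha b hb hab
    exact h4 ha hb (fun e => hab (Subtype.ext e))

/-- In a split graph it suffices to hit the triangles with a terminal. -/
theorem isSubsetFVS_iff (hG : IsSplit G) (T S : Set V) : IsSubsetFVS G T S ↔
    ∀ u v w, u ∉ S → v ∉ S → w ∉ S → G.Adj u v → G.Adj v w → G.Adj u w → u ∉ T := by
  classical
  constructor
  · intro h u v w hu hv hw huv hvw huw
    have e1 : (G.induce Sᶜ).Adj ⟨u, hu⟩ ⟨v, hv⟩ := huv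
    have e2 : (G.induce Sᶜ).Adj ⟨v, hv⟩ ⟨w, hw⟩ := hvw
    have e3 : (G.induce Sᶜ).Adj ⟨w, hw⟩ ⟨u, hu⟩ := huw.symm
    refine h ⟨u, hu⟩ (.cons e1 (.cons e2 (.cons e3 .nil))) ?_ ⟨u, hu⟩ (by simp)
    rw [SimpleGraph.Walk.cons_isCycle_iff]
    simp [SimpleGraph.Walk.cons_isPath_iff, huv.ne, huv.ne', hvw.ne, huw.ne', huw.ne]
  · intro h v c hc u hu
    obtain ⟨x, y, h1, h2, h3⟩ := exists_triangle_of_isCycle (hG.induce Sᶜ) (c.rotate u hu)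
      (hc.rotate hu)
    exact h u x y u.2 x.2 y.2 h1 h2 h3

end graph

/-! ## Instances as lists -/

/-- The adjacency matrix, the terminals, the matrix of the marked edges, and the budget. -/
abbrev Input := List (List Bool) × List Bool × List (List Bool) × ℕ × Unit

/-- An entry of a matrix. -/
def entry (m : List (List Bool)) (u v : ℕ) : Bool := (((m.drop u).headD []).drop v).headD false

namespace Input

/-- The number of vertices. -/
def n (i : Input) : ℕ := i.2.1.length

/-- The vertices. -/
def verts (i : Input) : List ℕ := List.range i.n

/-- Adjacency. -/
def adj (i : Input) (u v : ℕ) : Bool := entry i.1 u v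

/-- Being a terminal. -/
def tm (i : Input) (u : ℕ) : Bool := (i.2.1.drop u).headD false

/-- Being joined by a marked edge. -/
def mk (i : Input) (u v : ℕ) : Bool := entry i.2.2.1 u v

/-- The budget. -/
def k (i : Input) : ℕ := i.2.2.2.1

/-- The degree of a vertex. -/
def deg (i : Input) (u : ℕ) : ℕ := i.verts.countP fun v => i.adj u v

/-- The vertices of degree at least `d`, together with `v`. -/
def cliqueCandidate (i : Input) (d v : ℕ) : List ℕ :=
  i.verts.filter fun u => decide (d ≤ i.deg u) || decide (u = v)

/-- The vertices in the list form a clique, and the others an independent set. -/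
def isSplitClique (i : Input) (K : List ℕ) : Bool :=
  i.verts.all fun u => i.verts.all fun v => decide (u = v) ||
    bif K.contains u then !K.contains v || i.adj u v else K.contains v || !i.adj u v

/-- The clique of a split partition. -/
def clique (i : Input) : List ℕ :=
  (((List.range (i.n + 1)).flatMap fun d => i.verts.map fun v => i.cliqueCandidate d v).filter
    fun K => i.isSplitClique K).headD []

/-- The vertex has to be deleted if of the clique exactly `a` and `b` are kept. -/
def conflicts (i : Input) (a b u : ℕ) : Bool :=
  i.mk u a || i.mk u b || (i.adj u a && i.adj u b && !decide (a = b) && (i.tm u || i.tm a || i.tm b))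

/-- There is a solution that keeps exactly `a` and `b` of the clique. -/
def pairCheck (i : Input) (a b : ℕ) : Bool :=
  !i.mk a b && decide (i.verts.countP (fun u => bif i.clique.contains u then
    !decide (u = a) && !decide (u = b) else i.conflicts a b u) ≤ i.k)

/-- There is a solution that keeps at least one and at most two vertices of the clique. -/
def smallCheck (i : Input) : Bool :=
  i.clique.any fun a => i.clique.any fun b => i.pairCheck a b

/-- The clique vertices that are not terminals. -/
def items (i : Input) : List ℕ := i.clique.filter fun v => !i.tm v

/-- The clause of a vertex of the independent set. -/
def vertexClause (i : Input) (u : ℕ) : Clause :=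
  -- Items are not terminals, so two kept neighbours of `u` form a forbidden triangle only if `u` is
  -- a terminal. A terminal `u` hence tolerates one kept neighbour, and a marked neighbour is never
  -- tolerated.
  (i.items.filter fun v => i.tm u && i.adj u v && !i.mk u v, i.items.filter fun v => i.mk u v)

/-- The clauses of the independent set. -/
def vertexClauses (i : Input) : List Clause :=
  (i.verts.filter fun u => !i.clique.contains u).map fun u => i.vertexClause u

/-- Two clauses for every marked edge within the clique. -/
def edgeClauses (i : Input) : List Clause :=
  -- Each edge occurs in both orders, so violating it costs 2, more than deleting an endpoint.
  -- Violation has to be unprofitable, because no further vertex stands behind such a clause.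
  i.items.flatMap fun u => (i.items.filter fun v => i.mk u v).map fun v => ([u, v], [])

/-- Reduction to the covering problem. -/
def prep (i : Input) : Bool × List State :=
  -- For `n ≤ k` all vertices may be deleted. Answering here caps the budget of the search by `n`,
  -- which later absorbs polynomial factors in `k`.
  bif decide (i.n ≤ i.k) || i.smallCheck then (true, [])
  else (false, push (i.clique.countP fun v => i.tm v) (i.k, i.items, i.vertexClauses ++ i.edgeClauses))

end Input

section time

variable {α : Type} [Enc α] {i : α → Input} {x y z : α → ℕ}

@[fun_prop]
theorem PT.entry {m : α → List (List Bool)} (hm : PT m) (hx : PT x) (hy : PT y) :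
    PT (fun a => entry (m a) (x a) (y a)) := by
  unfold SFVS.entry; fun_prop

@[fun_prop]
theorem PT.input_n (hi : PT i) : PT (fun a => (i a).n) := by unfold Input.n; fun_prop

@[fun_prop]
theorem PT.input_verts (hi : PT i) : PT (fun a => (i a).verts) := by unfold Input.verts; fun_prop

@[fun_prop]
theorem PT.input_adj (hi : PT i) (hx : PT x) (hy : PT y) : PT (fun a => (i a).adj (x a) (y a)) := by
  unfold Input.adj; fun_prop

@[fun_prop]
theorem PT.input_tm (hi : PT i) (hx : PT x) : PT (fun a => (i a).tm (x a)) := by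
  unfold Input.tm; fun_prop

@[fun_prop]
theorem PT.input_mk (hi : PT i) (hx : PT x) (hy : PT y) : PT (fun a => (i a).mk (x a) (y a)) := by
  unfold Input.mk; fun_prop

@[fun_prop]
theorem PT.input_k (hi : PT i) : PT (fun a => (i a).k) := by unfold Input.k; fun_prop

@[fun_prop]
theorem PT.input_deg (hi : PT i) (hx : PT x) : PT (fun a => (i a).deg (x a)) := by
  unfold Input.deg; fun_prop

@[fun_prop]
theorem PT.input_cliqueCandidate (hi : PT i) (hx : PT x) (hy : PT y) :
    PT (fun a => (i a).cliqueCandidate (x a) (y a)) := by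
  unfold Input.cliqueCandidate; fun_prop

@[fun_prop]
theorem PT.input_isSplitClique {K : α → List ℕ} (hi : PT i) (hK : PT K) :
    PT (fun a => (i a).isSplitClique (K a)) := by
  unfold Input.isSplitClique; fun_prop

@[fun_prop]
theorem PT.input_clique (hi : PT i) : PT (fun a => (i a).clique) := by
  unfold Input.clique; fun_prop

@[fun_prop]
theorem PT.input_conflicts (hi : PT i) (hx : PT x) (hy : PT y) (hz : PT z) :
    PT (fun a => (i a).conflicts (x a) (y a) (z a)) := by
  unfold Input.conflicts; fun_prop

@[fun_prop]
theorem PT.input_pairCheck (hi : PT i) (hx : PT x) (hy : PT y) :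
    PT (fun a => (i a).pairCheck (x a) (y a)) := by
  unfold Input.pairCheck; fun_prop

@[fun_prop]
theorem PT.input_smallCheck (hi : PT i) : PT (fun a => (i a).smallCheck) := by
  unfold Input.smallCheck; fun_prop

@[fun_prop]
theorem PT.input_items (hi : PT i) : PT (fun a => (i a).items) := by unfold Input.items; fun_prop

@[fun_prop]
theorem PT.input_vertexClause (hi : PT i) (hx : PT x) : PT (fun a => (i a).vertexClause (x a)) := by
  unfold Input.vertexClause; fun_prop

@[fun_prop]
theorem PT.input_vertexClauses (hi : PT i) : PT (fun a => (i a).vertexClauses) := by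
  unfold Input.vertexClauses; fun_prop

@[fun_prop]
theorem PT.input_edgeClauses (hi : PT i) : PT (fun a => (i a).edgeClauses) := by
  unfold Input.edgeClauses; fun_prop

@[fun_prop]
theorem PT.input_prep (hi : PT i) : PT (fun a => (i a).prep) := by
  unfold Input.prep; fun_prop

end time

/-! ### Finding a split partition, and correctness of the reduction. -/

namespace Input

/-- The lists describe a split graph with marked edges. -/
structure Valid (i : Input) : Prop where
  adj_lt : ∀ u v, i.adj u v = true → u < i.n ∧ v < i.n
  adj_symm : ∀ u v, i.adj u v = true → i.adj v u = true
  adj_ne : ∀ u v, i.adj u v = true → u ≠ v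
  mk_symm : ∀ u v, i.mk u v = true → i.mk v u = true
  mk_adj : ∀ u v, i.mk u v = true → i.adj u v = true
  split : ∃ P : ℕ → Prop, (∀ u v, u < i.n → v < i.n → u ≠ v → P u → P v → i.adj u v = true) ∧
    ∀ u v, i.adj u v = true → P u ∨ P v

/-- The vertices in `X` may be kept. -/
def Sol (i : Input) (X : ℕ → Bool) : Prop :=
  (∀ u v w, X u = true → X v = true → X w = true → i.adj u v = true → i.adj v w = true →
    i.adj u w = true → i.tm u = false) ∧ ∀ u v, X u = true → X v = true → i.mk u v = false

theorem isSplitClique_iff {i : Input} {K : List ℕ} : i.isSplitClique K = true ↔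
    ∀ u < i.n, ∀ v < i.n, u ≠ v → (u ∈ K → v ∈ K → i.adj u v = true) ∧
      (u ∉ K → v ∉ K → i.adj u v = false) := by
  simp only [isSplitClique, verts, List.all_eq_true, List.mem_range, Bool.or_eq_true,
    decide_eq_true_eq]
  refine forall₄_congr fun u _ v _ => ?_
  by_cases huv : u = v
  · simp [huv]
  · by_cases hu : u ∈ K <;> by_cases hv : v ∈ K <;> simp [huv, hu, hv]

/-- The degrees determine a split partition up to one vertex. -/
theorem exists_cliqueCandidate {i : Input} (hi : i.Valid) (hn : 0 < i.n) :
    ∃ d ≤ i.n, ∃ v < i.n, i.isSplitClique (i.cliqueCandidate d v) = true := by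
  classical
  obtain ⟨P, hP1, hP2⟩ := hi.split
  let R := Finset.range i.n
  let ok : Finset ℕ → Prop := fun K => (∀ u ∈ K, ∀ v ∈ K, u ≠ v → i.adj u v = true) ∧
    ∀ u v, i.adj u v = true → u ∈ K ∨ v ∈ K
  have hne : (R.powerset.filter ok).Nonempty := by
    refine ⟨R.filter P, ?_⟩
    simp only [Finset.mem_filter, Finset.mem_powerset, R, Finset.filter_subset, true_and, ok,
      Finset.mem_range]
    refine ⟨fun u hu v hv huv => hP1 u v hu.1 hv.1 huv hu.2 hv.2, fun u v huv => ?_⟩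
    have := hi.adj_lt u v huv
    exact (hP2 u v huv).imp (fun h => ⟨this.1, h⟩) fun h => ⟨this.2, h⟩
  -- For a largest clique side `K`, members have degree at least `K.card - 1`. Outer vertices have
  -- degree at most `K.card - 1`, since one adjacent to all of `K` could be added. Only vertices of
  -- degree exactly `K.card - 1` can be ambiguous.
  obtain ⟨K, hK, hmax⟩ := Finset.exists_max_image _ Finset.card hne
  simp only [Finset.mem_filter, Finset.mem_powerset] at hK hmax
  obtain ⟨hKR, hK1, hK2⟩ := hK
  have hlt : ∀ u ∈ K, u < i.n := fun u hu => Finset.mem_range.1 (hKR hu)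
  have hKne : K.Nonempty := by
    by_contra h
    rw [Finset.not_nonempty_iff_eq_empty] at h
    subst h
    have := hmax {0} ⟨by simpa [R] using hn, by simp, fun u v huv => by
      have := hK2 u v huv
      simp at this⟩
    simp at this
  let N : ℕ → Finset ℕ := fun u => R.filter fun v => i.adj u v = true
  have hmemN : ∀ u v, v ∈ N u ↔ i.adj u v = true := by
    intro u v
    simp only [N, R, Finset.mem_filter, Finset.mem_range, and_iff_right_iff_imp]
    exact fun h => (hi.adj_lt u v h).2
  have hdeg : ∀ u, i.deg u = (N u).card := by
    intro u
    rw [deg, verts, List.countP_eq_length_filter,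
      ← List.toFinset_card_of_nodup (List.nodup_range.filter _)]
    congr 1
    ext v
    simp [N, R]
  have hin : ∀ u ∈ K, K.erase u ⊆ N u := by
    intro u hu v hv
    rw [Finset.mem_erase] at hv
    exact (hmemN u v).2 (hK1 u hu v hv.2 hv.1.symm)
  have hin' : ∀ u ∈ K, K.card ≤ i.deg u + 1 := by
    intro u hu
    have h1 := Finset.card_le_card (hin u hu)
    have h2 := Finset.card_erase_add_one hu
    rw [hdeg]
    omega
  have hout : ∀ u, u ∉ K → N u ⊆ K := by
    intro u hu v hv
    exact (hK2 u v ((hmemN u v).1 hv)).resolve_left hu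
  have hout' : ∀ u < i.n, u ∉ K → i.deg u + 1 ≤ K.card := by
    intro u hun hu
    by_contra hc
    have h1 : N u = K := Finset.eq_of_subset_of_card_le (hout u hu) (by rw [hdeg] at hc; omega)
    have h2 := hmax (insert u K) ⟨?_, ?_, ?_⟩
    · rw [Finset.card_insert_of_notMem hu] at h2
      omega
    · exact Finset.insert_subset (Finset.mem_range.2 hun) hKR
    · have h3 : ∀ v ∈ K, i.adj u v = true := fun v hv => (hmemN u v).1 (h1 ▸ hv)
      intro a ha b hb hab
      rcases Finset.mem_insert.1 ha with rfl | ha' <;>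
        rcases Finset.mem_insert.1 hb with rfl | hb'
      · exact absurd rfl hab
      · exact h3 b hb'
      · exact hi.adj_symm _ _ (h3 a ha')
      · exact hK1 a ha' b hb' hab
    · intro a b hab
      exact (hK2 a b hab).imp Finset.mem_insert_of_mem Finset.mem_insert_of_mem
  have key : ∀ d v, (∀ u < i.n, u ∈ K ↔ d ≤ i.deg u ∨ u = v) →
      i.isSplitClique (i.cliqueCandidate d v) = true := by
    intro d v h
    have h' : ∀ u < i.n, u ∈ i.cliqueCandidate d v ↔ u ∈ K := by
      intro u hu
      rw [h u hu]
      simp [cliqueCandidate, verts, hu]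
    rw [isSplitClique_iff]
    intro u hu w hw huw
    rw [h' u hu, h' w hw]
    refine ⟨fun h1 h2 => hK1 u h1 w h2 huw, fun h1 h2 => ?_⟩
    by_contra hc
    rcases hK2 u w (by simpa using hc) with h | h
    exacts [h1 h, h2 h]
  have hcard : K.card ≤ i.n := by simpa [R] using Finset.card_le_card hKR
  by_cases hall : ∀ u ∈ K, K.card ≤ i.deg u
  · obtain ⟨v, hv⟩ := hKne
    refine ⟨K.card, hcard, v, hlt v hv, key _ _ fun u hu => ⟨fun h => Or.inl (hall u h), ?_⟩⟩
    rintro (h | rfl)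
    · by_contra hc
      have := hout' u hu hc
      omega
    · exact hv
  push Not at hall
  obtain ⟨v, hv, hvd⟩ := hall
  have hNv : N v = K.erase v := by
    refine (Finset.eq_of_subset_of_card_le (hin v hv) ?_).symm
    have h2 := Finset.card_erase_add_one hv
    rw [hdeg] at hvd
    omega
  by_cases hlow : ∀ u < i.n, u ∉ K → i.deg u + 1 < K.card
  · refine ⟨K.card - 1, by omega, v, hlt v hv, key _ _ fun u hu => ⟨fun h => Or.inl ?_, ?_⟩⟩
    · have := hin' u h
      omega
    · rintro (h | rfl)
      · by_contra hc
        have := hlow u hu hc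
        omega
      · exact hv
  push Not at hlow
  obtain ⟨u, hu, huK, hud⟩ := hlow
  have hvu : v ∉ N u := by
    intro h
    have h1 := hi.adj_symm _ _ ((hmemN u v).1 h)
    have h2 := (hmemN v u).2 h1
    rw [hNv] at h2
    exact huK (Finset.mem_of_mem_erase h2)
  have hNu : N u = K.erase v := by
    refine Finset.eq_of_subset_of_card_le (fun w hw => ?_) ?_
    · exact Finset.mem_erase.2 ⟨fun e => hvu (e ▸ hw), hout u huK hw⟩
    · have h2 := Finset.card_erase_add_one hv
      rw [hdeg] at hud
      omega
  -- The outer vertex `u` is adjacent to all of `K` except `v`, so all members besides `v` have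
  -- degree at least `K.card`. The extra vertex of `cliqueCandidate` supplies `v`.
  refine ⟨K.card, hcard, v, hlt v hv, key _ _ fun w hw => ⟨fun h => ?_, ?_⟩⟩
  · by_cases hwv : w = v
    · exact Or.inr hwv
    · left
      have h1 : i.adj u w = true := (hmemN u w).1 (hNu ▸ Finset.mem_erase.2 ⟨hwv, h⟩)
      have h2 : u ∈ N w := (hmemN w u).2 (hi.adj_symm _ _ h1)
      have h3 : insert u (K.erase w) ⊆ N w := Finset.insert_subset h2 (hin w h)
      have h4 := Finset.card_le_card h3
      rw [Finset.card_insert_of_notMem (fun h => huK (Finset.mem_of_mem_erase h))] at h4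
      have h5 := Finset.card_erase_add_one h
      rw [hdeg]
      omega
  · rintro (h | rfl)
    · by_contra hc
      have := hout' w hw hc
      omega
    · exact hv

theorem clique_spec {i : Input} (hi : i.Valid) (hn : 0 < i.n) :
    i.isSplitClique i.clique = true ∧ ∃ p : ℕ → Bool, i.clique = i.verts.filter p := by
  unfold clique
  rcases hc : ((List.range (i.n + 1)).flatMap fun d => i.verts.map fun v => i.cliqueCandidate d v).filter
    fun K => i.isSplitClique K with _ | ⟨K, l⟩
  · exfalso
    obtain ⟨d, hd, v, hv, h⟩ := exists_cliqueCandidate hi hn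
    have : i.cliqueCandidate d v ∈ ((List.range (i.n + 1)).flatMap fun d => i.verts.map fun v =>
        i.cliqueCandidate d v).filter fun K => i.isSplitClique K := by
      simp only [List.mem_filter, List.mem_flatMap, List.mem_map, List.mem_range]
      exact ⟨⟨d, by omega, v, by simpa [verts] using hv, rfl⟩, h⟩
    simp [hc] at this
  · have : K ∈ ((List.range (i.n + 1)).flatMap fun d => i.verts.map fun v =>
        i.cliqueCandidate d v).filter fun K => i.isSplitClique K := by simp [hc]
    simp only [List.mem_filter, List.mem_flatMap, List.mem_map] at this
    obtain ⟨⟨d, -, v, -, rfl⟩, h⟩ := this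
    exact ⟨h, _, rfl⟩

/-! ### Equivalence of the graph problem and the covering problem. -/

section correct

variable {i : Input} (hi : i.Valid) (hn : 0 < i.n)

include hi hn

theorem mem_clique_lt {v : ℕ} (hv : v ∈ i.clique) : v < i.n := by
  obtain ⟨-, p, hp⟩ := clique_spec hi hn
  rw [hp] at hv
  simpa [verts] using (List.mem_filter.1 hv).1

theorem clique_nodup : i.clique.Nodup := by
  obtain ⟨-, p, hp⟩ := clique_spec hi hn
  rw [hp]
  exact List.nodup_range.filter _

theorem clique_eq : i.clique = i.verts.filter fun u => i.clique.contains u := by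
  obtain ⟨-, p, hp⟩ := clique_spec hi hn
  conv_lhs => rw [hp]
  refine List.filter_congr fun u hu => ?_
  rw [Bool.eq_iff_iff, List.contains_iff_mem, hp, List.mem_filter]
  simp [hu]

theorem clique_adj {u v : ℕ} (hu : u ∈ i.clique) (hv : v ∈ i.clique) (huv : u ≠ v) :
    i.adj u v = true :=
  (isSplitClique_iff.1 (clique_spec hi hn).1 u (mem_clique_lt hi hn hu) v
    (mem_clique_lt hi hn hv) huv).1 hu hv

theorem mem_clique_of_adj {u v : ℕ} (h : i.adj u v = true) (hu : u ∉ i.clique) : v ∈ i.clique := by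
  by_contra hv
  have h1 := hi.adj_lt u v h
  have h2 := (isSplitClique_iff.1 (clique_spec hi hn).1 u h1.1 v h1.2 (hi.adj_ne u v h)).2 hu hv
  simp [h] at h2

theorem countP_verts (p : ℕ → Bool) : i.verts.countP p
    = i.clique.countP p + (i.verts.filter fun u => !i.clique.contains u).countP p := by
  conv_rhs => rw [clique_eq hi hn]
  rw [List.countP_filter, List.countP_filter]
  have h : ∀ u ∈ i.verts, (i.verts.filter fun u => i.clique.contains u).contains u
      = i.clique.contains u := fun u _ => by rw [← clique_eq hi hn]
  refine le_antisymm (countP_le_add ?_) (countP_add_le ?_ ?_ ?_)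
  · intro u hu hp
    rw [h u hu]
    cases i.clique.contains u <;> simp [hp]
  · intro u _ hp
    rw [Bool.and_eq_true] at hp
    exact hp.1
  · intro u _ hp
    rw [Bool.and_eq_true] at hp
    exact hp.1
  · intro u hu hp hp'
    rw [h u hu] at hp'
    rw [Bool.and_eq_true] at hp hp'
    rw [hp.2] at hp'
    simp at hp'

theorem smallCheck_sound (h : i.smallCheck = true) :
    ∃ X, i.Sol X ∧ i.verts.countP (fun u => !X u) ≤ i.k := by
  simp only [smallCheck, pairCheck, List.any_eq_true, Bool.and_eq_true, Bool.not_eq_true',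
    decide_eq_true_eq] at h
  obtain ⟨a, ha, b, hb, hab, hk⟩ := h
  refine ⟨fun u => !(bif i.clique.contains u then
    !decide (u = a) && !decide (u = b) else i.conflicts a b u), ?_, by simpa using hk⟩
  have hX : ∀ u, (!(bif i.clique.contains u then
      !decide (u = a) && !decide (u = b) else i.conflicts a b u)) = true →
      u ∈ i.clique ∧ (u = a ∨ u = b) ∨ u ∉ i.clique ∧ i.conflicts a b u = false := by
    intro u hu
    by_cases hc : u ∈ i.clique
    · simp only [List.contains_iff_mem.2 hc, cond_true] at hu
      left
      refine ⟨hc, ?_⟩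
      by_contra hcon
      simp [not_or.1 hcon] at hu
    · have : i.clique.contains u = false := by simpa using hc
      simp only [this, cond_false] at hu
      exact Or.inr ⟨hc, by simpa using hu⟩
  have hmk : ∀ u, i.mk u u = false := by
    intro u
    by_contra h
    exact hi.adj_ne u u (hi.mk_adj u u (by simpa using h)) rfl
  have htri : ∀ u v w, u ∉ i.clique → i.conflicts a b u = false → (v = a ∨ v = b) →
      (w = a ∨ w = b) → i.adj u v = true → i.adj v w = true → i.adj u w = true →
      i.tm u = false ∧ i.tm v = false ∧ i.tm w = false := by
    intro u v w _ hc hv hw huv hvw huw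
    have hne := hi.adj_ne v w hvw
    have hab' : a ≠ b := by
      rintro rfl
      rcases hv with rfl | rfl <;> rcases hw with rfl | rfl <;> exact hne rfl
    simp only [conflicts, Bool.or_eq_false_iff, Bool.and_eq_false_iff] at hc
    have hc2 := hc.2
    rcases hv with rfl | rfl <;> rcases hw with rfl | rfl
    · exact absurd rfl hne
    · simp [huv, huw, hab'] at hc2
      exact ⟨hc2.1.1, hc2.1.2, hc2.2⟩
    · simp [huv, huw, hab'] at hc2
      exact ⟨hc2.1.1, hc2.2, hc2.1.2⟩
    · exact absurd rfl hne
  constructor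
  · intro u v w hu hv hw huv hvw huw
    rcases hX u hu with ⟨hu1, hu2⟩ | ⟨hu1, hu2⟩
    · rcases hX v hv with ⟨hv1, hv2⟩ | ⟨hv1, hv2⟩
      · rcases hX w hw with ⟨hw1, hw2⟩ | ⟨hw1, hw2⟩
        · exfalso
          have h1 := hi.adj_ne u v huv
          have h2 := hi.adj_ne v w hvw
          have h3 := hi.adj_ne u w huw
          rcases hu2 with rfl | rfl <;> rcases hv2 with rfl | rfl <;> rcases hw2 with rfl | rfl <;>
            simp_all
        · exact (htri w u v hw1 hw2 hu2 hv2 (hi.adj_symm _ _ huw) huv (hi.adj_symm _ _ hvw)).2.1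
      · have hw1 := mem_clique_of_adj hi hn hvw hv1
        rcases hX w hw with ⟨-, hw2⟩ | ⟨hw2, -⟩
        · exact (htri v u w hv1 hv2 hu2 hw2 (hi.adj_symm _ _ huv) huw hvw).2.1
        · exact absurd hw1 hw2
    · have hv1 := mem_clique_of_adj hi hn huv hu1
      have hw1 := mem_clique_of_adj hi hn huw hu1
      rcases hX v hv with ⟨-, hv2⟩ | ⟨hv2, -⟩
      · rcases hX w hw with ⟨-, hw2⟩ | ⟨hw2, -⟩
        · exact (htri u v w hu1 hu2 hv2 hw2 huv hvw huw).1
        · exact absurd hw1 hw2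
      · exact absurd hv1 hv2
  · have hout : ∀ u v, u ∉ i.clique → i.conflicts a b u = false → (v = a ∨ v = b) →
        i.mk u v = false := by
      intro u v _ hc hv
      simp only [conflicts, Bool.or_eq_false_iff] at hc
      rcases hv with rfl | rfl
      exacts [hc.1.1, hc.1.2]
    intro u v hu hv
    by_contra hm
    rw [Bool.not_eq_false] at hm
    rcases hX u hu with ⟨hu1, hu2⟩ | ⟨hu1, hu2⟩
    · rcases hX v hv with ⟨hv1, hv2⟩ | ⟨hv1, hv2⟩
      · have hab' : i.mk b a = false := by
          by_contra h
          have := hi.mk_symm b a (by simpa using h)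
          simp [hab] at this
        rcases hu2 with rfl | rfl <;> rcases hv2 with rfl | rfl <;> simp_all
      · have := hout v u hv1 hv2 hu2
        simp [hi.mk_symm _ _ hm] at this
    · rcases hX v hv with ⟨hv1, hv2⟩ | ⟨hv1, -⟩
      · have := hout u v hu1 hu2 hv2
        simp [hm] at this
      · exact absurd (mem_clique_of_adj hi hn (hi.mk_adj _ _ hm) hu1) hv1

/-- Two further kept clique vertices would form a triangle with the terminal `a`, so at most one
other vertex `b` is kept; `b = a` stands for none. Deleting just the conflicting vertices outside
the clique is then optimal. -/
theorem smallCheck_complete {X : ℕ → Bool} (hX : i.Sol X)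
    (hk : i.verts.countP (fun u => !X u) ≤ i.k) {a : ℕ} (ha : a ∈ i.clique) (hta : i.tm a = true)
    (hXa : X a = true) : i.smallCheck = true := by
  obtain ⟨h1, h2⟩ := hX
  obtain ⟨b, hb, hXb, hab⟩ : ∃ b ∈ i.clique, X b = true ∧
      ∀ u ∈ i.clique, X u = true → u = a ∨ u = b := by
    by_cases h : ∃ b ∈ i.clique, X b = true ∧ b ≠ a
    · obtain ⟨b, hb, hXb, hba⟩ := h
      refine ⟨b, hb, hXb, fun u hu hXu => ?_⟩
      by_contra hc
      obtain ⟨hua, hub⟩ := not_or.1 hc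
      have := h1 a b u hXa hXb hXu (clique_adj hi hn ha hb hba.symm)
        (clique_adj hi hn hb hu (Ne.symm hub)) (clique_adj hi hn ha hu (Ne.symm hua))
      simp [hta] at this
    · push Not at h
      exact ⟨a, ha, hXa, fun u hu hXu => Or.inl (h u hu hXu)⟩
  simp only [smallCheck, pairCheck, List.any_eq_true, Bool.and_eq_true, Bool.not_eq_true',
    decide_eq_true_eq]
  refine ⟨a, ha, b, hb, h2 a b hXa hXb, (countP_mono fun u _ hu => ?_).trans hk⟩
  by_contra hc
  have hXu : X u = true := by simpa using hc
  by_cases huc : u ∈ i.clique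
  · simp only [List.contains_iff_mem.2 huc, cond_true] at hu
    rcases hab u huc hXu with rfl | rfl <;> simp at hu
  · have : i.clique.contains u = false := by simpa using huc
    simp only [this, cond_false, conflicts, Bool.or_eq_true] at hu
    rcases hu with (hu | hu) | hu
    · simp [h2 u a hXu hXa] at hu
    · simp [h2 u b hXu hXb] at hu
    · simp only [Bool.and_eq_true, Bool.not_eq_true', decide_eq_false_iff_not] at hu
      obtain ⟨⟨⟨hua, hub⟩, hne⟩, -⟩ := hu
      have := h1 a u b hXa hXu hXb (hi.adj_symm _ _ hua) hub (clique_adj hi hn ha hb hne)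
      simp [hta] at this

theorem items_nodup : i.items.Nodup := (clique_nodup hi hn).filter _

omit hi hn in
theorem mem_items {v : ℕ} : v ∈ i.items ↔ v ∈ i.clique ∧ i.tm v = false := by
  simp [items]

omit hn in
theorem mk_ne {u v : ℕ} (h : i.mk u v = true) : u ≠ v := hi.adj_ne u v (hi.mk_adj u v h)

theorem clauses_wf : ClausesWF i.items (i.vertexClauses ++ i.edgeClauses) := by
  intro t ht
  rcases List.mem_append.1 ht with ht | ht
  · simp only [vertexClauses, List.mem_map] at ht
    obtain ⟨u, -, rfl⟩ := ht
    simp only [vertexClause, List.mem_filter]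
    refine ⟨(items_nodup hi hn).filter _, fun v hv => hv.1, fun v hv => hv.1, fun v hv hv' => ?_⟩
    simp [hv'.2] at hv
  · simp only [edgeClauses, List.mem_flatMap, List.mem_map, List.mem_filter] at ht
    obtain ⟨u, hu, v, ⟨hv, huv⟩, rfl⟩ := ht
    have := mk_ne hi huv
    refine ⟨by simpa using this, ?_, by simp, by simp⟩
    simp [hu, hv]

omit hi hn in
theorem countP_clique {X : ℕ → Bool} (hX : ∀ v ∈ i.clique, i.tm v = true → X v = false) :
    i.clique.countP (fun u => !X u) = i.clique.countP (fun v => i.tm v)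
      + i.items.countP (fun u => !X u) := by
  unfold items
  rw [List.countP_filter]
  refine le_antisymm (countP_le_add ?_) (countP_add_le ?_ ?_ ?_)
  · intro u _ h
    cases ht : i.tm u
    · exact Or.inr (by simpa using h)
    · exact Or.inl rfl
  · intro u hu h
    simp [hX u hu h]
  · intro u _ h
    rw [Bool.and_eq_true] at h
    exact h.1
  · intro u _ h h'
    simp [h] at h'

/-- A kept independent vertex never has a violated clause, so violated vertex clauses are paid for
by deleted vertices, and edge clauses are not violated at all. -/
theorem cost_complete {X : ℕ → Bool} (hX : i.Sol X)
    (hk : i.verts.countP (fun u => !X u) ≤ i.k)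
    (ht : ∀ v ∈ i.clique, i.tm v = true → X v = false) :
    ∃ κ, i.clique.countP (fun v => i.tm v) + cost i.items (i.vertexClauses ++ i.edgeClauses) κ
      ≤ i.k := by
  obtain ⟨h1, h2⟩ := hX
  refine ⟨X, le_trans ?_ hk⟩
  rw [countP_verts hi hn, countP_clique ht, cost, List.countP_append]
  have e1 : i.edgeClauses.countP (bad X) = 0 := by
    rw [List.countP_eq_zero]
    intro t ht hb
    simp only [edgeClauses, List.mem_flatMap, List.mem_map, List.mem_filter] at ht
    obtain ⟨u, hu, v, ⟨hv, huv⟩, rfl⟩ := ht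
    have := h2 u v
    cases hXu : X u <;> cases hXv : X v <;> simp_all [bad]
  have e2 : i.vertexClauses.countP (bad X)
      ≤ (i.verts.filter fun u => !i.clique.contains u).countP (fun u => !X u) := by
    rw [vertexClauses, List.countP_map]
    refine countP_mono fun u _ hb => ?_
    by_contra hc
    have hXu : X u = true := by simpa using hc
    simp only [Function.comp, bad, vertexClause, Bool.or_eq_true, List.any_eq_true,
      List.mem_filter] at hb
    rcases hb with ⟨v, hv, hXv⟩ | hb
    · simp [h2 u v hXu hXv] at hv
    · have hb := of_decide_eq_true hb
      rw [List.countP_filter] at hb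
      have hb0 : 0 < i.items.countP fun v => X v && (i.tm u && i.adj u v && !i.mk u v) := by omega
      obtain ⟨v, hv, hpv⟩ := List.countP_pos_iff.1 hb0
      obtain ⟨w, hw, hwv⟩ := exists_mem_ne (((items_nodup hi hn).filter
        fun v => X v && (i.tm u && i.adj u v && !i.mk u v)))
        (by rw [← List.countP_eq_length_filter]; exact hb) v
      rw [List.mem_filter] at hw
      obtain ⟨hw, hpw⟩ := hw
      simp only [Bool.and_eq_true] at hpv hpw
      have := h1 u v w hXu hpv.1 hpw.1 hpv.2.1.2
        (clique_adj hi hn (mem_items.1 hv).1 (mem_items.1 hw).1 hwv.symm) hpw.2.1.2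
      simp [hpv.2.1.1] at this
  omega

/-- An optimal choice never keeps both ends of a marked clique edge: deleting one end costs 1 and
repairs two clauses. Keeping exactly the independent vertices with satisfied clauses then gives a
solution of the same size. -/
theorem cost_sound {κ : ℕ → Bool}
    (hκ : i.clique.countP (fun v => i.tm v) + cost i.items (i.vertexClauses ++ i.edgeClauses) κ
      ≤ i.k) : ∃ X, i.Sol X ∧ i.verts.countP (fun u => !X u) ≤ i.k := by
  classical
  let c : (ℕ → Bool) → ℕ := cost i.items (i.vertexClauses ++ i.edgeClauses)
  -- Costs are natural numbers, so a minimum exists although there are infinitely many `κ`.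
  obtain ⟨μ, hμ⟩ : ∃ μ, ∀ κ, c μ ≤ c κ := ⟨Function.argmin c, fun κ => Function.argmin_le c κ⟩
  have hμk := hμ κ
  have hedge : ∀ u ∈ i.items, ∀ v ∈ i.items, μ u = true → μ v = true → i.mk u v = false := by
    intro u hu v hv hμu hμv
    by_contra hm
    rw [Bool.not_eq_false] at hm
    have hne := mk_ne hi hm
    have h1 := hμ (Function.update μ u false)
    have h2 : i.items.countP (fun w => !Function.update μ u false w)
        ≤ i.items.countP (fun w => !μ w) + 1 := by
      refine (countP_le_add (q := fun w => decide (w = u)) fun w _ hw => ?_).trans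
        (Nat.add_le_add_left (countP_eq_le_one (items_nodup hi hn) u) _)
      by_cases hwu : w = u
      · exact Or.inr (by simp [hwu])
      · rw [Function.update_of_ne hwu] at hw
        exact Or.inl hw
    have hmem : ∀ u v, u ∈ i.items → v ∈ i.items → i.mk u v = true →
        (([u, v], []) : Clause) ∈ i.vertexClauses ++ i.edgeClauses := by
      intro u v hu hv hm
      simp only [List.mem_append, edgeClauses, List.mem_flatMap, List.mem_map, List.mem_filter]
      exact Or.inr ⟨u, hu, v, ⟨hv, hm⟩, rfl⟩
    set ts := i.vertexClauses ++ i.edgeClauses with hts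
    have h3 : ts.countP (fun t => decide (t = ([u, v], []))) + ts.countP (fun t => decide (t = ([v, u], [])))
        ≤ ts.countP (fun t => decide (t = ([u, v], [])) || decide (t = ([v, u], []))) := by
      refine countP_add_le (by simp +contextual) (by simp +contextual) ?_
      intro t _ h h'
      simp only [decide_eq_true_eq] at h h'
      rw [h] at h'
      simp [hne] at h'
    have h4 : 0 < ts.countP (fun t => decide (t = ([u, v], []))) :=
      List.countP_pos_iff.2 ⟨_, hmem u v hu hv hm, by simp⟩
    have h5 : 0 < ts.countP (fun t => decide (t = ([v, u], []))) :=
      List.countP_pos_iff.2 ⟨_, hmem v u hv hu (hi.mk_symm _ _ hm), by simp⟩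
    have h6 : ts.countP (bad (Function.update μ u false))
        + ts.countP (fun t => decide (t = ([u, v], [])) || decide (t = ([v, u], [])))
        ≤ ts.countP (bad μ) := by
      refine countP_add_le ?_ ?_ ?_
      · intro t _ h
        refine bad_mono (fun w hw => ?_) h
        by_cases hwu : w = u
        · simp [hwu] at hw
        · rwa [Function.update_of_ne hwu] at hw
      · intro t _ h
        simp only [Bool.or_eq_true, decide_eq_true_eq] at h
        rcases h with rfl | rfl <;> simp [bad, hμu, hμv]
      · intro t _ h h'
        simp only [Bool.or_eq_true, decide_eq_true_eq] at h'
        rcases h' with rfl | rfl <;>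
          simp [bad, hμv, Function.update_of_ne hne.symm] at h
    simp only [c, cost, ← hts] at h1
    omega
  let X : ℕ → Bool := fun u => bif i.clique.contains u then !i.tm u && μ u
    else !bad μ (i.vertexClause u)
  have hXin : ∀ u ∈ i.clique, X u = true → u ∈ i.items ∧ μ u = true := by
    intro u hu hXu
    simp only [X, List.contains_iff_mem.2 hu, cond_true, Bool.and_eq_true, Bool.not_eq_true'] at hXu
    exact ⟨mem_items.2 ⟨hu, hXu.1⟩, hXu.2⟩
  have hXout : ∀ u, u ∉ i.clique → X u = !bad μ (i.vertexClause u) := by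
    intro u hu
    have : i.clique.contains u = false := by simpa using hu
    simp only [X, this, cond_false]
  have hmkout : ∀ u v, u ∉ i.clique → X u = true → X v = true → i.mk u v = false := by
    intro u v hu hXu hXv
    by_contra hm
    rw [Bool.not_eq_false] at hm
    obtain ⟨h1, h2⟩ := hXin v (mem_clique_of_adj hi hn (hi.mk_adj _ _ hm) hu) hXv
    have : bad μ (i.vertexClause u) = true := by
      simp only [bad, vertexClause, Bool.or_eq_true, List.any_eq_true, List.mem_filter]
      exact Or.inl ⟨v, ⟨h1, hm⟩, h2⟩
    simp [hXout u hu, this] at hXu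
  refine ⟨X, ⟨?_, ?_⟩, ?_⟩
  · intro u v w hXu hXv hXw huv hvw huw
    by_cases hu : u ∈ i.clique
    · exact (mem_items.1 (hXin u hu hXu).1).2
    · by_contra ht
      rw [Bool.not_eq_false] at ht
      obtain ⟨hv1, hv2⟩ := hXin v (mem_clique_of_adj hi hn huv hu) hXv
      obtain ⟨hw1, hw2⟩ := hXin w (mem_clique_of_adj hi hn huw hu) hXw
      have hne := hi.adj_ne v w hvw
      have hb : 2 ≤ (i.vertexClause u).1.countP μ := by
        simp only [vertexClause, List.countP_filter]
        have e1 : 0 < i.items.countP (fun z => decide (z = v)) :=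
          List.countP_pos_iff.2 ⟨v, hv1, by simp⟩
        have e2 : 0 < i.items.countP (fun z => decide (z = w)) :=
          List.countP_pos_iff.2 ⟨w, hw1, by simp⟩
        have e3 : i.items.countP (fun z => decide (z = v)) + i.items.countP (fun z => decide (z = w))
            ≤ i.items.countP fun z => μ z && (i.tm u && i.adj u z && !i.mk u z) := by
          refine countP_add_le ?_ ?_ ?_
          · intro z _ hz
            obtain rfl : z = v := by simpa using hz
            simp [hv2, ht, huv, hmkout u z hu hXu hXv]
          · intro z _ hz
            obtain rfl : z = w := by simpa using hz
            simp [hw2, ht, huw, hmkout u z hu hXu hXw]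
          · intro z _ hz hz'
            simp at hz hz'
            exact hne (hz.symm.trans hz')
        omega
      have : bad μ (i.vertexClause u) = true := by
        simp only [bad, Bool.or_eq_true, decide_eq_true_eq]
        exact Or.inr hb
      simp [hXout u hu, this] at hXu
  · intro u v hXu hXv
    by_cases hu : u ∈ i.clique
    · by_cases hv : v ∈ i.clique
      · obtain ⟨hu1, hu2⟩ := hXin u hu hXu
        obtain ⟨hv1, hv2⟩ := hXin v hv hXv
        exact hedge u hu1 v hv1 hu2 hv2
      · have := hmkout v u hv hXv hXu
        by_contra hm
        have := hi.mk_symm u v (by simpa using hm)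
        simp_all
    · exact hmkout u v hu hXu hXv
  · rw [countP_verts hi hn, countP_clique (X := X)]
    · have e1 : i.items.countP (fun u => !X u) = i.items.countP (fun u => !μ u) := by
        refine List.countP_congr fun u hu => ?_
        have := mem_items.1 hu
        simp only [X, List.contains_iff_mem.2 this.1, cond_true, this.2, Bool.not_false,
          Bool.true_and]
      have e2 : (i.verts.filter fun u => !i.clique.contains u).countP (fun u => !X u)
          = i.vertexClauses.countP (bad μ) := by
        rw [vertexClauses, List.countP_map]
        refine List.countP_congr fun u hu => ?_
        have hu' : u ∉ i.clique := by simpa using (List.mem_filter.1 hu).2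
        simp [hXout u hu']
      simp only [c, cost, List.countP_append] at hμk hκ
      omega
    · intro u hu ht
      simp only [X, List.contains_iff_mem.2 hu, cond_true, ht, Bool.not_true, Bool.false_and]

end correct

theorem prep_correct {i : Input} (hi : i.Valid) : (i.prep.1 = true ∨ ∃ s ∈ i.prep.2, s.Yes) ↔
    ∃ X, i.Sol X ∧ i.verts.countP (fun u => !X u) ≤ i.k := by
  unfold prep
  by_cases hnk : i.n ≤ i.k
  · simp only [hnk, decide_true, Bool.true_or, cond_true, true_or, true_iff]
    refine ⟨fun _ => false, ⟨by simp, by simp⟩, ?_⟩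
    simpa [verts] using hnk
  · have hn : 0 < i.n := by omega
    rw [decide_eq_false hnk, Bool.false_or]
    cases hs : i.smallCheck
    · simp only [cond_false, Bool.false_eq_true, false_or]
      rw [exists_push_yes (items_nodup hi hn) (clauses_wf hi hn)]
      constructor
      · rintro ⟨κ, hκ⟩
        exact cost_sound hi hn hκ
      · rintro ⟨X, hX, hk⟩
        refine cost_complete hi hn hX hk fun v hv ht => ?_
        by_contra hXv
        have := smallCheck_complete hi hn hX hk hv ht (by simpa using hXv)
        simp [hs] at this
    · simp only [cond_true, true_or, true_iff]
      exact smallCheck_sound hi hn hs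

theorem prep_wf {i : Input} (hi : i.Valid) : i.prep.2.length ≤ 1 ∧
    ∀ s ∈ i.prep.2, s.WF ∧ s.1 ≤ min i.k i.n := by
  unfold prep
  by_cases hnk : i.n ≤ i.k
  · simp [hnk]
  · have hn : 0 < i.n := by omega
    rw [decide_eq_false hnk, Bool.false_or]
    cases hs : i.smallCheck
    · rw [cond_false]
      refine ⟨length_push_le _ _, fun s hs => ?_⟩
      obtain ⟨-, h, rfl⟩ := mem_push.1 hs
      refine ⟨⟨items_nodup hi hn, clauses_wf hi hn, h⟩, ?_⟩
      simp only
      omega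
    · simp

end Input

/-! ## Instances as inputs -/

theorem headD_drop_ofFn {α : Type} {n : ℕ} (f : Fin n → α) (u : ℕ) (d : α) :
    ((List.ofFn f).drop u).headD d = if h : u < n then f ⟨u, h⟩ else d := by
  rw [List.headD_eq_head?_getD, List.head?_drop, List.getElem?_ofFn]
  split <;> rfl

namespace Instance

variable {n : ℕ}

open Classical in
/-- A 0-1 matrix as a list of rows. -/
noncomputable def boolMatrix (r : Fin n → Fin n → Prop) : List (List Bool) :=
  List.ofFn fun u => List.ofFn fun v => decide (r u v)

open Classical in
/-- The lists that an instance is encoded by. -/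
noncomputable def toInput (J : Instance n) : Input :=
  (boolMatrix J.graph.Adj, List.ofFn fun v => decide (v ∈ J.terminals),
    boolMatrix (fun u v => s(u, v) ∈ J.marked), J.k, ())

theorem enc_boolMatrix (r : Fin n → Fin n → Prop) : enc (boolMatrix r) = matrix r := by
  simp only [enc, boolMatrix, List.map_ofFn, Function.comp_def, matrix, bit]

theorem enc_toInput (J : Instance n) : enc J.toInput = J.encode := by
  have h : enc (J.toInput).2.1 = Data.ofList (List.ofFn fun v => bit (v ∈ J.terminals)) := by
    simp only [enc, toInput, List.map_ofFn, Function.comp_def, bit]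
  unfold encode
  rw [← enc_boolMatrix, ← enc_boolMatrix, ← h]
  -- The last component `()` of an `Input` is encoded as the `nil` that ends the list of four
  -- entries.
  rfl

theorem entry_boolMatrix (r : Fin n → Fin n → Prop) (u v : ℕ) : entry (boolMatrix r) u v = true ↔
    ∃ (hu : u < n) (hv : v < n), r ⟨u, hu⟩ ⟨v, hv⟩ := by
  rw [entry, boolMatrix, headD_drop_ofFn]
  by_cases hu : u < n
  · rw [dif_pos hu, headD_drop_ofFn]
    by_cases hv : v < n <;> simp [hu, hv]
  · simp [hu]

variable (J : Instance n)

theorem adj_toInput {u v : ℕ} : J.toInput.adj u v = true ↔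
    ∃ (hu : u < n) (hv : v < n), J.graph.Adj ⟨u, hu⟩ ⟨v, hv⟩ := entry_boolMatrix _ _ _

theorem mk_toInput {u v : ℕ} : J.toInput.mk u v = true ↔
    ∃ (hu : u < n) (hv : v < n), s((⟨u, hu⟩ : Fin n), ⟨v, hv⟩) ∈ J.marked := entry_boolMatrix _ _ _

theorem tm_toInput {u : ℕ} : J.toInput.tm u = true ↔ ∃ hu : u < n, ⟨u, hu⟩ ∈ J.terminals := by
  rw [Input.tm, toInput, headD_drop_ofFn]
  by_cases hu : u < n <;> simp [hu]

theorem n_toInput : J.toInput.n = n := by simp [Input.n, toInput]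

theorem k_toInput : J.toInput.k = J.k := rfl

theorem valid_toInput (hJ : IsSplit J.graph) : J.toInput.Valid where
  adj_lt u v h := by
    obtain ⟨hu, hv, -⟩ := J.adj_toInput.1 h
    rw [n_toInput]
    exact ⟨hu, hv⟩
  adj_symm u v h := by
    obtain ⟨hu, hv, h⟩ := J.adj_toInput.1 h
    exact J.adj_toInput.2 ⟨hv, hu, h.symm⟩
  adj_ne u v h := by
    obtain ⟨hu, hv, h⟩ := J.adj_toInput.1 h
    exact fun e => h.ne (Fin.ext e)
  mk_symm u v h := by
    obtain ⟨hu, hv, h⟩ := J.mk_toInput.1 h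
    exact J.mk_toInput.2 ⟨hv, hu, by rwa [Sym2.eq_swap]⟩
  mk_adj u v h := by
    obtain ⟨hu, hv, h⟩ := J.mk_toInput.1 h
    exact J.adj_toInput.2 ⟨hu, hv, J.marked_subset h⟩
  split := by
    obtain ⟨I, K, -, hIK, hI, hK⟩ := hJ
    refine ⟨fun u => ∃ hu : u < n, ⟨u, hu⟩ ∈ K, ?_, ?_⟩
    · rintro u v - - huv ⟨hu, hu'⟩ ⟨hv, hv'⟩
      exact J.adj_toInput.2 ⟨hu, hv, hK hu' hv' fun e => huv (Fin.ext_iff.1 e)⟩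
    · intro u v h
      obtain ⟨hu, hv, h⟩ := J.adj_toInput.1 h
      have hmem : ∀ x, x ∈ I ∪ K := fun x => by rw [hIK]; trivial
      rcases hmem ⟨u, hu⟩ with h1 | h1
      · rcases hmem ⟨v, hv⟩ with h2 | h2
        · exact absurd h (hI h1 h2 h.ne)
        · exact Or.inr ⟨hv, h2⟩
      · exact Or.inl ⟨hu, h1⟩

theorem isSolution_iff (hJ : IsSplit J.graph) {X : ℕ → Bool} {S : Finset (Fin n)}
    (hX : ∀ v : Fin n, X v = true ↔ v ∉ S) : J.IsSolution S ↔ J.toInput.Sol X := by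
  rw [IsSolution, isSubsetFVS_iff hJ, Input.Sol]
  refine and_congr ⟨fun h u v w hu hv hw huv hvw huw => ?_, fun h u v w hu hv hw huv hvw huw => ?_⟩
    ⟨fun h u v hu hv => ?_, fun h e => ?_⟩
  · obtain ⟨hun, hvn, huv'⟩ := J.adj_toInput.1 huv
    obtain ⟨_, hwn, hvw'⟩ := J.adj_toInput.1 hvw
    obtain ⟨_, _, huw'⟩ := J.adj_toInput.1 huw
    by_contra ht
    obtain ⟨_, ht'⟩ := J.tm_toInput.1 ((Bool.not_eq_false _).mp ht)
    exact h _ _ _ ((hX ⟨u, hun⟩).1 hu) ((hX ⟨v, hvn⟩).1 hv) ((hX ⟨w, hwn⟩).1 hw) huv' hvw' huw' ht'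
  · intro ht
    have := h u v w ((hX u).2 hu) ((hX v).2 hv) ((hX w).2 hw) (J.adj_toInput.2 ⟨u.2, v.2, huv⟩)
      (J.adj_toInput.2 ⟨v.2, w.2, hvw⟩) (J.adj_toInput.2 ⟨u.2, w.2, huw⟩)
    rw [J.tm_toInput.2 ⟨u.2, ht⟩] at this
    exact Bool.noConfusion this
  · by_contra hm
    obtain ⟨hun, hvn, hm⟩ := J.mk_toInput.1 ((Bool.not_eq_false _).mp hm)
    obtain ⟨x, hx, hxS⟩ := h _ hm
    rcases Sym2.mem_iff.1 hx with rfl | rfl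
    exacts [(hX _).1 hu hxS, (hX _).1 hv hxS]
  · induction e using Sym2.ind with
    | _ u v =>
      intro hm
      by_contra hc
      push Not at hc
      have := h u v ((hX u).2 (hc u (by simp))) ((hX v).2 (hc v (by simp)))
      rw [J.mk_toInput.2 ⟨u.2, v.2, hm⟩] at this
      exact Bool.noConfusion this

theorem countP_verts_toInput {X : ℕ → Bool} {S : Finset (Fin n)}
    (hX : ∀ v : Fin n, X v = true ↔ v ∉ S) : J.toInput.verts.countP (fun u => !X u) = S.card := by
  rw [Input.verts, n_toInput, List.countP_eq_length_filter,
    ← List.toFinset_card_of_nodup (List.nodup_range.filter _),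
    ← Finset.card_map Fin.valEmbedding (s := S)]
  congr 1
  ext v
  simp only [List.mem_toFinset, List.mem_filter, List.mem_range, Bool.not_eq_true',
    Finset.mem_map, Fin.valEmbedding_apply]
  constructor
  · rintro ⟨hv, h⟩
    refine ⟨⟨v, hv⟩, ?_, rfl⟩
    by_contra hc
    simp [(hX ⟨v, hv⟩).2 hc] at h
  · rintro ⟨v, hv, rfl⟩
    refine ⟨v.2, ?_⟩
    by_contra hc
    exact (hX v).1 (by simpa using hc) hv

theorem isYes_iff (hJ : IsSplit J.graph) : J.IsYes ↔
    ∃ X, J.toInput.Sol X ∧ J.toInput.verts.countP (fun u => !X u) ≤ J.toInput.k := by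
  constructor
  · rintro ⟨S, hk, hS⟩
    have hX : ∀ v : Fin n, (decide ¬∃ w ∈ S, (w : ℕ) = v) = true ↔ v ∉ S := by
      intro v
      simp only [decide_eq_true_eq, not_iff_not]
      exact ⟨fun ⟨w, hw, e⟩ => Fin.ext e ▸ hw, fun h => ⟨v, h, rfl⟩⟩
    refine ⟨fun u => decide ¬∃ w ∈ S, (w : ℕ) = u, (J.isSolution_iff hJ hX).1 hS, ?_⟩
    rw [J.countP_verts_toInput (S := S) hX]
    exact hk
  · rintro ⟨X, hX, hk⟩
    have h : ∀ v : Fin n, X v = true ↔ v ∉ Finset.univ.filter fun v : Fin n => X v = false := by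
      intro v
      simp
    rw [J.countP_verts_toInput h] at hk
    exact ⟨_, hk, (J.isSolution_iff hJ h).2 hX⟩

theorem sz_ofFn_le {α : Type} [Enc α] (f : Fin n → α) {c : ℕ} (h : ∀ u, sz (f u) ≤ c) :
    sz (List.ofFn f) ≤ 1 + n * (1 + c) := by
  induction n with
  | zero => simp
  | succ n ih =>
    rw [List.ofFn_succ, sz_cons]
    have h1 := ih (fun u => f u.succ) fun u => h _
    have h2 := h 0
    rw [Nat.add_mul]
    omega

theorem sz_boolMatrix_le (r : Fin n → Fin n → Prop) : sz (boolMatrix r) ≤ 1 + n * (2 + n * 4) :=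
  (sz_ofFn_le _ fun _ => sz_ofFn_le _ fun _ => sz_bool_le _).trans (by ring_nf; rfl)

theorem sz_toInput_le : sz J.toInput + 1 ≤ 14 * ((n + 1) ^ 2 * (J.k + 1)) := by
  have h1 := sz_boolMatrix_le J.graph.Adj
  have h2 := sz_boolMatrix_le (fun u v => s(u, v) ∈ J.marked)
  have h3 : sz J.toInput.2.1 ≤ 1 + n * (1 + 3) := sz_ofFn_le _ fun _ => sz_bool_le _
  have h4 : sz J.toInput = 1 + sz (boolMatrix J.graph.Adj) + (1 + sz J.toInput.2.1
      + (1 + sz (boolMatrix (fun u v => s(u, v) ∈ J.marked)) + (1 + sz J.k + 1))) := rfl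
  rw [sz_nat] at h4
  nlinarith [Nat.zero_le (n ^ 2 * J.k), Nat.zero_le (n * J.k), sq n]

end Instance

/-! ### Numerical estimates for the running time. -/

theorem exists_pow_le_mul_pow (d : ℕ) {r : ℝ} (hr : 1 < r) :
    ∃ B : ℕ, ∀ j : ℕ, ((j : ℝ) + 1) ^ d ≤ B * r ^ j := by
  obtain ⟨B, hB⟩ := (tendsto_pow_const_div_const_pow_of_one_lt d hr).bddAbove_range
  refine ⟨⌈B * r⌉₊, fun j => ?_⟩
  have h : ((j + 1 : ℕ) : ℝ) ^ d / r ^ (j + 1) ≤ B := hB ⟨j + 1, rfl⟩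
  have h0 : 0 < r := by linarith
  rw [div_le_iff₀ (by positivity), pow_succ] at h
  push_cast at h
  calc ((j : ℝ) + 1) ^ d ≤ B * r * r ^ j := by linarith
    _ ≤ _ := by gcongr; exact Nat.le_ceil _

/-- A polynomial overhead in the parameter is absorbed if the parameter may be capped. -/
theorem exists_pow_mul_pow_min_le (d : ℕ) {r : ℝ} (hr : 1 < r) :
    ∃ B : ℕ, ∀ n k : ℕ, ((k : ℝ) + 1) ^ d * r ^ min k n ≤ B * ((n : ℝ) + 1) ^ d * r ^ k := by
  obtain ⟨B, hB⟩ := exists_pow_le_mul_pow d hr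
  refine ⟨B, fun n k => ?_⟩
  have h0 : 0 < r := by linarith
  -- The part of `k` beyond `n` is not used by the search, so the unused factor `r ^ (k - n)`
  -- swallows its polynomial contribution.
  have h1 : (k : ℝ) + 1 ≤ ((n : ℝ) + 1) * (((k - n : ℕ) : ℝ) + 1) := by
    have : k + 1 ≤ (n + 1) * (k - n + 1) := by
      have : k ≤ n + (k - n) := by omega
      nlinarith [Nat.zero_le (n * (k - n))]
    exact_mod_cast this
  calc ((k : ℝ) + 1) ^ d * r ^ min k n
      ≤ (((n : ℝ) + 1) * (((k - n : ℕ) : ℝ) + 1)) ^ d * r ^ min k n := by gcongr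
    _ = ((n : ℝ) + 1) ^ d * ((((k - n : ℕ) : ℝ) + 1) ^ d * r ^ min k n) := by
      rw [mul_pow, mul_assoc]
    _ ≤ ((n : ℝ) + 1) ^ d * (B * r ^ (k - n) * r ^ min k n) := by
      gcongr
      exact hB _
    _ = B * ((n : ℝ) + 1) ^ d * r ^ k := by
      rw [mul_assoc (B : ℝ), ← pow_add, show k - n + min k n = k by omega]
      ring

/-- With `β ^ 3 = 1.82` the inequality reads `β + 1 ≤ 1.82 * β`, that is, `β ≥ 1 / 0.82`. The number
1.2196 lies above this threshold, and its cube is below 1.82. -/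
theorem exists_base : ∃ β : ℝ, 1 ≤ β ∧ β + 1 ≤ β ^ 4 ∧ β ^ 3 = 1.820 := by
  have h3 : ((1.820 : ℝ) ^ (1 / 3 : ℝ)) ^ 3 = 1.820 := by
    rw [← Real.rpow_natCast, ← Real.rpow_mul (by norm_num)]
    norm_num
  set β := (1.820 : ℝ) ^ (1 / 3 : ℝ)
  have h : 1.2196 ≤ β := by
    refine le_of_pow_le_pow_left₀ (n := 3) (by norm_num) (by positivity) ?_
    rw [h3]
    norm_num
  refine ⟨β, by linarith, ?_, h3⟩
  rw [pow_succ, h3]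
  linarith

end SFVS

/-- Subset feedback vertex set with marked edges can be solved in split graphs in time
`O*(1.820 ^ k)`: one program decides all instances whose graph is a split graph, within
`C * (n + 1) ^ d * 1.820 ^ k` steps, where `n` is the number of vertices. -/
theorem mainTheorem1 :
    ∃ (p : SFVS.Prog) (C d : ℕ), ∀ (n : ℕ) (J : SFVS.Instance n), SFVS.IsSplit J.graph →
      ∃ t : ℕ, SFVS.Runs p J.encode (SFVS.Instance.bit J.IsYes) t ∧
        (t : ℝ) ≤ (C : ℝ) * ((n : ℝ) + 1) ^ d * (1.820 : ℝ) ^ J.k := by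
  classical
  obtain ⟨β, hβ, hβ', hβ3⟩ := SFVS.exists_base
  obtain ⟨p, b, hp⟩ := SFVS.exists_search_prog (SFVS.PT.input_prep SFVS.PT.id) hβ hβ'
  obtain ⟨c, d, hb⟩ := SFVS.eval_le_pow b
  obtain ⟨B, hB⟩ := SFVS.exists_pow_mul_pow_min_le d (r := 1.820) (by norm_num)
  -- The input has size at most `14 * (n + 1) ^ 2 * (k + 1)`. The matrices thus contribute the
  -- exponent `2 * d`, and absorbing the factor `(k + 1) ^ d` contributes another `d`.
  refine ⟨p, c * 14 ^ d * B, 3 * d, fun n J hJ => ?_⟩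
  have hv := J.valid_toInput hJ
  obtain ⟨hlen, hwf⟩ := SFVS.Input.prep_wf hv
  obtain ⟨t, ht, hle⟩ := hp J.toInput (min J.k n) (decide J.IsYes) hlen
    (by rwa [J.n_toInput, J.k_toInput] at hwf)
    (by rw [decide_eq_true_eq, J.isYes_iff hJ, SFVS.Input.prep_correct hv])
  refine ⟨t, ?_, hle.trans ?_⟩
  · rw [J.enc_toInput] at ht
    convert ht using 1
    unfold SFVS.Instance.bit
    congr!
  · rw [hβ3]
    have h1 : b.eval (SFVS.sz J.toInput) ≤ c * (14 * ((n + 1) ^ 2 * (J.k + 1))) ^ d :=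
      (hb _).trans (by gcongr; exact J.sz_toInput_le)
    have h2 : ((b.eval (SFVS.sz J.toInput) : ℕ) : ℝ)
        ≤ c * (14 * (((n : ℝ) + 1) ^ 2 * ((J.k : ℝ) + 1))) ^ d := by exact_mod_cast h1
    calc ((b.eval (SFVS.sz J.toInput) : ℕ) : ℝ) * 1.820 ^ min J.k n
        ≤ c * (14 * (((n : ℝ) + 1) ^ 2 * ((J.k : ℝ) + 1))) ^ d * 1.820 ^ min J.k n := by gcongr
      _ = c * 14 ^ d * (((n : ℝ) + 1) ^ 2) ^ d * (((J.k : ℝ) + 1) ^ d * 1.820 ^ min J.k n) := by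
        rw [mul_pow, mul_pow]
        ring
      _ ≤ c * 14 ^ d * (((n : ℝ) + 1) ^ 2) ^ d * (B * ((n : ℝ) + 1) ^ d * 1.820 ^ J.k) := by
        exact mul_le_mul_of_nonneg_left (hB n J.k) (by positivity)
      _ = _ := by
        push_cast
        rw [← pow_mul]
        ring
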